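/- Let $k$ be a field, let $A$ be a finite-dimensional associative unital $k$-algebra and let $B\subseteq A$ be a unital $k$-subalgebra. For a $k$-algebra $C$ put $C^e=C\otimes_k C^{op}$, so that left $C^e$-modules are the $C$-$C$-bimodules on which $k$ acts centrally, and regard $A/B$ as a $B$-$B$-bimodule. Put $(A/B)^{\otimes_B 0}=B$ and $(A/B)^{\otimes_B (j+1)}=(A/B)\otimes_B (A/B)^{\otimes_B j}$. Suppose that 1. $A/B$ has finite projective dimension as a $B^e$-module; 2. $(A/B)^{\otimes_B p}=0$ for some integer $p\ge 0$; 3. $\operatorname{Tor}_i^B\bigl(A/B,(A/B)^{\otimes_B j}\bigr)=0$ for all integers $i,j\ge 1$. Then there is a singular equivalence of Morita type with level between $A$ and $B$. That is, there exist an integer $l\ge 0$, an $A$-$B$-bimodule $M$ and a $B$-$A$-bimodule $N$ (with $k$ acting centrally on both) such that $M$ is finitely generated and projective as a left $A$-module and as a right $B$-module, $N$ is finitely generated and projective as a left $B$-module and as a right $A$-module, and $$M\otimes_B N\cong \Omega^l_{A^e}(A)\ \text{ in } \underline{\mathrm{mod}}\,A^e,\qquad N\otimes_A M\cong \Omega^l_{B^e}(B)\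 \text{ in } \underline{\mathrm{mod}}\,B^e .$$ Here $\underline{\mathrm{mod}}\,R$ is the stable category of finitely generated left $R$-modules (morphisms modulo those that factor through a finitely generated projective module), and $\Omega^l_R(X)$ is the $l$-th syzygy of $X$, i.e. the module $K$ in an exact sequence $0\to K\to P_{l-1}\to\cdots\to P_0\to X\to 0$ with all $P_i$ finitely generated projective; it is unique up to isomorphism in $\underline{\mathrm{mod}}\,R$. -/

import Mathlib

open CategoryTheory MulOpposite
open scoped TensorProduct

universe v u

noncomputable section

/-! ### Tensor products and `Tor` over a noncommutative ring -/

section Balanced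

variable (R : Type u) [Ring R]

/-- The subgroup of `M ⊗[ℤ] N` generated by all `(m·r) ⊗ n - m ⊗ (r·n)`, for a right `R`-module `M`
(that is, a left `Rᵐᵒᵖ`-module) and a left `R`-module `N`. -/
def balancedRel (M N : Type u) [AddCommGroup M] [Module Rᵐᵒᵖ M] [AddCommGroup N] [Module R N] :
    AddSubgroup (M ⊗[ℤ] N) :=
  AddSubgroup.closure
    {z | ∃ (m : M) (r : R) (n : N), z = (op r • m) ⊗ₜ[ℤ] n - m ⊗ₜ[ℤ] (r • n)}

/-- The tensor product `M ⊗_R N` of a right `R`-module `M` and a left `R`-module `N` over a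
possibly noncommutative ring `R`. -/
def BalancedTensor (M N : Type u) [AddCommGroup M] [Module Rᵐᵒᵖ M] [AddCommGroup N]
    [Module R N] : Type u :=
  (M ⊗[ℤ] N) ⧸ balancedRel R M N

instance (M N : Type u) [AddCommGroup M] [Module Rᵐᵒᵖ M] [AddCommGroup N] [Module R N] :
    AddCommGroup (BalancedTensor R M N) :=
  inferInstanceAs (AddCommGroup ((M ⊗[ℤ] N) ⧸ balancedRel R M N))

namespace BalancedTensor

variable {M M' N N' : Type u}
  [AddCommGroup M] [Module Rᵐᵒᵖ M] [AddCommGroup M'] [Module Rᵐᵒᵖ M']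
  [AddCommGroup N] [Module R N] [AddCommGroup N'] [Module R N']

variable (M N) in
/-- The quotient map `M ⊗[ℤ] N → M ⊗_R N`. -/
def mk : M ⊗[ℤ] N →+ BalancedTensor R M N :=
  QuotientAddGroup.mk' (balancedRel R M N)

/-- The pure tensor `m ⊗ n` in `M ⊗_R N`. -/
def tmul (m : M) (n : N) : BalancedTensor R M N :=
  mk R M N (m ⊗ₜ[ℤ] n)

theorem smul_tmul (m : M) (r : R) (n : N) : tmul R (op r • m) n = tmul R m (r • n) := by
  rw [← sub_eq_zero, tmul, tmul, ← map_sub]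
  exact (QuotientAddGroup.eq_zero_iff _).2 (AddSubgroup.subset_closure ⟨m, r, n, rfl⟩)

theorem tmul_add (m : M) (n n' : N) : tmul R m (n + n') = tmul R m n + tmul R m n' := by
  rw [tmul, TensorProduct.tmul_add, map_add]; rfl

theorem add_tmul (m m' : M) (n : N) : tmul R (m + m') n = tmul R m n + tmul R m' n := by
  rw [tmul, TensorProduct.add_tmul, map_add]; rfl

theorem zero_tmul (n : N) : tmul R (0 : M) n = 0 := by
  rw [tmul, TensorProduct.zero_tmul, map_zero]

theorem tmul_zero (m : M) : tmul R m (0 : N) = 0 := by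
  rw [tmul, TensorProduct.tmul_zero, map_zero]

/-- The map `f ⊗ g : M ⊗_R N → M' ⊗_R N'`. -/
def map (f : M →ₗ[Rᵐᵒᵖ] M') (g : N →ₗ[R] N') :
    BalancedTensor R M N →+ BalancedTensor R M' N' :=
  QuotientAddGroup.map (balancedRel R M N) (balancedRel R M' N')
    (TensorProduct.map f.toAddMonoidHom.toIntLinearMap
      g.toAddMonoidHom.toIntLinearMap).toAddMonoidHom (by
      refine (AddSubgroup.closure_le _).2 ?_
      rintro _ ⟨m, r, n, rfl⟩
      refine AddSubgroup.subset_closure ⟨f m, r, g n, ?_⟩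
      rw [map_sub, ← map_smul, ← map_smul]
      rfl)

@[simp]
theorem map_tmul (f : M →ₗ[Rᵐᵒᵖ] M') (g : N →ₗ[R] N') (m : M) (n : N) :
    map R f g (tmul R m n) = tmul R (f m) (g n) := rfl

variable {R} in
/-- Two additive maps out of `M ⊗_R N` agree if they agree on pure tensors. -/
theorem hom_ext {P : Type*} [AddCommGroup P] {f g : BalancedTensor R M N →+ P}
    (h : ∀ m n, f (tmul R m n) = g (tmul R m n)) : f = g := by
  refine AddMonoidHom.ext fun x => ?_
  obtain ⟨x, rfl⟩ : ∃ y, mk R M N y = x := QuotientAddGroup.mk'_surjective _ x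
  induction x with
  | zero => rw [map_zero, map_zero, map_zero]
  | tmul m n => exact h m n
  | add x y hx hy => rw [map_add, map_add, map_add, hx, hy]

theorem map_id : map R (LinearMap.id : M →ₗ[Rᵐᵒᵖ] M) (LinearMap.id : N →ₗ[R] N) =
    AddMonoidHom.id _ :=
  hom_ext fun _ _ => rfl

end BalancedTensor

/-- The functor `M ⊗_R -` from left `R`-modules to abelian groups. -/
def balancedTensorFunctor (M : ModuleCat.{u} Rᵐᵒᵖ) : ModuleCat.{u} R ⥤ AddCommGrpCat.{u} where
  obj N := AddCommGrpCat.of (BalancedTensor R M N)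
  map g := AddCommGrpCat.ofHom (BalancedTensor.map R LinearMap.id g.hom)
  map_id N := congrArg AddCommGrpCat.ofHom (BalancedTensor.map_id R)
  map_comp f g := by
    rw [← AddCommGrpCat.ofHom_comp]
    exact congrArg AddCommGrpCat.ofHom (BalancedTensor.hom_ext fun _ _ => rfl)

instance balancedTensorFunctor_additive (M : ModuleCat.{u} Rᵐᵒᵖ) :
    (balancedTensorFunctor R M).Additive where
  map_add {_ _ f g} := congrArg AddCommGrpCat.ofHom
    (BalancedTensor.hom_ext (f := BalancedTensor.map R LinearMap.id (f + g).hom)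
      (g := BalancedTensor.map R LinearMap.id f.hom + BalancedTensor.map R LinearMap.id g.hom)
      fun m n => BalancedTensor.tmul_add R m (f.hom n) (g.hom n))

/-- `Tor_i^R(M, N)` for a right `R`-module `M` and a left `R`-module `N`: the `i`-th left derived
functor of `M ⊗_R -`, evaluated at `N`. -/
def ncTor (i : ℕ) (M : ModuleCat.{u} Rᵐᵒᵖ) (N : ModuleCat.{u} R) : AddCommGrpCat.{u} :=
  ((balancedTensorFunctor R M).leftDerived i).obj N

end Balanced

/-! ### Bimodules over algebras -/

section Bimodules

variable (k : Type v) [Field k]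

/-- `A`-`B`-bimodules on which `k` acts centrally, that is, left modules over `A ⊗[k] Bᵐᵒᵖ`. -/
abbrev KBimodule (A B : Type u) [Ring A] [Algebra k A] [Ring B] [Algebra k B] :=
  ModuleCat.{u} (A ⊗[k] Bᵐᵒᵖ)

namespace KBimodule

variable {k}
variable {A B C : Type u} [Ring A] [Algebra k A] [Ring B] [Algebra k B] [Ring C] [Algebra k C]

/-- The left `A`-module underlying an `A`-`B`-bimodule: `a·m = (a ⊗ 1)·m`. -/
abbrev left (M : KBimodule k A B) : ModuleCat.{u} A :=
  (ModuleCat.restrictScalars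
    (Algebra.TensorProduct.includeLeft : A →ₐ[k] A ⊗[k] Bᵐᵒᵖ).toRingHom).obj M

/-- The right `B`-module underlying an `A`-`B`-bimodule: `m·b = (1 ⊗ op b)·m`. -/
abbrev right (M : KBimodule k A B) : ModuleCat.{u} Bᵐᵒᵖ :=
  (ModuleCat.restrictScalars
    (Algebra.TensorProduct.includeRight : Bᵐᵒᵖ →ₐ[k] A ⊗[k] Bᵐᵒᵖ).toRingHom).obj M

/-- Left multiplication by `a` on an `A`-`B`-bimodule, as a map of right `B`-modules. -/
def lmul (M : KBimodule k A B) (a : A) : M.right →ₗ[Bᵐᵒᵖ] M.right where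
  toFun := fun m : M => (a ⊗ₜ[k] (1 : Bᵐᵒᵖ)) • m
  map_add' x y := smul_add (a ⊗ₜ[k] (1 : Bᵐᵒᵖ)) (show M from x) (show M from y)
  map_smul' b x := by
    change (a ⊗ₜ[k] (1 : Bᵐᵒᵖ)) • (((1 : A) ⊗ₜ[k] b) • (show M from x)) =
      ((1 : A) ⊗ₜ[k] b) • ((a ⊗ₜ[k] (1 : Bᵐᵒᵖ)) • (show M from x))
    rw [← mul_smul, ← mul_smul]
    simp

/-- Right multiplication by `b` on an `A`-`B`-bimodule, as a map of left `A`-modules. -/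
def rmul (M : KBimodule k A B) (b : Bᵐᵒᵖ) : M.left →ₗ[A] M.left where
  toFun := fun m : M => ((1 : A) ⊗ₜ[k] b) • m
  map_add' x y := smul_add ((1 : A) ⊗ₜ[k] b) (show M from x) (show M from y)
  map_smul' a x := by
    change ((1 : A) ⊗ₜ[k] b) • ((a ⊗ₜ[k] (1 : Bᵐᵒᵖ)) • (show M from x)) =
      (a ⊗ₜ[k] (1 : Bᵐᵒᵖ)) • (((1 : A) ⊗ₜ[k] b) • (show M from x))
    rw [← mul_smul, ← mul_smul]
    simp

/-- The underlying group of `M ⊗_B N`, for an `A`-`B`-bimodule `M` and a `B`-`C`-bimodule `N`. -/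
abbrev TensorCarrier (M : KBimodule k A B) (N : KBimodule k B C) : Type u :=
  BalancedTensor B M.right N.left

/-- The left action of `A` on `M ⊗_B N`: `a·(m ⊗ n) = (a·m) ⊗ n`. -/
def tensorLeftAct (M : KBimodule k A B) (N : KBimodule k B C) :
    A →+* AddMonoid.End (TensorCarrier M N) where
  toFun a := BalancedTensor.map B (lmul M a) LinearMap.id
  map_one' := BalancedTensor.hom_ext fun m n =>
    congrArg (fun x => BalancedTensor.tmul B x n) (one_smul (A ⊗[k] Bᵐᵒᵖ) (show M from m))
  map_zero' := BalancedTensor.hom_ext fun m n => by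
    have h : lmul M 0 m = 0 := by
      change ((0 : A) ⊗ₜ[k] (1 : Bᵐᵒᵖ)) • (show M from m) = 0
      rw [TensorProduct.zero_tmul]
      exact zero_smul (A ⊗[k] Bᵐᵒᵖ) (show M from m)
    rw [BalancedTensor.map_tmul, h, BalancedTensor.zero_tmul]
    rfl
  map_mul' a a' := BalancedTensor.hom_ext fun m n => by
    have h : lmul M (a * a') m = lmul M a (lmul M a' m) := by
      change ((a * a') ⊗ₜ[k] (1 : Bᵐᵒᵖ)) • (show M from m) =
        (a ⊗ₜ[k] (1 : Bᵐᵒᵖ)) • ((a' ⊗ₜ[k] (1 : Bᵐᵒᵖ)) • (show M from m))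
      rw [← mul_smul]
      simp
    exact congrArg (fun x => BalancedTensor.tmul B x n) h
  map_add' a a' := BalancedTensor.hom_ext fun m n => by
    have h : lmul M (a + a') m = lmul M a m + lmul M a' m := by
      change ((a + a') ⊗ₜ[k] (1 : Bᵐᵒᵖ)) • (show M from m) =
        (a ⊗ₜ[k] (1 : Bᵐᵒᵖ)) • (show M from m) + (a' ⊗ₜ[k] (1 : Bᵐᵒᵖ)) • (show M from m)
      rw [← add_smul, TensorProduct.add_tmul]
    exact (congrArg (fun x => BalancedTensor.tmul B x n) h).trans (BalancedTensor.add_tmul B _ _ _)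

/-- The right action of `C` on `M ⊗_B N`: `(m ⊗ n)·c = m ⊗ (n·c)`. -/
def tensorRightAct (M : KBimodule k A B) (N : KBimodule k B C) :
    Cᵐᵒᵖ →+* AddMonoid.End (TensorCarrier M N) where
  toFun c := BalancedTensor.map B LinearMap.id (rmul N c)
  map_one' := BalancedTensor.hom_ext fun m n =>
    congrArg (fun x => BalancedTensor.tmul B m x) (one_smul (B ⊗[k] Cᵐᵒᵖ) (show N from n))
  map_zero' := BalancedTensor.hom_ext fun m n => by
    have h : rmul N 0 n = 0 := by
      change ((1 : B) ⊗ₜ[k] (0 : Cᵐᵒᵖ)) • (show N from n) = 0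
      rw [TensorProduct.tmul_zero]
      exact zero_smul (B ⊗[k] Cᵐᵒᵖ) (show N from n)
    rw [BalancedTensor.map_tmul, h, BalancedTensor.tmul_zero]
    rfl
  map_mul' c c' := BalancedTensor.hom_ext fun m n => by
    have h : rmul N (c * c') n = rmul N c (rmul N c' n) := by
      change ((1 : B) ⊗ₜ[k] (c * c')) • (show N from n) =
        ((1 : B) ⊗ₜ[k] c) • (((1 : B) ⊗ₜ[k] c') • (show N from n))
      rw [← mul_smul]
      simp
    exact congrArg (BalancedTensor.tmul B m) h
  map_add' c c' := BalancedTensor.hom_ext fun m n => by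
    have h : rmul N (c + c') n = rmul N c n + rmul N c' n := by
      change ((1 : B) ⊗ₜ[k] (c + c')) • (show N from n) =
        ((1 : B) ⊗ₜ[k] c) • (show N from n) + ((1 : B) ⊗ₜ[k] c') • (show N from n)
      rw [← add_smul, TensorProduct.tmul_add]
    exact (congrArg (BalancedTensor.tmul B m) h).trans (BalancedTensor.tmul_add B _ _ _)

theorem tensorAct_comm (M : KBimodule k A B) (N : KBimodule k B C) (a : A) (c : Cᵐᵒᵖ)
    (x : TensorCarrier M N) :
    tensorLeftAct M N a (tensorRightAct M N c x) =
      tensorRightAct M N c (tensorLeftAct M N a x) :=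
  DFunLike.congr_fun (BalancedTensor.hom_ext
    (f := (tensorLeftAct M N a).comp (tensorRightAct M N c))
    (g := (tensorRightAct M N c).comp (tensorLeftAct M N a)) fun _ _ => rfl) x

/-- The two actions of `k` on `M ⊗_B N`, through `A` and through `C`, agree. -/
theorem tensorAct_algebraMap (M : KBimodule k A B) (N : KBimodule k B C) (t : k)
    (x : TensorCarrier M N) :
    tensorRightAct M N (algebraMap k Cᵐᵒᵖ t) x = tensorLeftAct M N (algebraMap k A t) x := by
  refine DFunLike.congr_fun (BalancedTensor.hom_ext fun m n => ?_) x
  have h₁ : lmul M (algebraMap k A t) m = op (algebraMap k B t) • m := by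
    change ((algebraMap k A t) ⊗ₜ[k] (1 : Bᵐᵒᵖ)) • (show M from m) =
      ((1 : A) ⊗ₜ[k] (algebraMap k Bᵐᵒᵖ t)) • (show M from m)
    rw [Algebra.algebraMap_eq_smul_one, Algebra.algebraMap_eq_smul_one, TensorProduct.smul_tmul]
  have h₂ : rmul N (algebraMap k Cᵐᵒᵖ t) n = algebraMap k B t • n := by
    change ((1 : B) ⊗ₜ[k] (algebraMap k Cᵐᵒᵖ t)) • (show N from n) =
      ((algebraMap k B t) ⊗ₜ[k] (1 : Cᵐᵒᵖ)) • (show N from n)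
    rw [Algebra.algebraMap_eq_smul_one, Algebra.algebraMap_eq_smul_one, TensorProduct.smul_tmul]
  change BalancedTensor.tmul B m (rmul N (algebraMap k Cᵐᵒᵖ t) n) =
    BalancedTensor.tmul B (lmul M (algebraMap k A t) m) n
  rw [h₁, h₂, BalancedTensor.smul_tmul]

/-- The `A ⊗ Cᵐᵒᵖ`-module structure on `M ⊗_B N` given by the two commuting actions. -/
@[reducible]
def tensorModule (M : KBimodule k A B) (N : KBimodule k B C) :
    Module (A ⊗[k] Cᵐᵒᵖ) (TensorCarrier M N) :=
  letI : Module A (TensorCarrier M N) := Module.compHom _ (tensorLeftAct M N)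
  letI : Module Cᵐᵒᵖ (TensorCarrier M N) := Module.compHom _ (tensorRightAct M N)
  letI : Module k (TensorCarrier M N) := Module.compHom _ (algebraMap k A)
  haveI : SMulCommClass A Cᵐᵒᵖ (TensorCarrier M N) := ⟨tensorAct_comm M N⟩
  haveI : IsScalarTower k A (TensorCarrier M N) := ⟨fun t a x => by
    rw [Algebra.smul_def, mul_smul]; rfl⟩
  haveI : IsScalarTower k Cᵐᵒᵖ (TensorCarrier M N) := ⟨fun t c x => by
    rw [Algebra.smul_def, mul_smul]
    exact tensorAct_algebraMap M N t (c • x)⟩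
  TensorProduct.Algebra.module

/-- The tensor product `M ⊗_B N` of an `A`-`B`-bimodule and a `B`-`C`-bimodule, as an
`A`-`C`-bimodule. -/
def tensor (M : KBimodule k A B) (N : KBimodule k B C) : KBimodule k A C :=
  letI := tensorModule M N
  ModuleCat.of (A ⊗[k] Cᵐᵒᵖ) (TensorCarrier M N)

/-- The action on `M ⊗_B N` is `(a ⊗ op c)·(m ⊗ n) = (a·m) ⊗ (n·c)`. -/
theorem tensor_smul_tmul (M : KBimodule k A B) (N : KBimodule k B C) (a : A) (c : C)
    (m : M.right) (n : N.left) :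
    (a ⊗ₜ[k] op c) • (show tensor M N from BalancedTensor.tmul B m n) =
      (show tensor M N from BalancedTensor.tmul B (lmul M a m) (rmul N (op c) n)) := rfl

variable (k A) in
/-- The algebra `A` as an `A`-`A`-bimodule: `(a ⊗ op b)·x = a * x * b`. -/
def regular : KBimodule k A A :=
  letI : Module (A ⊗[k] Aᵐᵒᵖ) A := TensorProduct.Algebra.module
  ModuleCat.of (A ⊗[k] Aᵐᵒᵖ) A

theorem regular_smul (a b x : A) :
    (a ⊗ₜ[k] op b) • (show regular k A from x) = (show regular k A from a * (x * b)) := rfl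

/-- The tensor powers `X^{⊗_B j}` of a `B`-`B`-bimodule; `X^{⊗_B 0} = B`. -/
def tensorPow (X : KBimodule k B B) : ℕ → KBimodule k B B
  | 0 => regular k B
  | j + 1 => tensor X (tensorPow X j)

end KBimodule

/-! ### The quotient bimodule of an extension -/

namespace Subalgebra

variable {k}
variable {A : Type u} [Ring A] [Algebra k A] (B : Subalgebra k A)

/-- The algebra `A` as a bimodule over its subalgebra `B`. -/
def ambientBimodule : KBimodule k B B :=
  (ModuleCat.restrictScalars
    (Algebra.TensorProduct.map B.val (AlgHom.op B.val)).toRingHom).obj (KBimodule.regular k A)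

theorem ambientBimodule_smul (b b' : B) (x : A) :
    (b ⊗ₜ[k] op b') • (show ambientBimodule B from x) =
      (show ambientBimodule B from (b : A) * (x * (b' : A))) := rfl

/-- The subalgebra `B` as a sub-bimodule of `A`. -/
def subBimodule : Submodule (B ⊗[k] Bᵐᵒᵖ) (ambientBimodule B) where
  carrier := (B : Set A)
  add_mem' := fun hx hy => B.add_mem hx hy
  zero_mem' := B.zero_mem
  smul_mem' := by
    intro c x hx
    induction c with
    | zero =>
      have h : (0 : B ⊗[k] Bᵐᵒᵖ) • x = 0 := zero_smul (B ⊗[k] Bᵐᵒᵖ) x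
      rw [h]
      exact B.zero_mem
    | tmul b b' => exact B.mul_mem b.2 (B.mul_mem hx b'.unop.2)
    | add c d hc hd =>
      have h : (c + d) • x = c • x + d • x := add_smul c d x
      rw [h]
      exact B.add_mem hc hd

/-- The quotient `A/B` as a `B`-`B`-bimodule. -/
def quotientBimodule : KBimodule k B B :=
  ModuleCat.of (B ⊗[k] Bᵐᵒᵖ) (ambientBimodule B ⧸ subBimodule B)

end Subalgebra

end Bimodules

/-! ### Stable categories and syzygies -/

section Stable

variable (R : Type u) [Ring R]

/-- Two maps of finitely generated `R`-modules are stably equal if their difference factors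
through a finitely generated projective module. -/
def stableRel : HomRel (FGModuleCat.{u} R) := fun X Y f g =>
  ∃ (P : FGModuleCat.{u} R) (i : X ⟶ P) (j : P ⟶ Y), Module.Projective R P ∧ f - g = i ≫ j

/-- The stable category of finitely generated `R`-modules: its morphisms are the `R`-linear maps
modulo those that factor through a finitely generated projective module. -/
abbrev StableFGModuleCat := CategoryTheory.Quotient (stableRel R)

variable {R}

/-- `X` and `Y` are finitely generated `R`-modules that are isomorphic in the stable category. -/
def StablyIsomorphic (X Y : ModuleCat.{u} R) : Prop :=
  ∃ (_ : Module.Finite R X) (_ : Module.Finite R Y),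
    Nonempty ((CategoryTheory.Quotient.functor (stableRel R)).obj (FGModuleCat.of R X) ≅
      (CategoryTheory.Quotient.functor (stableRel R)).obj (FGModuleCat.of R Y))

/-- `K` is an `l`-th syzygy of `X`: there is an exact sequence
`0 → K → P_{l-1} → ⋯ → P_0 → X → 0` with all `P_i` finitely generated projective. Such a `K` is
unique up to isomorphism in the stable category. -/
def IsSyzygy : ℕ → ModuleCat.{u} R → ModuleCat.{u} R → Prop
  | 0, X, K => Nonempty (K ≅ X)
  | l + 1, X, K => ∃ (P : ModuleCat.{u} R) (f : P →ₗ[R] X),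
      Module.Finite R P ∧ Module.Projective R P ∧ Function.Surjective f ∧
        IsSyzygy l (ModuleCat.of R (LinearMap.ker f)) K

/-- `Y ≅ Ω^l(X)` in the stable category of finitely generated `R`-modules. -/
def IsStablySyzygy (l : ℕ) (X Y : ModuleCat.{u} R) : Prop :=
  ∃ K : ModuleCat.{u} R, IsSyzygy l X K ∧ StablyIsomorphic Y K

end Stable

/-! ### Singular equivalences of Morita type with level -/

/-- The bimodules `M` and `N` define a singular equivalence of Morita type with level `l` between
`A` and `B`: both are finitely generated and projective on each side, and
`M ⊗_B N ≅ Ω^l_{A^e}(A)` and `N ⊗_A M ≅ Ω^l_{B^e}(B)` in the stable categories of finitely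
generated bimodules. -/
structure IsSingularEquivalenceOfMoritaType {k : Type v} [Field k] {A B : Type u} [Ring A]
    [Algebra k A] [Ring B] [Algebra k B] (M : KBimodule k A B) (N : KBimodule k B A) (l : ℕ) :
    Prop where
  finite_M_left : Module.Finite A M.left
  projective_M_left : Module.Projective A M.left
  finite_M_right : Module.Finite Bᵐᵒᵖ M.right
  projective_M_right : Module.Projective Bᵐᵒᵖ M.right
  finite_N_left : Module.Finite B N.left
  projective_N_left : Module.Projective B N.left
  finite_N_right : Module.Finite Aᵐᵒᵖ N.right
  projective_N_right : Module.Projective Aᵐᵒᵖ N.right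
  tensor_MN : IsStablySyzygy l (KBimodule.regular k A) (M.tensor N)
  tensor_NM : IsStablySyzygy l (KBimodule.regular k B) (N.tensor M)

/-- There is a singular equivalence of Morita type with level between `A` and `B`. -/
def SingularlyEquivalentOfMoritaTypeWithLevel (k : Type v) [Field k] (A B : Type u) [Ring A]
    [Algebra k A] [Ring B] [Algebra k B] : Prop :=
  ∃ (l : ℕ) (M : KBimodule k A B) (N : KBimodule k B A), IsSingularEquivalenceOfMoritaType M N l

end

-- Write `X = A/B` and let `n` bound both the projective dimension of `X` over `B^e` and that of the
-- kernel of multiplication `A ⊗_B A → A` over `A^e`. Take `U = Ω^{n+1}(B)` over `B^e`, and set `M =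
-- A ⊗_B U`, `N = U ⊗_B A`. The level is `2(n+1)`. As a one-sided `B`-module, `A` is an extension of
-- `X` by `B`, so it has projective dimension at most `n`. Since `M` and `N` are `(n+1)`-st syzygies
-- of `A`, they are projective over `B`. Over `A` they are projective because `A` is.
--
-- Over `B`: `N ⊗_A M = U ⊗_B A ⊗_B U` is an extension of `U ⊗_B X ⊗_B U` by `U ⊗_B U`. Tensoring
-- with `U` takes an `(n+1)`-st syzygy, so `U ⊗_B X` is left projective, and then `U ⊗_B X ⊗_B U` is
-- a projective bimodule. The extension splits, and `U ⊗_B U` is `Ω^{2(n+1)}(B)`. This is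
-- `stablyIsomorphic_tensor_regularL_tensor`.
--
-- Over `A`: `M ⊗_B N` is a `2(n+1)`-st syzygy of `A ⊗_B A`, because `Tor^B(A, A)` vanishes in
-- positive degrees. A surjection whose kernel has finite projective dimension does not change high
-- syzygies stably (`IsSyzygy.exists_isProjectiveExtension_of_surjective`), so multiplication `A ⊗_B
-- A → A` gives `Ω^{2(n+1)}(A)`. This is `stablyIsomorphic_regularR_tensor_tensor`.
--
-- It remains to bound that kernel (`exists_hasProjectiveDimensionLT_relSyzygy`). Put `K_0 = A` and
-- `K_{j+1} = ker (K_j ⊗_B A → K_j)`. Over `B` on the right, `v ↦ v ⊗ 1` splits the multiplication,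
-- so `K_{j+1} ≅ K_j ⊗_B X` (`mulKerEquiv`). Hence `K_j ≅ A ⊗_B X^{⊗j}` there, which is zero for `j
-- ≥ p`. The `Tor` hypothesis propagates along these tensor products (`TorIndependent.tensor`), so
-- for `j ≥ 1` the bimodule `K_j` has finite projective dimension over `A ⊗ B^op`, and `K_j ⊗_B A`
-- has finite projective dimension over `A^e`. Descending along `0 → K_{j+1} → K_j ⊗_B A → K_j → 0`
-- from `K_j = 0` reaches `K_1`.

universe w

noncomputable section

/-! ### Tensor products over a noncommutative ring: right exactness and flatness of projectives. -/

namespace BalancedTensor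

variable {R : Type u} [Ring R]
variable {M M' M'' N N' N'' : Type u}
  [AddCommGroup M] [Module Rᵐᵒᵖ M] [AddCommGroup M'] [Module Rᵐᵒᵖ M']
  [AddCommGroup M''] [Module Rᵐᵒᵖ M'']
  [AddCommGroup N] [Module R N] [AddCommGroup N'] [Module R N']
  [AddCommGroup N''] [Module R N'']

/-- The additive map out of `M ⊗_R N` induced by a balanced biadditive map. -/
def lift {P : Type w} [AddCommGroup P] (φ : M →+ N →+ P)
    (h : ∀ m (r : R) n, φ (op r • m) n = φ m (r • n)) : BalancedTensor R M N →+ P :=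
  QuotientAddGroup.lift (balancedRel R M N)
    (TensorProduct.liftAddHom φ fun z m n => by
      rw [map_zsmul, map_zsmul, AddMonoidHom.smul_apply]) (by
      refine (AddSubgroup.closure_le _).2 ?_
      rintro _ ⟨m, r, n, rfl⟩
      change TensorProduct.liftAddHom φ _ _ = 0
      rw [map_sub, TensorProduct.liftAddHom_tmul, TensorProduct.liftAddHom_tmul, h, sub_self])

@[simp]
theorem lift_tmul {P : Type w} [AddCommGroup P] (φ : M →+ N →+ P)
    (h : ∀ m (r : R) n, φ (op r • m) n = φ m (r • n)) (m : M) (n : N) :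
    lift φ h (tmul R m n) = φ m n := rfl

theorem induction_on {p : BalancedTensor R M N → Prop} (x : BalancedTensor R M N)
    (zero : p 0) (tmul : ∀ m n, p (tmul R m n)) (add : ∀ x y, p x → p y → p (x + y)) : p x := by
  obtain ⟨x, rfl⟩ : ∃ y, mk R M N y = x := QuotientAddGroup.mk'_surjective _ x
  induction x with
  | zero => rwa [map_zero]
  | tmul m n => exact tmul m n
  | add x y hx hy => rw [map_add]; exact add _ _ hx hy

theorem map_comp_apply (f : M →ₗ[Rᵐᵒᵖ] M') (g : N →ₗ[R] N') (f' : M' →ₗ[Rᵐᵒᵖ] M'')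
    (g' : N' →ₗ[R] N'') (x : BalancedTensor R M N) :
    map R f' g' (map R f g x) = map R (f'.comp f) (g'.comp g) x :=
  DFunLike.congr_fun (hom_ext (f := (map R f' g').comp (map R f g))
    (g := map R (f'.comp f) (g'.comp g)) fun _ _ => rfl) x

theorem map_surjective {f : M →ₗ[Rᵐᵒᵖ] M'} {g : N →ₗ[R] N'} (hf : Function.Surjective f)
    (hg : Function.Surjective g) : Function.Surjective (map R f g) := by
  intro x
  induction x using induction_on with
  | zero => exact ⟨0, map_zero _⟩
  | tmul m n =>
    obtain ⟨m, rfl⟩ := hf m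
    obtain ⟨n, rfl⟩ := hg n
    exact ⟨tmul R m n, rfl⟩
  | add x y hx hy =>
    obtain ⟨x, rfl⟩ := hx
    obtain ⟨y, rfl⟩ := hy
    exact ⟨x + y, map_add _ _ _⟩

variable (R) in
/-- The pure tensors as a biadditive map. -/
def tmulHom : M →+ N →+ BalancedTensor R M N where
  toFun m :=
    { toFun := fun n => tmul R m n
      map_zero' := tmul_zero R m
      map_add' := tmul_add R m }
  map_zero' := AddMonoidHom.ext fun n => zero_tmul R n
  map_add' m m' := AddMonoidHom.ext fun n => add_tmul R m m' n

@[simp]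
theorem tmulHom_apply (m : M) (n : N) : tmulHom R m n = tmul R m n := rfl

/-- Right exactness of `- ⊗_R N`. -/
theorem exact_map_left {f : M →ₗ[Rᵐᵒᵖ] M'} {g : M' →ₗ[Rᵐᵒᵖ] M''} (h : Function.Exact f g)
    (hg : Function.Surjective g) :
    Function.Exact (map R f (LinearMap.id : N →ₗ[R] N)) (map R g LinearMap.id) := by
  intro x
  constructor
  · intro hx
    -- With `q` the projection modulo the image `I` of `f ⊗ N`, a map `Φ` on `M'' ⊗ N` with `Φ ∘ (g
    -- ⊗ N) = q` puts the kernel of `g ⊗ N` inside `I`. It is built from a set-theoretic section of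
    -- `g`; by `key` the class modulo `I` does not depend on the chosen preimage, so the section
    -- need not be additive.
    let I := (map R f (LinearMap.id : N →ₗ[R] N)).range
    let q := QuotientAddGroup.mk' I
    have key : ∀ m₁ m₂ : M', g m₁ = g m₂ → ∀ n : N, q (tmul R m₁ n) = q (tmul R m₂ n) := by
      intro m₁ m₂ hm n
      obtain ⟨m, hm⟩ := (h (m₁ - m₂)).1 (by rw [map_sub, hm, sub_self])
      rw [← sub_eq_zero, ← map_sub]
      refine (QuotientAddGroup.eq_zero_iff _).2 ⟨tmul R m n, ?_⟩
      rw [map_tmul, hm]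
      change (tmulHom R).flip n (m₁ - m₂) = _
      rw [map_sub]; rfl
    let s := Function.surjInv hg
    have hs : ∀ m, g (s m) = m := Function.surjInv_eq hg
    let φ : M'' →+ N →+ (BalancedTensor R M' N ⧸ I) :=
      { toFun := fun m => q.comp (tmulHom R (s m))
        map_zero' := AddMonoidHom.ext fun n => by
          refine (key (s 0) 0 (by rw [hs, map_zero]) n).trans ?_
          rw [zero_tmul, map_zero]; rfl
        map_add' := fun a b => AddMonoidHom.ext fun n => by
          refine (key (s (a + b)) (s a + s b) (by rw [map_add, hs, hs, hs]) n).trans ?_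
          rw [add_tmul, map_add]; rfl }
    let Φ := lift (R := R) φ (fun m r n => by
      refine (key (s (op r • m)) (op r • s m) (by rw [map_smul, hs, hs]) n).trans ?_
      rw [smul_tmul]; rfl)
    have hΦ : ∀ y, Φ (map R g LinearMap.id y) = q y := fun y =>
      DFunLike.congr_fun (hom_ext (f := Φ.comp (map R g LinearMap.id)) (g := q)
        fun m n => key _ _ (hs _) n) y
    have := hΦ x
    rw [hx, map_zero] at this
    exact (QuotientAddGroup.eq_zero_iff _).1 this.symm
  · rintro ⟨y, rfl⟩
    rw [map_comp_apply]
    induction y using induction_on with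
    | zero => exact map_zero _
    | tmul m n =>
      rw [map_tmul]
      have : (g.comp f) m = 0 := (h _).2 ⟨m, rfl⟩
      rw [this, zero_tmul]
    | add x y hx hy => rw [map_add, hx, hy, add_zero]

/-- Right exactness of `M ⊗_R -`. -/
theorem exact_map_right {f : N →ₗ[R] N'} {g : N' →ₗ[R] N''} (h : Function.Exact f g)
    (hg : Function.Surjective g) :
    Function.Exact (map R (LinearMap.id : M →ₗ[Rᵐᵒᵖ] M) f) (map R LinearMap.id g) := by
  intro x
  constructor
  · intro hx
    let I := (map R (LinearMap.id : M →ₗ[Rᵐᵒᵖ] M) f).range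
    let q := QuotientAddGroup.mk' I
    have key : ∀ n₁ n₂ : N', g n₁ = g n₂ → ∀ m : M, q (tmul R m n₁) = q (tmul R m n₂) := by
      intro n₁ n₂ hn m
      obtain ⟨n, hn⟩ := (h (n₁ - n₂)).1 (by rw [map_sub, hn, sub_self])
      rw [← sub_eq_zero, ← map_sub]
      refine (QuotientAddGroup.eq_zero_iff _).2 ⟨tmul R m n, ?_⟩
      rw [map_tmul, hn]
      exact (tmulHom R m).map_sub n₁ n₂
    let s := Function.surjInv hg
    have hs : ∀ m, g (s m) = m := Function.surjInv_eq hg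
    let φ : M →+ N'' →+ (BalancedTensor R M N' ⧸ I) :=
      { toFun := fun m =>
          { toFun := fun n => q (tmul R m (s n))
            map_zero' := by
              refine (key (s 0) 0 (by rw [hs, map_zero]) m).trans ?_
              rw [tmul_zero, map_zero]
            map_add' := fun a b => by
              refine (key (s (a + b)) (s a + s b) (by rw [map_add, hs, hs, hs]) m).trans ?_
              rw [tmul_add, map_add] }
        map_zero' := AddMonoidHom.ext fun n => by
          change q (tmul R 0 _) = 0
          rw [zero_tmul, map_zero]
        map_add' := fun a b => AddMonoidHom.ext fun n => by
          change q (tmul R (a + b) _) = q (tmul R a _) + q (tmul R b _)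
          rw [add_tmul, map_add] }
    let Φ := lift (R := R) φ (fun m r n => by
      refine Eq.trans ?_ (key (r • s n) (s (r • n)) (by rw [map_smul, hs, hs]) m)
      rw [← smul_tmul]; rfl)
    have hΦ : ∀ y, Φ (map R LinearMap.id g y) = q y := fun y =>
      DFunLike.congr_fun (hom_ext (f := Φ.comp (map R LinearMap.id g)) (g := q)
        fun m n => key _ _ (hs _) m) y
    have := hΦ x
    rw [hx, map_zero] at this
    exact (QuotientAddGroup.eq_zero_iff _).1 this.symm
  · rintro ⟨y, rfl⟩
    rw [map_comp_apply]
    induction y using induction_on with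
    | zero => exact map_zero _
    | tmul m n =>
      rw [map_tmul]
      have : (g.comp f) n = 0 := (h _).2 ⟨n, rfl⟩
      rw [this, tmul_zero]
    | add x y hx hy => rw [map_add, hx, hy, add_zero]

/-- A projective right module is flat. -/
theorem map_id_injective_of_projective [Module.Projective Rᵐᵒᵖ M] {i : N →ₗ[R] N'}
    (hi : Function.Injective i) :
    Function.Injective (map R (LinearMap.id : M →ₗ[Rᵐᵒᵖ] M) i) := by
  obtain ⟨s, hs⟩ := Module.projective_def.1 ‹Module.Projective Rᵐᵒᵖ M›
  -- The section `s` of the free cover of `M` turns `M ⊗ L` into a subgroup of a direct sum of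
  -- copies of `L`, naturally in `L`. Since `Θ` retracts `Ψ N`, injectivity of `M ⊗ i` reduces to
  -- that of `i` in each coordinate.
  let Ψ : ∀ (L : Type u) [AddCommGroup L] [Module R L], BalancedTensor R M L →+ (M →₀ L) :=
    fun L _ _ => lift
      { toFun := fun m =>
          { toFun := fun n => (s m).mapRange (fun r => r.unop • n) (zero_smul _ _)
            map_zero' := by ext; simp
            map_add' := fun a b => by ext; simp }
        map_zero' := by ext; simp
        map_add' := fun a b => by ext; simp [add_smul] }
      (fun m r n => by ext; simp [mul_smul])
  let Θ : (M →₀ N) →+ BalancedTensor R M N := Finsupp.liftAddHom fun p => tmulHom R p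
  have hΘ : ∀ x, Θ (Ψ N x) = x := fun x => by
    refine DFunLike.congr_fun (hom_ext (f := Θ.comp (Ψ N)) (g := AddMonoidHom.id _)
      fun m n => ?_) x
    change Finsupp.liftAddHom (fun p => tmulHom R p)
      ((s m).mapRange (fun r => unop r • n) (zero_smul _ _)) = tmul R m n
    conv_rhs => rw [← hs m, Finsupp.linearCombination_apply]
    rw [Finsupp.liftAddHom_apply, Finsupp.sum_mapRange_index (fun a => map_zero _)]
    change _ = (tmulHom R (N := N)).flip n _
    rw [Finsupp.sum, Finsupp.sum, map_sum]
    refine Finset.sum_congr rfl fun p _ => ?_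
    exact (smul_tmul R p (s m p).unop n).symm
  have hnat : ∀ x, Ψ N' (map R LinearMap.id i x) =
      Finsupp.mapRange.addMonoidHom i.toAddMonoidHom (Ψ N x) := fun x => by
    refine DFunLike.congr_fun (hom_ext (f := (Ψ N').comp (map R LinearMap.id i))
      (g := (Finsupp.mapRange.addMonoidHom i.toAddMonoidHom).comp (Ψ N)) fun m n => ?_) x
    ext p
    exact (map_smul i (s m p).unop n).symm
  refine (injective_iff_map_eq_zero _).2 fun x hx => ?_
  have h := hnat x
  rw [hx, map_zero] at h
  have h0 : Ψ N x = 0 := by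
    refine Finsupp.mapRange_injective i.toAddMonoidHom (map_zero _) hi ?_
    rw [Finsupp.mapRange_zero]
    exact h.symm
  rw [← hΘ x, h0, map_zero]

/-- A projective left module is flat. -/
theorem map_injective_id_of_projective [Module.Projective R N] {i : M →ₗ[Rᵐᵒᵖ] M'}
    (hi : Function.Injective i) :
    Function.Injective (map R i (LinearMap.id : N →ₗ[R] N)) := by
  obtain ⟨s, hs⟩ := Module.projective_def.1 ‹Module.Projective R N›
  let Ψ : ∀ (L : Type u) [AddCommGroup L] [Module Rᵐᵒᵖ L], BalancedTensor R L N →+ (N →₀ L) :=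
    fun L _ _ => lift
      { toFun := fun m =>
          { toFun := fun n => (s n).mapRange (fun r => op r • m) (by simp)
            map_zero' := by ext; simp
            map_add' := fun a b => by ext; simp [add_smul] }
        map_zero' := by ext; simp
        map_add' := fun a b => by ext; simp }
      (fun m r n => by ext; simp [mul_smul])
  let Θ : (N →₀ M) →+ BalancedTensor R M N := Finsupp.liftAddHom fun p => (tmulHom R).flip p
  have hΘ : ∀ x, Θ (Ψ M x) = x := fun x => by
    refine DFunLike.congr_fun (hom_ext (f := Θ.comp (Ψ M)) (g := AddMonoidHom.id _)
      fun m n => ?_) x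
    change Finsupp.liftAddHom (fun p => (tmulHom R).flip p)
      ((s n).mapRange (fun r => op r • m) (by simp)) = tmul R m n
    conv_rhs => rw [← hs n, Finsupp.linearCombination_apply]
    rw [Finsupp.liftAddHom_apply, Finsupp.sum_mapRange_index (fun a => map_zero _)]
    change _ = tmulHom R m _
    rw [Finsupp.sum, Finsupp.sum, map_sum]
    refine Finset.sum_congr rfl fun p _ => ?_
    exact smul_tmul R m (s n p) p
  have hnat : ∀ x, Ψ M' (map R i LinearMap.id x) =
      Finsupp.mapRange.addMonoidHom i.toAddMonoidHom (Ψ M x) := fun x => by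
    refine DFunLike.congr_fun (hom_ext (f := (Ψ M').comp (map R i LinearMap.id))
      (g := (Finsupp.mapRange.addMonoidHom i.toAddMonoidHom).comp (Ψ M)) fun m n => ?_) x
    ext p
    exact (map_smul i (op (s n p)) m).symm
  refine (injective_iff_map_eq_zero _).2 fun x hx => ?_
  have h := hnat x
  rw [hx, map_zero] at h
  have h0 : Ψ M x = 0 := by
    refine Finsupp.mapRange_injective i.toAddMonoidHom (map_zero _) hi ?_
    rw [Finsupp.mapRange_zero]
    exact h.symm
  rw [← hΘ x, h0, map_zero]

/-- A diagram chase on a `3 × 3` grid: if the middle row is left exact and the right column is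
injective, then the bottom row is injective. -/
theorem grid_injective {A' A A'' B' B B'' C' C : Type*} [AddCommGroup A'] [AddCommGroup A]
    [AddCommGroup A''] [AddCommGroup B'] [AddCommGroup B] [AddCommGroup B''] [AddCommGroup C']
    [AddCommGroup C] {t : A' →+ A} {r : A →+ A''} {u : B' →+ B} {y : B →+ B''}
    {w : C' →+ C} {i : A' →+ B'} {p : B' →+ C'} {q : A →+ B} {v : B →+ C} {z : A'' →+ B''}
    (hr : Function.Surjective r) (hq : Function.Injective q) (hw : Function.Injective w)
    (huy : Function.Exact u y) (hip : Function.Exact i p) (hqv : ∀ x, v (q x) = 0)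
    (hrt : ∀ x, r (t x) = 0) (h₁ : ∀ x, q (t x) = u (i x)) (h₂ : ∀ x, w (p x) = v (u x))
    (h₃ : ∀ x, z (r x) = y (q x)) : Function.Injective z := by
  refine (injective_iff_map_eq_zero _).2 fun x hx => ?_
  obtain ⟨x, rfl⟩ := hr x
  -- If `r x` dies under `z`, then `q x = u b`. The element `p b` is killed by the injective `w`, so
  -- `b = i a`, whence `x = t a` and `r x = 0`.
  obtain ⟨b, hb⟩ := (huy (q x)).1 (by rw [← h₃, hx])
  obtain ⟨a, rfl⟩ := (hip b).1 (hw (by rw [h₂, hb, hqv, map_zero]))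
  rw [← hq ((h₁ a).trans hb), hrt]

end BalancedTensor

/-! ### Maps and tensor products of bimodules. -/

namespace KBimodule

variable {k : Type v} [Field k]
variable {A B C D : Type u} [Ring A] [Algebra k A] [Ring B] [Algebra k B] [Ring C] [Algebra k C]
  [Ring D] [Algebra k D]

section Maps

variable {M M' M'' : KBimodule k A B}

theorem tmul_smul (a : A) (b : Bᵐᵒᵖ) (m : M) :
    (a ⊗ₜ[k] b) • m = (a ⊗ₜ[k] (1 : Bᵐᵒᵖ)) • (((1 : A) ⊗ₜ[k] b) • m) := by
  rw [← mul_smul]; simp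

theorem smul_comm' (a : A) (b : Bᵐᵒᵖ) (m : M) :
    ((1 : A) ⊗ₜ[k] b) • ((a ⊗ₜ[k] (1 : Bᵐᵒᵖ)) • m) =
      (a ⊗ₜ[k] (1 : Bᵐᵒᵖ)) • (((1 : A) ⊗ₜ[k] b) • m) := by
  rw [← mul_smul, ← mul_smul]; simp

/-- The left linear map underlying a map of bimodules. -/
def leftMap (f : M →ₗ[A ⊗[k] Bᵐᵒᵖ] M') : M.left →ₗ[A] M'.left where
  toFun := f
  map_add' := f.map_add
  map_smul' a x := f.map_smul (a ⊗ₜ[k] (1 : Bᵐᵒᵖ)) x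

/-- The right linear map underlying a map of bimodules. -/
def rightMap (f : M →ₗ[A ⊗[k] Bᵐᵒᵖ] M') : M.right →ₗ[Bᵐᵒᵖ] M'.right where
  toFun := f
  map_add' := f.map_add
  map_smul' b x := f.map_smul ((1 : A) ⊗ₜ[k] b) x

/-- An additive map that commutes with both actions is a map of bimodules. -/
def ofAddHom (φ : M →+ M') (hl : ∀ (a : A) (m : M), φ ((a ⊗ₜ[k] (1 : Bᵐᵒᵖ)) • m) =
    (a ⊗ₜ[k] (1 : Bᵐᵒᵖ)) • φ m) (hr : ∀ (b : Bᵐᵒᵖ) (m : M), φ (((1 : A) ⊗ₜ[k] b) • m) =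
    ((1 : A) ⊗ₜ[k] b) • φ m) : M →ₗ[A ⊗[k] Bᵐᵒᵖ] M' where
  toFun := φ
  map_add' := φ.map_add
  map_smul' c x := by
    induction c with
    | zero =>
      refine (congrArg φ (zero_smul (A ⊗[k] Bᵐᵒᵖ) x)).trans ?_
      exact (map_zero φ).trans (zero_smul (A ⊗[k] Bᵐᵒᵖ) (φ x)).symm
    | tmul a b => rw [tmul_smul, hl, hr, RingHom.id_apply, ← tmul_smul]
    | add c d hc hd => rw [add_smul, map_add, hc, hd]; simp [add_smul]

@[simp]
theorem ofAddHom_apply (φ : M →+ M') (hl hr) (m : M) :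
    (ofAddHom (k := k) (A := A) (B := B) φ hl hr) m = φ m := rfl

end Maps

section Tensor

variable {M M' M'' : KBimodule k A B} {N N' N'' : KBimodule k B C}

/-- The pure tensor of two elements of bimodules. -/
def tm (m : M) (n : N) : tensor M N := BalancedTensor.tmul B (M := M.right) (N := N.left) m n

theorem tm_add (m : M) (n n' : N) : tm m (n + n') = tm m n + tm m n' :=
  BalancedTensor.tmul_add B (M := M.right) (N := N.left) m n n'

theorem add_tm (m m' : M) (n : N) : tm (m + m') n = tm m n + tm m' n :=
  BalancedTensor.add_tmul B (M := M.right) (N := N.left) m m' n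

theorem zero_tm (n : N) : tm (0 : M) n = 0 :=
  BalancedTensor.zero_tmul B (M := M.right) (N := N.left) n

theorem tm_zero (m : M) : tm m (0 : N) = 0 :=
  BalancedTensor.tmul_zero B (M := M.right) (N := N.left) m

theorem smul_tm (m : M) (b : B) (n : N) :
    tm (((1 : A) ⊗ₜ[k] op b) • m) n = tm m ((b ⊗ₜ[k] (1 : Cᵐᵒᵖ)) • n) :=
  BalancedTensor.smul_tmul B (M := M.right) (N := N.left) m b n

theorem left_smul_tm (a : A) (m : M) (n : N) :
    (a ⊗ₜ[k] (1 : Cᵐᵒᵖ)) • tm m n = tm ((a ⊗ₜ[k] (1 : Bᵐᵒᵖ)) • m) n := by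
  refine (tensor_smul_tmul M N a 1 m n).trans ?_
  change tm ((a ⊗ₜ[k] (1 : Bᵐᵒᵖ)) • m) (((1 : B) ⊗ₜ[k] (1 : Cᵐᵒᵖ)) • n) = _
  rw [← Algebra.TensorProduct.one_def, one_smul]

theorem right_smul_tm (c : Cᵐᵒᵖ) (m : M) (n : N) :
    ((1 : A) ⊗ₜ[k] c) • tm m n = tm m (((1 : B) ⊗ₜ[k] c) • n) := by
  refine (tensor_smul_tmul M N 1 c.unop m n).trans ?_
  change tm (((1 : A) ⊗ₜ[k] (1 : Bᵐᵒᵖ)) • m) (((1 : B) ⊗ₜ[k] c) • n) = _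
  rw [← Algebra.TensorProduct.one_def, one_smul]

theorem tensor_induction {p : tensor M N → Prop} (x : tensor M N) (zero : p 0)
    (tmul : ∀ (m : M) (n : N), p (tm m n)) (add : ∀ x y, p x → p y → p (x + y)) : p x :=
  BalancedTensor.induction_on (M := M.right) (N := N.left) (p := p) x zero tmul add

theorem tensor_addHom_ext {Z : Type w} [AddCommGroup Z] {f g : tensor M N →+ Z}
    (h : ∀ (m : M) (n : N), f (tm m n) = g (tm m n)) : f = g :=
  BalancedTensor.hom_ext (M := M.right) (N := N.left) h

theorem tensor_ext {Z : KBimodule k A C} {f g : tensor M N →ₗ[A ⊗[k] Cᵐᵒᵖ] Z}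
    (h : ∀ (m : M) (n : N), f (tm m n) = g (tm m n)) : f = g :=
  LinearMap.toAddMonoidHom_injective (tensor_addHom_ext h)

/-- The additive map out of a tensor product of bimodules induced by a balanced map. -/
def liftAdd {Z : Type w} [AddCommGroup Z] (φ : M →+ N →+ Z)
    (h : ∀ (m : M) (b : B) (n : N), φ (((1 : A) ⊗ₜ[k] op b) • m) n =
      φ m ((b ⊗ₜ[k] (1 : Cᵐᵒᵖ)) • n)) : tensor M N →+ Z :=
  BalancedTensor.lift (M := M.right) (N := N.left) φ h

@[simp]
theorem liftAdd_tm {Z : Type w} [AddCommGroup Z] (φ : M →+ N →+ Z)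
    (h : ∀ (m : M) (b : B) (n : N), φ (((1 : A) ⊗ₜ[k] op b) • m) n =
      φ m ((b ⊗ₜ[k] (1 : Cᵐᵒᵖ)) • n)) (m : M) (n : N) : liftAdd φ h (tm m n) = φ m n := rfl

/-- The map of bimodules out of a tensor product induced by a balanced equivariant map. -/
def tensorLift {Z : KBimodule k A C} (φ : M →+ N →+ Z)
    (h : ∀ (m : M) (b : B) (n : N), φ (((1 : A) ⊗ₜ[k] op b) • m) n =
      φ m ((b ⊗ₜ[k] (1 : Cᵐᵒᵖ)) • n))
    (hl : ∀ (a : A) (m : M) (n : N), φ ((a ⊗ₜ[k] (1 : Bᵐᵒᵖ)) • m) n =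
      (a ⊗ₜ[k] (1 : Cᵐᵒᵖ)) • φ m n)
    (hr : ∀ (c : Cᵐᵒᵖ) (m : M) (n : N), φ m (((1 : B) ⊗ₜ[k] c) • n) =
      ((1 : A) ⊗ₜ[k] c) • φ m n) : tensor M N →ₗ[A ⊗[k] Cᵐᵒᵖ] Z :=
  ofAddHom (liftAdd φ h)
    (fun a x => by
      induction x using tensor_induction with
      | zero => rw [smul_zero, map_zero, smul_zero]
      | tmul m n => rw [left_smul_tm, liftAdd_tm, liftAdd_tm, hl]
      | add x y hx hy => rw [smul_add, map_add, hx, hy, map_add, smul_add])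
    (fun a x => by
      induction x using tensor_induction with
      | zero => rw [smul_zero, map_zero, smul_zero]
      | tmul m n => rw [right_smul_tm, liftAdd_tm, liftAdd_tm, hr]
      | add x y hx hy => rw [smul_add, map_add, hx, hy, map_add, smul_add])

@[simp]
theorem tensorLift_tm {Z : KBimodule k A C} (φ : M →+ N →+ Z) (h hl hr) (m : M) (n : N) :
    (tensorLift (k := k) (A := A) (B := B) (C := C) φ h hl hr) (tm m n) = φ m n := rfl

/-- The pure tensors as a biadditive map. -/
def tmHom (M : KBimodule k A B) (N : KBimodule k B C) : M →+ N →+ tensor M N where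
  toFun m :=
    { toFun := fun n => tm m n
      map_zero' := tm_zero m
      map_add' := tm_add m }
  map_zero' := AddMonoidHom.ext fun n => zero_tm n
  map_add' m m' := AddMonoidHom.ext fun n => add_tm m m' n

@[simp]
theorem tmHom_apply (m : M) (n : N) : tmHom M N m n = tm m n := rfl

/-- The tensor product of two maps of bimodules. -/
def tensorMap (f : M →ₗ[A ⊗[k] Bᵐᵒᵖ] M') (g : N →ₗ[B ⊗[k] Cᵐᵒᵖ] N') :
    tensor M N →ₗ[A ⊗[k] Cᵐᵒᵖ] tensor M' N' :=
  tensorLift (((tmHom M' N').comp f.toAddMonoidHom).compr₂ (AddMonoidHom.id _) |>.compl₂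
      g.toAddMonoidHom)
    (fun m b n => by
      change tm (f _) (g _) = tm (f _) (g _)
      rw [map_smul, map_smul, smul_tm])
    (fun a m n => by
      change tm (f _) (g _) = _ • tm (f _) (g _)
      rw [map_smul, left_smul_tm])
    (fun a m n => by
      change tm (f _) (g _) = _ • tm (f _) (g _)
      rw [map_smul, right_smul_tm])

@[simp]
theorem tensorMap_tm (f : M →ₗ[A ⊗[k] Bᵐᵒᵖ] M') (g : N →ₗ[B ⊗[k] Cᵐᵒᵖ] N') (m : M) (n : N) :
    tensorMap f g (tm m n) = tm (f m) (g n) := rfl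

/-- The bridge by which exactness and flatness of the underlying balanced tensor products pass to
bimodules. -/
theorem tensorMap_eq (f : M →ₗ[A ⊗[k] Bᵐᵒᵖ] M') (g : N →ₗ[B ⊗[k] Cᵐᵒᵖ] N') (x : tensor M N) :
    tensorMap f g x = BalancedTensor.map B (rightMap f) (leftMap g) x :=
  DFunLike.congr_fun (tensor_addHom_ext (f := (tensorMap f g).toAddMonoidHom)
    (g := BalancedTensor.map B (rightMap f) (leftMap g)) fun _ _ => rfl) x

theorem tensorMap_comp (f : M →ₗ[A ⊗[k] Bᵐᵒᵖ] M') (g : N →ₗ[B ⊗[k] Cᵐᵒᵖ] N')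
    (f' : M' →ₗ[A ⊗[k] Bᵐᵒᵖ] M'') (g' : N' →ₗ[B ⊗[k] Cᵐᵒᵖ] N'') :
    tensorMap (f'.comp f) (g'.comp g) = (tensorMap f' g').comp (tensorMap f g) :=
  tensor_ext fun _ _ => rfl

theorem tensorMap_comp_apply (f : M →ₗ[A ⊗[k] Bᵐᵒᵖ] M') (g : N →ₗ[B ⊗[k] Cᵐᵒᵖ] N')
    (f' : M' →ₗ[A ⊗[k] Bᵐᵒᵖ] M'') (g' : N' →ₗ[B ⊗[k] Cᵐᵒᵖ] N'') (x : tensor M N) :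
    tensorMap f' g' (tensorMap f g x) = tensorMap (f'.comp f) (g'.comp g) x :=
  (DFunLike.congr_fun (tensorMap_comp f g f' g') x).symm

theorem tensorMap_id : tensorMap (LinearMap.id : M →ₗ[A ⊗[k] Bᵐᵒᵖ] M)
    (LinearMap.id : N →ₗ[B ⊗[k] Cᵐᵒᵖ] N) = LinearMap.id :=
  tensor_ext fun _ _ => rfl

theorem tensorMap_surjective {f : M →ₗ[A ⊗[k] Bᵐᵒᵖ] M'} {g : N →ₗ[B ⊗[k] Cᵐᵒᵖ] N'}
    (hf : Function.Surjective f) (hg : Function.Surjective g) :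
    Function.Surjective (tensorMap f g) := fun x =>
  (BalancedTensor.map_surjective (f := rightMap f) (g := leftMap g) hf hg x).imp fun y hy =>
    (tensorMap_eq f g y).trans hy

/-- Isomorphisms of bimodules induce isomorphisms of tensor products. -/
def tensorEquiv (e : M ≃ₗ[A ⊗[k] Bᵐᵒᵖ] M') (e' : N ≃ₗ[B ⊗[k] Cᵐᵒᵖ] N') :
    tensor M N ≃ₗ[A ⊗[k] Cᵐᵒᵖ] tensor M' N' :=
  LinearEquiv.ofLinearMap (tensorMap e.toLinearMap e'.toLinearMap)
    (tensorMap e.symm.toLinearMap e'.symm.toLinearMap)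
    (tensor_ext fun m n => by simp) (tensor_ext fun m n => by simp)

theorem tensorMap_exact_left {f : M →ₗ[A ⊗[k] Bᵐᵒᵖ] M'} {g : M' →ₗ[A ⊗[k] Bᵐᵒᵖ] M''}
    (h : Function.Exact f g) (hg : Function.Surjective g) (N : KBimodule k B C) :
    Function.Exact (tensorMap f (LinearMap.id : N →ₗ[B ⊗[k] Cᵐᵒᵖ] N))
      (tensorMap g (LinearMap.id : N →ₗ[B ⊗[k] Cᵐᵒᵖ] N)) := by
  have := BalancedTensor.exact_map_left (N := N.left) (f := rightMap f) (g := rightMap g) h hg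
  intro x
  rw [tensorMap_eq]
  refine (this x).trans (exists_congr fun y => ?_)
  change _ ↔ tensorMap _ _ (show tensor _ _ from y) = x
  rw [tensorMap_eq]; rfl

theorem tensorMap_exact_right {f : N →ₗ[B ⊗[k] Cᵐᵒᵖ] N'} {g : N' →ₗ[B ⊗[k] Cᵐᵒᵖ] N''}
    (h : Function.Exact f g) (hg : Function.Surjective g) (M : KBimodule k A B) :
    Function.Exact (tensorMap (LinearMap.id : M →ₗ[A ⊗[k] Bᵐᵒᵖ] M) f)
      (tensorMap (LinearMap.id : M →ₗ[A ⊗[k] Bᵐᵒᵖ] M) g) := by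
  have := BalancedTensor.exact_map_right (M := M.right) (f := leftMap f) (g := leftMap g) h hg
  intro x
  rw [tensorMap_eq]
  refine (this x).trans (exists_congr fun y => ?_)
  change _ ↔ tensorMap _ _ (show tensor _ _ from y) = x
  rw [tensorMap_eq]; rfl

theorem tensorMap_injective_of_projective_right (M : KBimodule k A B)
    [Module.Projective Bᵐᵒᵖ M.right] {i : N →ₗ[B ⊗[k] Cᵐᵒᵖ] N'} (hi : Function.Injective i) :
    Function.Injective (tensorMap (LinearMap.id : M →ₗ[A ⊗[k] Bᵐᵒᵖ] M) i) := by
  have := BalancedTensor.map_id_injective_of_projective (M := M.right) (i := leftMap i) hi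
  intro x y h
  rw [tensorMap_eq, tensorMap_eq] at h
  exact this h

theorem tensorMap_injective_of_projective_left (N : KBimodule k B C)
    [Module.Projective B N.left] {i : M →ₗ[A ⊗[k] Bᵐᵒᵖ] M'} (hi : Function.Injective i) :
    Function.Injective (tensorMap i (LinearMap.id : N →ₗ[B ⊗[k] Cᵐᵒᵖ] N)) := by
  have := BalancedTensor.map_injective_id_of_projective (N := N.left) (i := rightMap i) hi
  intro x y h
  rw [tensorMap_eq, tensorMap_eq] at h
  exact this h

end Tensor

/-! ### Associativity of the tensor product of bimodules. -/

section Assoc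

variable (L : KBimodule k A B) (M : KBimodule k B C) (N : KBimodule k C D)

/-- The map `m ↦ n ↦ l ⊗ (m ⊗ n)`, as a function of `l`. -/
def tmHom₃ : L →+ M →+ N →+ tensor L (tensor M N) where
  toFun l := (tmHom M N).compr₂ (tmHom L (tensor M N) l)
  map_zero' := AddMonoidHom.ext fun m => AddMonoidHom.ext fun n =>
    zero_tm (M := L) (N := tensor M N) (tm m n)
  map_add' l l' := AddMonoidHom.ext fun m => AddMonoidHom.ext fun n =>
    add_tm (M := L) (N := tensor M N) l l' (tm m n)

@[simp]
theorem tmHom₃_apply (l : L) (m : M) (n : N) : tmHom₃ L M N l m n = tm l (tm m n) := rfl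

/-- The map `(l ⊗ m) ↦ n ↦ l ⊗ (m ⊗ n)`. -/
def assocAux : tensor L M →+ N →+ tensor L (tensor M N) :=
  liftAdd (tmHom₃ L M N) (fun l b m => AddMonoidHom.ext fun n => by
    rw [tmHom₃_apply, tmHom₃_apply, smul_tm, left_smul_tm])

@[simp]
theorem assocAux_tm (l : L) (m : M) (n : N) : assocAux L M N (tm l m) n = tm l (tm m n) := rfl

/-- Associativity of the tensor product of bimodules, from left to right. -/
def assocHom : tensor (tensor L M) N →ₗ[A ⊗[k] Dᵐᵒᵖ] tensor L (tensor M N) :=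
  tensorLift (assocAux L M N)
    (fun x c n => by
      induction x using tensor_induction with
      | zero => rw [smul_zero, map_zero]; rfl
      | tmul l m => rw [right_smul_tm, assocAux_tm, assocAux_tm, smul_tm]
      | add x y hx hy =>
        rw [smul_add, map_add, map_add, AddMonoidHom.add_apply, AddMonoidHom.add_apply, hx, hy])
    (fun a x n => by
      induction x using tensor_induction with
      | zero => rw [smul_zero, map_zero, AddMonoidHom.zero_apply, smul_zero]
      | tmul l m => rw [left_smul_tm, assocAux_tm, assocAux_tm, left_smul_tm]
      | add x y hx hy =>
        rw [smul_add, map_add, map_add, AddMonoidHom.add_apply, AddMonoidHom.add_apply, hx, hy,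
          smul_add])
    (fun d x n => by
      induction x using tensor_induction with
      | zero => rw [map_zero, AddMonoidHom.zero_apply, AddMonoidHom.zero_apply, smul_zero]
      | tmul l m => rw [assocAux_tm, assocAux_tm, right_smul_tm, right_smul_tm]
      | add x y hx hy =>
        rw [map_add, AddMonoidHom.add_apply, AddMonoidHom.add_apply, hx, hy, smul_add])

@[simp]
theorem assocHom_tm (l : L) (m : M) (n : N) :
    assocHom L M N (tm (tm l m) n) = tm l (tm m n) := rfl

/-- The map `m ↦ n ↦ (l ⊗ m) ⊗ n`, for a fixed `l`. -/
def tmHom₃' (l : L) : M →+ N →+ tensor (tensor L M) N :=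
  (tmHom (tensor L M) N).comp (tmHom L M l)

@[simp]
theorem tmHom₃'_apply (l : L) (m : M) (n : N) : tmHom₃' L M N l m n = tm (tm l m) n := rfl

/-- The map `(m ⊗ n) ↦ (l ⊗ m) ⊗ n`, for a fixed `l`. -/
def assocInvAux (l : L) : tensor M N →+ tensor (tensor L M) N :=
  liftAdd (tmHom₃' L M N l) (fun m c n => by
    rw [tmHom₃'_apply, tmHom₃'_apply, ← smul_tm, right_smul_tm])

@[simp]
theorem assocInvAux_tm (l : L) (m : M) (n : N) :
    assocInvAux L M N l (tm m n) = tm (tm l m) n := rfl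

/-- The map `l ↦ (m ⊗ n) ↦ (l ⊗ m) ⊗ n`. -/
def assocInvHom : L →+ tensor M N →+ tensor (tensor L M) N where
  toFun := assocInvAux L M N
  map_zero' := tensor_addHom_ext fun m n => by
    rw [assocInvAux_tm, zero_tm, zero_tm, AddMonoidHom.zero_apply]
  map_add' l l' := tensor_addHom_ext fun m n => by
    rw [AddMonoidHom.add_apply, assocInvAux_tm, assocInvAux_tm, assocInvAux_tm, add_tm, add_tm]

@[simp]
theorem assocInvHom_tm (l : L) (m : M) (n : N) :
    assocInvHom L M N l (tm m n) = tm (tm l m) n := rfl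

/-- Associativity of the tensor product of bimodules, from right to left. -/
def assocInv : tensor L (tensor M N) →+ tensor (tensor L M) N :=
  liftAdd (assocInvHom L M N) (fun l b x => by
    induction x using tensor_induction with
    | zero => rw [smul_zero, map_zero, map_zero]
    | tmul m n => rw [left_smul_tm, assocInvHom_tm, assocInvHom_tm, smul_tm]
    | add x y hx hy => rw [smul_add, map_add, map_add, hx, hy])

/-- Associativity of the tensor product of bimodules. -/
def assoc : tensor (tensor L M) N ≃ₗ[A ⊗[k] Dᵐᵒᵖ] tensor L (tensor M N) :=
  LinearEquiv.ofBijective (assocHom L M N) (by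
    -- An additive inverse suffices for bijectivity, so equivariance is checked in one direction
    -- only.
    have h₁ : (assocInv L M N).comp (assocHom L M N).toAddMonoidHom = AddMonoidHom.id _ :=
      tensor_addHom_ext fun x n => by
        induction x using tensor_induction with
        | zero => rw [zero_tm, map_zero, map_zero]
        | tmul l m => rfl
        | add x y hx hy => rw [add_tm, map_add, map_add, hx, hy]
    have h₂ : (assocHom L M N).toAddMonoidHom.comp (assocInv L M N) = AddMonoidHom.id _ :=
      tensor_addHom_ext fun l x => by
        induction x using tensor_induction with
        | zero => rw [tm_zero, map_zero, map_zero]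
        | tmul m n => rfl
        | add x y hx hy => rw [tm_add, map_add, map_add, hx, hy]
    exact Function.bijective_iff_has_inverse.2
      ⟨assocInv L M N, DFunLike.congr_fun h₁, DFunLike.congr_fun h₂⟩)

@[simp]
theorem assoc_tm (l : L) (m : M) (n : N) :
    assoc L M N (tm (tm l m) n) = tm l (tm m n) := rfl

variable {L M N} {L' : KBimodule k A B} {M' : KBimodule k B C} {N' : KBimodule k C D}

theorem assoc_naturality (f : L →ₗ[A ⊗[k] Bᵐᵒᵖ] L') (g : M →ₗ[B ⊗[k] Cᵐᵒᵖ] M')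
    (h : N →ₗ[C ⊗[k] Dᵐᵒᵖ] N') (x : tensor (tensor L M) N) :
    assoc L' M' N' (tensorMap (tensorMap f g) h x) =
      tensorMap f (tensorMap g h) (assoc L M N x) := by
  induction x using tensor_induction with
  | zero => simp only [map_zero]
  | tmul x n =>
    induction x using tensor_induction with
    | zero => rw [zero_tm]; simp only [map_zero]
    | tmul l m => rfl
    | add x y hx hy => rw [add_tm, map_add, map_add, map_add, map_add, hx, hy]
  | add x y hx hy => rw [map_add, map_add, map_add, map_add, hx, hy]

end Assoc

theorem add_tmul_one_smul {M : KBimodule k A B} (a a' : A) (m : M) :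
    ((a + a') ⊗ₜ[k] (1 : Bᵐᵒᵖ)) • m = (a ⊗ₜ[k] (1 : Bᵐᵒᵖ)) • m + (a' ⊗ₜ[k] (1 : Bᵐᵒᵖ)) • m := by
  rw [TensorProduct.add_tmul, add_smul]

theorem one_tmul_add_smul {M : KBimodule k A B} (b b' : Bᵐᵒᵖ) (m : M) :
    ((1 : A) ⊗ₜ[k] (b + b')) • m = ((1 : A) ⊗ₜ[k] b) • m + ((1 : A) ⊗ₜ[k] b') • m := by
  rw [TensorProduct.tmul_add, add_smul]

theorem zero_tmul_one_smul {M : KBimodule k A B} (m : M) :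
    ((0 : A) ⊗ₜ[k] (1 : Bᵐᵒᵖ)) • m = 0 := by
  rw [TensorProduct.zero_tmul]; exact zero_smul (A ⊗[k] Bᵐᵒᵖ) m

theorem one_tmul_zero_smul {M : KBimodule k A B} (m : M) :
    ((1 : A) ⊗ₜ[k] (0 : Bᵐᵒᵖ)) • m = 0 := by
  rw [TensorProduct.tmul_zero]; exact zero_smul (A ⊗[k] Bᵐᵒᵖ) m

theorem one_tmul_one_smul {M : KBimodule k A B} (m : M) :
    ((1 : A) ⊗ₜ[k] (1 : Bᵐᵒᵖ)) • m = m :=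
  one_smul (A ⊗[k] Bᵐᵒᵖ) m

theorem mul_tmul_one_smul {M : KBimodule k A B} (a a' : A) (m : M) :
    ((a * a') ⊗ₜ[k] (1 : Bᵐᵒᵖ)) • m = (a ⊗ₜ[k] (1 : Bᵐᵒᵖ)) • (a' ⊗ₜ[k] (1 : Bᵐᵒᵖ)) • m := by
  rw [← mul_smul, Algebra.TensorProduct.tmul_mul_tmul, one_mul]

theorem one_tmul_mul_smul {M : KBimodule k A B} (b b' : Bᵐᵒᵖ) (m : M) :
    ((1 : A) ⊗ₜ[k] (b * b')) • m = ((1 : A) ⊗ₜ[k] b) • ((1 : A) ⊗ₜ[k] b') • m := by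
  rw [← mul_smul, Algebra.TensorProduct.tmul_mul_tmul, one_mul]

theorem algebraMap_smul {M : KBimodule k A B} (t : k) (m : M) :
    ((1 : A) ⊗ₜ[k] (algebraMap k Bᵐᵒᵖ t)) • m = ((algebraMap k A t) ⊗ₜ[k] (1 : Bᵐᵒᵖ)) • m := by
  rw [Algebra.algebraMap_eq_smul_one, Algebra.algebraMap_eq_smul_one, TensorProduct.smul_tmul]

/-! ### Restriction of scalars on one side, and the unit isomorphisms. -/

section Restriction

/-- Restriction of the right action along an algebra map. -/
abbrev resR (φ : B →ₐ[k] A) : KBimodule k C A ⥤ KBimodule k C B :=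
  ModuleCat.restrictScalars
    (Algebra.TensorProduct.map (AlgHom.id k C) (AlgHom.op φ)).toRingHom

/-- Restriction of the left action along an algebra map. -/
abbrev resL (φ : B →ₐ[k] A) : KBimodule k A C ⥤ KBimodule k B C :=
  ModuleCat.restrictScalars
    (Algebra.TensorProduct.map φ (AlgHom.id k Cᵐᵒᵖ)).toRingHom

theorem resR_smul (φ : B →ₐ[k] A) (V : KBimodule k C A) (c : C) (b : Bᵐᵒᵖ) (x : V) :
    (c ⊗ₜ[k] b) • (show (resR φ).obj V from x) =
      (show (resR φ).obj V from (c ⊗ₜ[k] op (φ b.unop)) • x) := rfl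

theorem resL_smul (φ : B →ₐ[k] A) (V : KBimodule k A C) (b : B) (c : Cᵐᵒᵖ) (x : V) :
    (b ⊗ₜ[k] c) • (show (resL φ).obj V from x) =
      (show (resL φ).obj V from (φ b ⊗ₜ[k] c) • x) := rfl

/-- A map of bimodules, restricted on the right. -/
def resRMap (φ : B →ₐ[k] A) {V V' : KBimodule k C A} (f : V →ₗ[C ⊗[k] Aᵐᵒᵖ] V') :
    (resR φ).obj V →ₗ[C ⊗[k] Bᵐᵒᵖ] (resR φ).obj V' :=
  ((resR φ).map (ModuleCat.ofHom f)).hom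

@[simp]
theorem resRMap_apply (φ : B →ₐ[k] A) {V V' : KBimodule k C A} (f : V →ₗ[C ⊗[k] Aᵐᵒᵖ] V')
    (x : V) : resRMap φ f x = f x := rfl

/-- `A` as a bimodule over `B` on the left and `A` on the right. -/
abbrev regularL (φ : B →ₐ[k] A) : KBimodule k B A := (resL φ).obj (regular k A)

/-- `A` as a bimodule over `A` on the left and `B` on the right. -/
abbrev regularR (φ : B →ₐ[k] A) : KBimodule k A B := (resR φ).obj (regular k A)

end Restriction

section Unit

/-- The biadditive map `v ↦ a ↦ v·a`. -/
def actR (V : KBimodule k C A) : V →+ A →+ V where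
  toFun v :=
    { toFun := fun a => ((1 : C) ⊗ₜ[k] op a) • v
      map_zero' := one_tmul_zero_smul v
      map_add' := fun a b => one_tmul_add_smul (op a) (op b) v }
  map_zero' := AddMonoidHom.ext fun a => smul_zero ((1 : C) ⊗ₜ[k] op a)
  map_add' v v' := AddMonoidHom.ext fun a => smul_add ((1 : C) ⊗ₜ[k] op a) v v'

/-- The biadditive map `a ↦ v ↦ a·v`. -/
def actL (V : KBimodule k A C) : A →+ V →+ V where
  toFun a :=
    { toFun := fun v => (a ⊗ₜ[k] (1 : Cᵐᵒᵖ)) • v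
      map_zero' := smul_zero (a ⊗ₜ[k] (1 : Cᵐᵒᵖ))
      map_add' := smul_add (a ⊗ₜ[k] (1 : Cᵐᵒᵖ)) }
  map_zero' := AddMonoidHom.ext fun v => zero_tmul_one_smul v
  map_add' a a' := AddMonoidHom.ext fun v => add_tmul_one_smul a a' v

@[simp]
theorem actR_apply (V : KBimodule k C A) (v : V) (a : A) :
    actR V v a = ((1 : C) ⊗ₜ[k] op a) • v := rfl

@[simp]
theorem actL_apply (V : KBimodule k A C) (a : A) (v : V) :
    actL V a v = (a ⊗ₜ[k] (1 : Cᵐᵒᵖ)) • v := rfl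

theorem regular_left_smul (a x : A) :
    (a ⊗ₜ[k] (1 : Aᵐᵒᵖ)) • (show regular k A from x) = (show regular k A from a * x) := by
  refine (regular_smul (k := k) a 1 x).trans ?_
  rw [mul_one]

theorem regular_right_smul (a : Aᵐᵒᵖ) (x : A) :
    ((1 : A) ⊗ₜ[k] a) • (show regular k A from x) = (show regular k A from x * a.unop) := by
  refine (regular_smul (k := k) 1 a.unop x).trans ?_
  rw [one_mul]

theorem actR_mul (V : KBimodule k C A) (v : V) (a b : A) :
    actR V v (a * b) = actR V (((1 : C) ⊗ₜ[k] op a) • v) b := by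
  rw [actR_apply, op_mul, one_tmul_mul_smul, actR_apply]

/-- The multiplication `V ⊗_B A → V`, for a right `A`-module `V`. -/
def mulHom (φ : B →ₐ[k] A) (V : KBimodule k C A) :
    tensor ((resR φ).obj V) (regularL φ) →ₗ[C ⊗[k] Aᵐᵒᵖ] V :=
  tensorLift (M := (resR φ).obj V) (N := regularL φ) (actR V)
    (fun (m : V) b (n : A) => (actR_mul V m (φ b) n).symm.trans
      (congrArg (actR V m) (regular_left_smul (k := k) (φ b) n).symm))
    (fun c (m : V) (n : A) => by
      refine Eq.trans ?_ (smul_comm' c (op n) m)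
      change actR V ((c ⊗ₜ[k] op (φ 1)) • m) n = _
      rw [map_one]; rfl)
    (fun a (m : V) (n : A) => by
      refine Eq.trans (congrArg (actR V m) ?_) (actR_mul V m n a.unop)
      refine Eq.trans ?_ (regular_right_smul (k := k) a n)
      change ((φ 1) ⊗ₜ[k] a) • (show regular k A from n) = _
      rw [map_one])

theorem mulHom_tm (φ : B →ₐ[k] A) (V : KBimodule k C A) (v : V) (a : A) :
    mulHom φ V (tm (M := (resR φ).obj V) (N := regularL φ) v a) =
      ((1 : C) ⊗ₜ[k] op a) • v := rfl

/-- The multiplication `V ⊗_A A → V`, with both sides restricted on the right. -/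
def tensorRegularRHom (φ : B →ₐ[k] A) (V : KBimodule k C A) :
    tensor V (regularR φ) →ₗ[C ⊗[k] Bᵐᵒᵖ] (resR φ).obj V :=
  tensorLift (M := V) (N := regularR φ) (Z := (resR φ).obj V) (actR V)
    (fun m b (n : A) => by
      refine (actR_mul V m b n).symm.trans (congrArg (actR V m) ?_)
      refine (regular_left_smul (k := k) b n).symm.trans ?_
      change _ = (b ⊗ₜ[k] op (φ 1)) • (show regular k A from n)
      rw [map_one]; rfl)
    (fun c m (n : A) => by
      refine (smul_comm' c (op n) m).trans ?_
      change _ = (c ⊗ₜ[k] op (φ 1)) • actR V m n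
      rw [map_one]; rfl)
    (fun a m (n : A) => Eq.trans
      (congrArg (actR V m) (regular_right_smul (k := k) (op (φ a.unop)) n))
      (actR_mul V m n (φ a.unop)))

/-- `V ⊗_A A ≅ V`, with both sides restricted on the right. -/
def tensorRegularR (φ : B →ₐ[k] A) (V : KBimodule k C A) :
    tensor V (regularR φ) ≃ₗ[C ⊗[k] Bᵐᵒᵖ] (resR φ).obj V :=
  LinearEquiv.ofBijective (tensorRegularRHom φ V) (by
    have h : ∀ x : tensor V (regularR φ),
        tm (N := regularR φ) (show V from tensorRegularRHom φ V x) (1 : A) = x := fun x => by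
      induction x using tensor_induction with
      | zero => rw [map_zero]; exact zero_tm (M := V) (N := regularR φ) _
      | tmul v a =>
        refine (smul_tm (M := V) (N := regularR φ) v (show A from a) (1 : A)).trans ?_
        refine congrArg (tm (M := V) (N := regularR φ) v) ?_
        change ((show A from a) ⊗ₜ[k] op (φ 1)) • (show regular k A from (1 : A)) = _
        rw [map_one]
        exact (regular_left_smul (k := k) (show A from a) (1 : A)).trans (mul_one (M := A) a)
      | add x y hx hy =>
        rw [map_add]
        exact (add_tm (M := V) (N := regularR φ) _ _ _).trans (congrArg₂ _ hx hy)
    refine Function.bijective_iff_has_inverse.2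
      ⟨fun v => tm (M := V) (N := regularR φ) v (1 : A), h, fun v => ?_⟩
    exact one_tmul_one_smul (show V from v))

/-- The restriction along the identity, as an isomorphism. -/
def resRId (V : KBimodule k C A) : (resR (AlgHom.id k A)).obj V ≃ₗ[C ⊗[k] Aᵐᵒᵖ] V :=
  LinearEquiv.ofBijective (ofAddHom (M := (resR (AlgHom.id k A)).obj V) (M' := V)
    (AddMonoidHom.id V) (fun _ _ => rfl) (fun _ _ => rfl)) Function.bijective_id

/-- `V ⊗_A A ≅ V`. -/
def tensorRegular (V : KBimodule k C A) : tensor V (regular k A) ≃ₗ[C ⊗[k] Aᵐᵒᵖ] V :=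
  (tensorEquiv (LinearEquiv.refl _ V) (resRId (regular k A)).symm).trans
    ((tensorRegularR (AlgHom.id k A) V).trans (resRId V))

/-- The multiplication `A ⊗_A V → V`. -/
def regularTensorHom (V : KBimodule k A C) : tensor (regular k A) V →ₗ[A ⊗[k] Cᵐᵒᵖ] V :=
  tensorLift (M := regular k A) (N := V) (actL V)
    (fun (m : A) b n => (congrArg (fun a => actL V a n)
      (regular_right_smul (k := k) (op b) m)).trans (mul_tmul_one_smul m b n))
    (fun c (m : A) n => (congrArg (fun a => actL V a n)
      (regular_left_smul (k := k) c m)).trans (mul_tmul_one_smul c m n))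
    (fun a (m : A) n => (smul_comm' m a n).symm)

/-- `A ⊗_A V ≅ V`. -/
def regularTensor (V : KBimodule k A C) : tensor (regular k A) V ≃ₗ[A ⊗[k] Cᵐᵒᵖ] V :=
  LinearEquiv.ofBijective (regularTensorHom V) (by
    have h : ∀ x : tensor (regular k A) V,
        tm (M := regular k A) (1 : A) (regularTensorHom V x) = x := fun x => by
      induction x using tensor_induction with
      | zero => rw [map_zero]; exact tm_zero (M := regular k A) (N := V) _
      | tmul a v =>
        refine (smul_tm (M := regular k A) (N := V) (1 : A) (show A from a) v).symm.trans ?_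
        refine congrArg (fun x => tm (M := regular k A) (N := V) x v) ?_
        exact (regular_right_smul (k := k) (op (show A from a)) (1 : A)).trans
          (one_mul (M := A) a)
      | add x y hx hy =>
        rw [map_add]
        exact (tm_add (M := regular k A) (N := V) _ _ _).trans (congrArg₂ _ hx hy)
    exact Function.bijective_iff_has_inverse.2
      ⟨fun v => tm (M := regular k A) (1 : A) v, h, fun v => one_tmul_one_smul v⟩)

end Unit

end KBimodule

/-! ### Projectivity of bimodules, of the underlying one-sided modules and of tensor products. -/

theorem Module.Projective.of_isScalarTower {S R W : Type*} [Ring S] [Ring R] [AddCommGroup W]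
    [Module S R] [Module R W] [Module S W] [IsScalarTower S R W] [IsScalarTower S R R]
    [Module.Projective S R] [Module.Projective R W] : Module.Projective S W := by
  obtain ⟨s, hs⟩ := Module.projective_def'.1 ‹Module.Projective R W›
  classical
  have : Module.Projective S (W →₀ R) := Module.Projective.of_equiv (finsuppLequivDFinsupp S).symm
  exact Module.Projective.of_split (s.restrictScalars S)
    ((Finsupp.linearCombination R id).restrictScalars S) (by
      ext x; exact DFunLike.congr_fun hs x)

namespace KBimodule

variable {k : Type v} [Field k]
variable {A B C D : Type u} [Ring A] [Algebra k A] [Ring B] [Algebra k B] [Ring C] [Algebra k C]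
  [Ring D] [Algebra k D]

/-- A `k`-basis of `B^op` makes `A ⊗ B^op` free over `A`. A projective bimodule is a summand of a
direct sum of copies of it, hence projective over `A`. -/
theorem projective_left (W : KBimodule k A B) [Module.Projective (A ⊗[k] Bᵐᵒᵖ) W] :
    Module.Projective A W.left := by
  let _ : Module (A ⊗[k] Bᵐᵒᵖ) W.left := inferInstanceAs (Module (A ⊗[k] Bᵐᵒᵖ) W)
  have : Module.Projective (A ⊗[k] Bᵐᵒᵖ) W.left := ‹Module.Projective (A ⊗[k] Bᵐᵒᵖ) W›
  have : IsScalarTower A (A ⊗[k] Bᵐᵒᵖ) W.left := ⟨fun a x w => by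
    refine Eq.trans ?_ (mul_smul (a ⊗ₜ[k] (1 : Bᵐᵒᵖ)) x (show W from w))
    congr 1
    induction x with
    | zero => rw [smul_zero, mul_zero]
    | tmul x y => rw [TensorProduct.smul_tmul', smul_eq_mul, Algebra.TensorProduct.tmul_mul_tmul,
        one_mul]
    | add x y hx hy => rw [smul_add, mul_add, hx, hy]⟩
  have : Module.Projective A (A ⊗[k] Bᵐᵒᵖ) :=
    Module.Projective.of_basis (Algebra.TensorProduct.basis A (Module.Free.chooseBasis k Bᵐᵒᵖ))
  exact Module.Projective.of_isScalarTower (S := A) (R := A ⊗[k] Bᵐᵒᵖ)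

theorem projective_right (W : KBimodule k A B) [Module.Projective (A ⊗[k] Bᵐᵒᵖ) W] :
    Module.Projective Bᵐᵒᵖ W.right := by
  let _ : Module (A ⊗[k] Bᵐᵒᵖ) W.right := inferInstanceAs (Module (A ⊗[k] Bᵐᵒᵖ) W)
  have : Module.Projective (A ⊗[k] Bᵐᵒᵖ) W.right := ‹Module.Projective (A ⊗[k] Bᵐᵒᵖ) W›
  let _ : Module Bᵐᵒᵖ (A ⊗[k] Bᵐᵒᵖ) := Module.compHom _
    (Algebra.TensorProduct.includeRight : Bᵐᵒᵖ →ₐ[k] A ⊗[k] Bᵐᵒᵖ).toRingHom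
  have : IsScalarTower Bᵐᵒᵖ (A ⊗[k] Bᵐᵒᵖ) (A ⊗[k] Bᵐᵒᵖ) := ⟨fun b x y =>
    mul_assoc ((1 : A) ⊗ₜ[k] b) x y⟩
  have : IsScalarTower Bᵐᵒᵖ (A ⊗[k] Bᵐᵒᵖ) W.right := ⟨fun b x w =>
    mul_smul ((1 : A) ⊗ₜ[k] b) x (show W from w)⟩
  have : Module.Projective Bᵐᵒᵖ (Bᵐᵒᵖ ⊗[k] A) :=
    Module.Projective.of_basis (Algebra.TensorProduct.basis Bᵐᵒᵖ (Module.Free.chooseBasis k A))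
  -- A basis over `k` yields one over the left tensor factor, so the factors are swapped to see
  -- freeness over `B^op`.
  let e : Bᵐᵒᵖ ⊗[k] A ≃ₗ[Bᵐᵒᵖ] A ⊗[k] Bᵐᵒᵖ :=
    { TensorProduct.comm k Bᵐᵒᵖ A with
      map_smul' := fun b x => by
        change TensorProduct.comm k Bᵐᵒᵖ A (b • x) =
          ((1 : A) ⊗ₜ[k] b) * TensorProduct.comm k Bᵐᵒᵖ A x
        induction x with
        | zero => rw [smul_zero, map_zero, mul_zero]
        | tmul x y => rw [TensorProduct.smul_tmul', smul_eq_mul, TensorProduct.comm_tmul,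
            TensorProduct.comm_tmul, Algebra.TensorProduct.tmul_mul_tmul, one_mul]
        | add x y hx hy => rw [smul_add, map_add, map_add, mul_add, hx, hy] }
  have : Module.Projective Bᵐᵒᵖ (A ⊗[k] Bᵐᵒᵖ) := Module.Projective.of_equiv e
  exact Module.Projective.of_isScalarTower (S := Bᵐᵒᵖ) (R := A ⊗[k] Bᵐᵒᵖ)

section OfActions

variable (H : Type u) [AddCommGroup H]

/-- The bimodule structure given by two commuting actions that agree on `k`. -/
@[reducible]
def moduleOfActions (l : A →+* AddMonoid.End H) (r : Bᵐᵒᵖ →+* AddMonoid.End H)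
    (hc : ∀ a b x, l a (r b x) = r b (l a x))
    (hk : ∀ (t : k) x, r (algebraMap k Bᵐᵒᵖ t) x = l (algebraMap k A t) x) :
    Module (A ⊗[k] Bᵐᵒᵖ) H :=
  letI : Module A H := Module.compHom _ l
  letI : Module Bᵐᵒᵖ H := Module.compHom _ r
  letI : Module k H := Module.compHom _ (algebraMap k A)
  haveI : SMulCommClass A Bᵐᵒᵖ H := ⟨hc⟩
  haveI : IsScalarTower k A H := ⟨fun t a x => by
    rw [Algebra.smul_def, mul_smul]; rfl⟩
  haveI : IsScalarTower k Bᵐᵒᵖ H := ⟨fun t c x => by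
    rw [Algebra.smul_def, mul_smul]
    exact hk t (c • x)⟩
  TensorProduct.Algebra.module

/-- The bimodule given by two commuting actions that agree on `k`. -/
def ofActions (l : A →+* AddMonoid.End H) (r : Bᵐᵒᵖ →+* AddMonoid.End H)
    (hc : ∀ a b x, l a (r b x) = r b (l a x))
    (hk : ∀ (t : k) x, r (algebraMap k Bᵐᵒᵖ t) x = l (algebraMap k A t) x) : KBimodule k A B :=
  letI := moduleOfActions H l r hc hk
  ModuleCat.of (A ⊗[k] Bᵐᵒᵖ) H

variable {H}

theorem ofActions_left_smul (l : A →+* AddMonoid.End H) (r : Bᵐᵒᵖ →+* AddMonoid.End H)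
    (hc : ∀ a b x, l a (r b x) = r b (l a x))
    (hk : ∀ (t : k) x, r (algebraMap k Bᵐᵒᵖ t) x = l (algebraMap k A t) x) (a : A) (x : H) :
    (a ⊗ₜ[k] (1 : Bᵐᵒᵖ)) • (show ofActions H l r hc hk from x) =
      (show ofActions H l r hc hk from l a x) := by
  change l a (r 1 x) = l a x
  rw [map_one]; rfl

theorem ofActions_right_smul (l : A →+* AddMonoid.End H) (r : Bᵐᵒᵖ →+* AddMonoid.End H)
    (hc : ∀ a b x, l a (r b x) = r b (l a x))
    (hk : ∀ (t : k) x, r (algebraMap k Bᵐᵒᵖ t) x = l (algebraMap k A t) x) (b : Bᵐᵒᵖ) (x : H) :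
    ((1 : A) ⊗ₜ[k] b) • (show ofActions H l r hc hk from x) =
      (show ofActions H l r hc hk from r b x) := by
  change l 1 (r b x) = r b x
  rw [map_one]; rfl

end OfActions

/-- The left action on a bimodule. -/
def actEndL (M : KBimodule k A B) : A →+* AddMonoid.End M where
  toFun a := actL M a
  map_one' := AddMonoidHom.ext one_tmul_one_smul
  map_mul' a a' := AddMonoidHom.ext fun m => mul_tmul_one_smul a a' m
  map_zero' := map_zero _
  map_add' := map_add _

@[simp]
theorem actEndL_apply (M : KBimodule k A B) (a : A) (m : M) :
    actEndL M a m = (a ⊗ₜ[k] (1 : Bᵐᵒᵖ)) • m := rfl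

/-- The right action on a bimodule. -/
def actEndR (M : KBimodule k A B) : Bᵐᵒᵖ →+* AddMonoid.End M where
  toFun b := (actR M).flip b.unop
  map_one' := AddMonoidHom.ext one_tmul_one_smul
  map_mul' a a' := AddMonoidHom.ext fun m => one_tmul_mul_smul a a' m
  map_zero' := AddMonoidHom.ext one_tmul_zero_smul
  map_add' a a' := AddMonoidHom.ext fun m => one_tmul_add_smul a a' m

@[simp]
theorem actEndR_apply (M : KBimodule k A B) (b : Bᵐᵒᵖ) (m : M) :
    actEndR M b m = ((1 : A) ⊗ₜ[k] b) • m := rfl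

section HomRight

variable (N : KBimodule k B C) {Z : Type u} [AddCommGroup Z] (l : A →+* AddMonoid.End Z)

/-- A group of additive maps `N → Z` that is stable under the left action of `A` on `Z` and the
left action of `B` on `N`, with both actions of `k` the same. -/
structure IsHomGroup (H : AddSubgroup (N →+ Z)) : Prop where
  left : ∀ φ ∈ H, ∀ a, (l a).comp φ ∈ H
  right : ∀ φ ∈ H, ∀ b, φ.comp (actEndL N b) ∈ H
  scalar : ∀ φ ∈ H, ∀ (t : k) (n : N), φ ((algebraMap k B t ⊗ₜ[k] (1 : Cᵐᵒᵖ)) • n) =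
    l (algebraMap k A t) (φ n)

variable {N l}

/-- A stable group of additive maps `N → Z`, as an `A`-`B`-bimodule. -/
def IsHomGroup.bimodule {H : AddSubgroup (N →+ Z)} (h : IsHomGroup N l H) : KBimodule k A B :=
  ofActions H
    { toFun := fun a =>
        { toFun := fun φ => ⟨(l a).comp φ.1, h.left φ.1 φ.2 a⟩
          map_zero' := Subtype.ext (AddMonoidHom.ext fun _ => map_zero (l a))
          map_add' := fun _ _ => Subtype.ext (AddMonoidHom.ext fun _ => map_add (l a) _ _) }
      map_one' := AddMonoidHom.ext fun _ => Subtype.ext (AddMonoidHom.ext fun _ =>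
        DFunLike.congr_fun (map_one l) _)
      map_mul' := fun a b => AddMonoidHom.ext fun _ => Subtype.ext (AddMonoidHom.ext fun _ =>
        DFunLike.congr_fun (map_mul l a b) _)
      map_zero' := AddMonoidHom.ext fun _ => Subtype.ext (AddMonoidHom.ext fun _ =>
        DFunLike.congr_fun (map_zero l) _)
      map_add' := fun a b => AddMonoidHom.ext fun _ => Subtype.ext (AddMonoidHom.ext fun _ =>
        DFunLike.congr_fun (map_add l a b) _) }
    { toFun := fun b =>
        { toFun := fun φ => ⟨φ.1.comp (actEndL N b.unop), h.right φ.1 φ.2 b.unop⟩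
          map_zero' := rfl
          map_add' := fun _ _ => rfl }
      map_one' := AddMonoidHom.ext fun φ => Subtype.ext (AddMonoidHom.ext fun n =>
        congrArg φ.1 (DFunLike.congr_fun (map_one (actEndL N)) n))
      map_mul' := fun a b => AddMonoidHom.ext fun φ => Subtype.ext (AddMonoidHom.ext fun n =>
        congrArg φ.1 (DFunLike.congr_fun (map_mul (actEndL N) b.unop a.unop) n))
      map_zero' := AddMonoidHom.ext fun φ => Subtype.ext (AddMonoidHom.ext fun n =>
        (congrArg φ.1 (DFunLike.congr_fun (map_zero (actEndL N)) n)).trans (map_zero φ.1))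
      map_add' := fun a b => AddMonoidHom.ext fun φ => Subtype.ext (AddMonoidHom.ext fun n =>
        (congrArg φ.1 (DFunLike.congr_fun (map_add (actEndL N) a.unop b.unop) n)).trans
          (map_add φ.1 _ _)) }
    (fun _ _ _ => rfl)
    (fun t φ => Subtype.ext (AddMonoidHom.ext fun n => h.scalar φ.1 φ.2 t n))

theorem IsHomGroup.left_smul {H : AddSubgroup (N →+ Z)} (h : IsHomGroup N l H) (a : A)
    (φ : H) : (a ⊗ₜ[k] (1 : Bᵐᵒᵖ)) • (show h.bimodule from φ) =
      (show h.bimodule from ⟨(l a).comp φ.1, h.left φ.1 φ.2 a⟩) :=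
  ofActions_left_smul _ _ _ _ a φ

theorem IsHomGroup.right_smul {H : AddSubgroup (N →+ Z)} (h : IsHomGroup N l H) (b : Bᵐᵒᵖ)
    (φ : H) : ((1 : A) ⊗ₜ[k] b) • (show h.bimodule from φ) =
      (show h.bimodule from ⟨φ.1.comp (actEndL N b.unop), h.right φ.1 φ.2 b.unop⟩) :=
  ofActions_right_smul _ _ _ _ b φ

/-- A surjection onto `W ⊗_B N`, for a projective bimodule `W`, has an equivariant section as soon
as maps out of `N` lift along it. -/
theorem exists_section_of_lift (W : KBimodule k A B) [Module.Projective (A ⊗[k] Bᵐᵒᵖ) W]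
    (p : Z →+ tensor W N) (hp : ∀ a z, p (l a z) = (a ⊗ₜ[k] (1 : Cᵐᵒᵖ)) • p z)
    {HZ : AddSubgroup (N →+ Z)} {HP : AddSubgroup (N →+ tensor W N)}
    (hZ : IsHomGroup N l HZ) (hP : IsHomGroup N (actEndL (tensor W N)) HP)
    (htm : ∀ w : W, tmHom W N w ∈ HP) (hsub : ∀ ψ ∈ HZ, p.comp ψ ∈ HP)
    (hsurj : ∀ φ ∈ HP, ∃ ψ ∈ HZ, p.comp ψ = φ) :
    ∃ g : tensor W N →+ Z, (∀ x, p (g x) = x) ∧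
      (∀ a x, g ((a ⊗ₜ[k] (1 : Cᵐᵒᵖ)) • x) = l a (g x)) ∧ ∀ w : W, g.comp (tmHom W N w) ∈ HZ := by
  -- Tensor-hom adjunction: `w ↦ (n ↦ w ⊗ n)` is a bimodule map from `W` to a Hom-bimodule, and
  -- postcomposition with `p` is a bimodule map `q` onto the latter. Projectivity of `W` lifts `f`
  -- through `q`, and uncurrying the lift gives `g`. The Hom-groups are left abstract so that maps
  -- linear over `C` and maps linear over `k` are treated together.
  let f : W →ₗ[A ⊗[k] Bᵐᵒᵖ] hP.bimodule := ofAddHom (M' := hP.bimodule)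
    (AddMonoidHom.codRestrict (tmHom W N) HP htm)
    (fun a w => by
      refine Eq.trans ?_ (hP.left_smul a ⟨tmHom W N w, htm w⟩).symm
      exact Subtype.ext (AddMonoidHom.ext fun n => (left_smul_tm a w n).symm))
    (fun b w => by
      refine Eq.trans ?_ (hP.right_smul b ⟨tmHom W N w, htm w⟩).symm
      exact Subtype.ext (AddMonoidHom.ext fun n => smul_tm w b.unop n))
  let q : hZ.bimodule →ₗ[A ⊗[k] Bᵐᵒᵖ] hP.bimodule :=
    ofAddHom (M := hZ.bimodule) (M' := hP.bimodule)
    (show HZ →+ HP from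
      { toFun := fun ψ => ⟨p.comp ψ.1, hsub ψ.1 ψ.2⟩
        map_zero' := Subtype.ext (AddMonoidHom.ext fun n => map_zero p)
        map_add' := fun ψ ψ' => Subtype.ext (AddMonoidHom.ext fun n => map_add p _ _) })
    (fun a (ψ : HZ) => by
      refine Eq.trans ?_ (hP.left_smul a ⟨p.comp ψ.1, hsub ψ.1 ψ.2⟩).symm
      rw [hZ.left_smul a ψ]
      exact Subtype.ext (AddMonoidHom.ext fun n => hp a _))
    (fun b (ψ : HZ) => by
      refine Eq.trans ?_ (hP.right_smul b ⟨p.comp ψ.1, hsub ψ.1 ψ.2⟩).symm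
      rw [hZ.right_smul b ψ]
      rfl)
  have hq : Function.Surjective q := fun φ => by
    obtain ⟨ψ, hψ, h⟩ := hsurj (show HP from φ).1 (show HP from φ).2
    exact ⟨(show HZ from ⟨ψ, hψ⟩), Subtype.ext h⟩
  obtain ⟨G, hG⟩ := Module.projective_lifting_property q f hq
  let G' : W →+ HZ := G.toAddMonoidHom
  have hG' : ∀ (w : W) (n : N), p ((G' w).1 n) = tm w n := fun w n =>
    DFunLike.congr_fun (congrArg Subtype.val (show (q (G w) : HP) = f w from
      DFunLike.congr_fun hG w)) n
  have hl : ∀ a (w : W), G' ((a ⊗ₜ[k] (1 : Bᵐᵒᵖ)) • w) =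
      ⟨(l a).comp (G' w).1, hZ.left _ (G' w).2 a⟩ := fun a w =>
    (map_smul G _ w).trans (hZ.left_smul a (G' w))
  have hr : ∀ (b : Bᵐᵒᵖ) (w : W), G' (((1 : A) ⊗ₜ[k] b) • w) =
      ⟨(G' w).1.comp (actEndL N b.unop), hZ.right _ (G' w).2 b.unop⟩ := fun b w =>
    (map_smul G _ w).trans (hZ.right_smul b (G' w))
  let g : tensor W N →+ Z := liftAdd (HZ.subtype.comp G') (fun w b n =>
    DFunLike.congr_fun (congrArg Subtype.val (hr (op b) w)) n)
  refine ⟨g, fun x => ?_, fun a x => ?_, fun w => ?_⟩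
  · exact DFunLike.congr_fun (tensor_addHom_ext (f := p.comp g) (g := AddMonoidHom.id _) hG') x
  · induction x using tensor_induction with
    | zero => rw [smul_zero, map_zero, map_zero]
    | tmul w n =>
      rw [left_smul_tm]
      exact DFunLike.congr_fun (congrArg Subtype.val (hl a w)) n
    | add x y hx hy => rw [smul_add, map_add, map_add, map_add, hx, hy]
  · exact (G' w).2

end HomRight

/-- The additive maps between bimodules that commute with the right action. -/
def equivariantR (N : KBimodule k B C) (Z : KBimodule k A C) : AddSubgroup (N →+ Z) where
  carrier := {φ | ∀ (c : Cᵐᵒᵖ) (n : N), φ (((1 : B) ⊗ₜ[k] c) • n) = ((1 : A) ⊗ₜ[k] c) • φ n}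
  add_mem' {φ ψ} hφ hψ c n := by
    rw [AddMonoidHom.add_apply, hφ, hψ, AddMonoidHom.add_apply, smul_add]
  zero_mem' c n := (smul_zero ((1 : A) ⊗ₜ[k] c)).symm
  neg_mem' {φ} hφ c n := by
    rw [AddMonoidHom.neg_apply, hφ, AddMonoidHom.neg_apply, smul_neg]

theorem isHomGroup_equivariantR (N : KBimodule k B C) (Z : KBimodule k A C) :
    IsHomGroup N (actEndL Z) (equivariantR N Z) where
  left φ hφ a c n := by
    change (a ⊗ₜ[k] (1 : Cᵐᵒᵖ)) • φ _ = ((1 : A) ⊗ₜ[k] c) • ((a ⊗ₜ[k] (1 : Cᵐᵒᵖ)) • φ n)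
    rw [hφ, smul_comm']
  right φ hφ b c n := by
    change φ ((b ⊗ₜ[k] (1 : Cᵐᵒᵖ)) • _) = ((1 : A) ⊗ₜ[k] c) • φ ((b ⊗ₜ[k] (1 : Cᵐᵒᵖ)) • n)
    rw [← smul_comm', hφ]
  scalar φ hφ t n := by
    rw [← algebraMap_smul, hφ, algebraMap_smul]; rfl

/-- If `W` is a projective bimodule and `N` is projective on the right, then `W ⊗_B N` is a
projective bimodule. -/
theorem projective_tensor_of_right (W : KBimodule k A B) [Module.Projective (A ⊗[k] Bᵐᵒᵖ) W]
    (N : KBimodule k B C) [Module.Projective Cᵐᵒᵖ N.right] :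
    Module.Projective (A ⊗[k] Cᵐᵒᵖ) (tensor W N) := by
  refine Module.Projective.of_lifting_property'' fun f hf => ?_
  -- The free cover of `W ⊗ N` is to be split. Right `C`-linear maps `N → W ⊗ N` lift to `Z` because
  -- `N` is projective over `C^op`.
  let Z : KBimodule k A C := ModuleCat.of _ (tensor W N →₀ A ⊗[k] Cᵐᵒᵖ)
  change Z →ₗ[A ⊗[k] Cᵐᵒᵖ] tensor W N at f
  obtain ⟨g, hpg, hgl, hgm⟩ := exists_section_of_lift W f.toAddMonoidHom
    (fun a z => map_smul f _ z) (isHomGroup_equivariantR N Z)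
    (isHomGroup_equivariantR N (tensor W N)) (fun w c n => (right_smul_tm c w n).symm)
    (fun ψ hψ c n => (congrArg f (hψ c n)).trans (map_smul f _ _)) (fun φ hφ => by
      obtain ⟨h, hh⟩ := Module.projective_lifting_property (R := Cᵐᵒᵖ) (P := N.right)
        (rightMap f) (show N.right →ₗ[Cᵐᵒᵖ] (tensor W N).right from
          { toFun := φ, map_add' := φ.map_add, map_smul' := hφ }) hf
      exact ⟨(show N →+ Z from h.toAddMonoidHom), fun c n => h.map_smul c n,
        AddMonoidHom.ext fun n => DFunLike.congr_fun hh n⟩)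
  refine ⟨ofAddHom (M' := Z) g hgl fun c x => ?_, LinearMap.ext hpg⟩
  induction x using tensor_induction with
  | zero => rw [smul_zero, map_zero, smul_zero]
  | tmul w n => rw [right_smul_tm]; exact hgm w c n
  | add x y hx hy => rw [smul_add, map_add, map_add, smul_add, hx, hy]

/-- The additive maps from a bimodule to an `A`-module that are linear over the ground field. -/
def scalarEquivariant (N : KBimodule k B C) (Z : ModuleCat.{u} A) : AddSubgroup (N →+ Z) where
  carrier := {φ | ∀ (t : k) (n : N), φ ((algebraMap k B t ⊗ₜ[k] (1 : Cᵐᵒᵖ)) • n) =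
    algebraMap k A t • φ n}
  add_mem' {φ ψ} hφ hψ c n := by
    rw [AddMonoidHom.add_apply, hφ, hψ, AddMonoidHom.add_apply, smul_add]
  zero_mem' c n := (smul_zero _).symm
  neg_mem' {φ} hφ c n := by
    rw [AddMonoidHom.neg_apply, hφ, AddMonoidHom.neg_apply, smul_neg]

theorem isHomGroup_scalarEquivariant (N : KBimodule k B C) (Z : ModuleCat.{u} A) :
    IsHomGroup N (Module.toAddMonoidEnd A Z) (scalarEquivariant (k := k) N Z) where
  left φ hφ a t n := by
    change a • φ _ = algebraMap k A t • a • φ n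
    rw [hφ, ← mul_smul, ← mul_smul, Algebra.commutes]
  right φ hφ b t n := by
    change φ ((b ⊗ₜ[k] (1 : Cᵐᵒᵖ)) • _) = algebraMap k A t • φ ((b ⊗ₜ[k] (1 : Cᵐᵒᵖ)) • n)
    rw [← hφ, ← mul_tmul_one_smul, ← mul_tmul_one_smul, Algebra.commutes]
  scalar φ hφ t n := hφ t n

/-- If `W` is a projective bimodule, then `W ⊗_B N` is projective on the left. -/
theorem projective_tensor_left (W : KBimodule k A B) [Module.Projective (A ⊗[k] Bᵐᵒᵖ) W]
    (N : KBimodule k B C) : Module.Projective A (tensor W N).left := by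
  refine Module.Projective.of_lifting_property'' fun f hf => ?_
  let Z : ModuleCat A := ModuleCat.of _ ((tensor W N).left →₀ A)
  change Z →ₗ[A] (tensor W N).left at f
  obtain ⟨g, hpg, hgl, -⟩ := exists_section_of_lift W (show Z →+ tensor W N from f.toAddMonoidHom)
    (fun a z => f.map_smul a z) (isHomGroup_scalarEquivariant N Z)
    (isHomGroup_scalarEquivariant N (tensor W N).left)
    (fun w t n => by
      refine (smul_tm w (algebraMap k B t) n).symm.trans
        (Eq.trans ?_ (left_smul_tm (algebraMap k A t) w n).symm)
      exact congrArg (fun x => tm x n) (algebraMap_smul t w))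
    (fun ψ hψ c n => (congrArg f (hψ c n)).trans (map_smul f _ _)) (fun φ hφ => by
      -- Here only `k`-linear lifts of maps out of `N` are needed. They exist for every `N`, because
      -- `k` is a field.
      let _ : Module k N := Module.compHom N ((Algebra.TensorProduct.includeLeft :
        B →ₐ[k] B ⊗[k] Cᵐᵒᵖ).toRingHom.comp (algebraMap k B))
      let _ : Module k Z := Module.compHom Z (algebraMap k A)
      let _ : Module k (tensor W N).left := Module.compHom (tensor W N).left (algebraMap k A)
      obtain ⟨h, hh⟩ := Module.projective_lifting_property (R := k) (P := N)
        (show Z →ₗ[k] (tensor W N).left from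
          { toFun := f, map_add' := f.map_add, map_smul' := fun t z => f.map_smul _ z })
        (show N →ₗ[k] (tensor W N).left from
          { toFun := φ, map_add' := φ.map_add, map_smul' := hφ }) hf
      exact ⟨h.toAddMonoidHom, fun c n => h.map_smul c n,
        AddMonoidHom.ext fun n => DFunLike.congr_fun hh n⟩)
  exact ⟨{ toFun := g, map_add' := g.map_add, map_smul' := hgl }, LinearMap.ext hpg⟩

/-- The additive maps between bimodules that commute with the left action. -/
def equivariantL (V : KBimodule k A B) (Z : KBimodule k A C) : AddSubgroup (V →+ Z) where
  carrier := {φ | ∀ (a : A) (v : V), φ ((a ⊗ₜ[k] (1 : Bᵐᵒᵖ)) • v) = (a ⊗ₜ[k] (1 : Cᵐᵒᵖ)) • φ v}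
  add_mem' {φ ψ} hφ hψ c n := by
    rw [AddMonoidHom.add_apply, hφ, hψ, AddMonoidHom.add_apply, smul_add]
  zero_mem' c n := (smul_zero (c ⊗ₜ[k] (1 : Cᵐᵒᵖ))).symm
  neg_mem' {φ} hφ c n := by
    rw [AddMonoidHom.neg_apply, hφ, AddMonoidHom.neg_apply, smul_neg]

theorem comp_mem_equivariantL {V : KBimodule k A B} {Z : KBimodule k A C} {φ : V →+ Z}
    (hφ : φ ∈ equivariantL V Z) (b : Bᵐᵒᵖ) : φ.comp (actEndR V b) ∈ equivariantL V Z :=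
  fun a v => by
    change φ (((1 : A) ⊗ₜ[k] b) • _) = (a ⊗ₜ[k] (1 : Cᵐᵒᵖ)) • φ (((1 : A) ⊗ₜ[k] b) • v)
    rw [smul_comm', hφ]

theorem mem_equivariantL_comp {V : KBimodule k A B} {Z : KBimodule k A C} {φ : V →+ Z}
    (hφ : φ ∈ equivariantL V Z) (c : Cᵐᵒᵖ) :
    AddMonoidHom.comp (actEndR Z c) φ ∈ equivariantL V Z :=
  fun a v => by
    change ((1 : A) ⊗ₜ[k] c) • φ _ = (a ⊗ₜ[k] (1 : Cᵐᵒᵖ)) • ((1 : A) ⊗ₜ[k] c) • φ v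
    rw [hφ, smul_comm']

/-- The `B`-`C`-bimodule of left `A`-linear maps between an `A`-`B`-bimodule and an
`A`-`C`-bimodule. -/
def homL (V : KBimodule k A B) (Z : KBimodule k A C) : KBimodule k B C :=
  ofActions (equivariantL V Z)
    { toFun := fun b =>
        { toFun := fun φ => ⟨φ.1.comp (actEndR V (op b)), comp_mem_equivariantL φ.2 (op b)⟩
          map_zero' := rfl
          map_add' := fun φ ψ => rfl }
      map_one' := AddMonoidHom.ext fun φ => Subtype.ext (AddMonoidHom.ext fun n =>
        congrArg φ.1 (DFunLike.congr_fun (map_one (actEndR V)) n))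
      map_mul' := fun a b => AddMonoidHom.ext fun φ => Subtype.ext (AddMonoidHom.ext fun n =>
        congrArg φ.1 (DFunLike.congr_fun (map_mul (actEndR V) (op b) (op a)) n))
      map_zero' := AddMonoidHom.ext fun φ => Subtype.ext (AddMonoidHom.ext fun n =>
        (congrArg φ.1 (DFunLike.congr_fun (map_zero (actEndR V)) n)).trans (map_zero φ.1))
      map_add' := fun a b => AddMonoidHom.ext fun φ => Subtype.ext (AddMonoidHom.ext fun n =>
        (congrArg φ.1 (DFunLike.congr_fun (map_add (actEndR V) (op a) (op b)) n)).trans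
          (map_add φ.1 _ _)) }
    { toFun := fun c =>
        { toFun := fun φ => ⟨AddMonoidHom.comp (actEndR Z c) φ.1, mem_equivariantL_comp φ.2 c⟩
          map_zero' := Subtype.ext (AddMonoidHom.ext fun n => map_zero (actEndR Z c))
          map_add' := fun φ ψ => Subtype.ext (AddMonoidHom.ext fun n =>
            map_add (actEndR Z c) _ _) }
      map_one' := AddMonoidHom.ext fun φ => Subtype.ext (AddMonoidHom.ext fun n =>
        DFunLike.congr_fun (map_one (actEndR Z)) _)
      map_mul' := fun a b => AddMonoidHom.ext fun φ => Subtype.ext (AddMonoidHom.ext fun n =>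
        DFunLike.congr_fun (map_mul (actEndR Z) a b) _)
      map_zero' := AddMonoidHom.ext fun φ => Subtype.ext (AddMonoidHom.ext fun n =>
        DFunLike.congr_fun (map_zero (actEndR Z)) _)
      map_add' := fun a b => AddMonoidHom.ext fun φ => Subtype.ext (AddMonoidHom.ext fun n =>
        DFunLike.congr_fun (map_add (actEndR Z) a b) _) }
    (fun a b φ => rfl)
    (fun t φ => Subtype.ext (AddMonoidHom.ext fun v => by
      change ((1 : A) ⊗ₜ[k] algebraMap k Cᵐᵒᵖ t) • φ.1 v =
        φ.1 (((1 : A) ⊗ₜ[k] algebraMap k Bᵐᵒᵖ t) • v)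
      rw [algebraMap_smul, algebraMap_smul, φ.2]))

theorem homL_left_smul {V : KBimodule k A B} {Z : KBimodule k A C} (b : B)
    (φ : equivariantL V Z) : (b ⊗ₜ[k] (1 : Cᵐᵒᵖ)) • (show homL V Z from φ) =
      (show homL V Z from (⟨φ.1.comp (actEndR V (op b)), comp_mem_equivariantL φ.2 (op b)⟩ :
        equivariantL V Z)) :=
  ofActions_left_smul _ _ _ _ b φ

theorem homL_right_smul {V : KBimodule k A B} {Z : KBimodule k A C} (c : Cᵐᵒᵖ)
    (φ : equivariantL V Z) : ((1 : B) ⊗ₜ[k] c) • (show homL V Z from φ) =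
      (show homL V Z from (⟨AddMonoidHom.comp (actEndR Z c) φ.1, mem_equivariantL_comp φ.2 c⟩ :
        equivariantL V Z)) :=
  ofActions_right_smul _ _ _ _ c φ

/-- Postcomposition with a map of bimodules, on groups of left linear maps. -/
def equivariantLMap (V : KBimodule k A B) {Z Z' : KBimodule k A C} (p : Z →ₗ[A ⊗[k] Cᵐᵒᵖ] Z') :
    equivariantL V Z →+ equivariantL V Z' where
  toFun ψ := ⟨p.toAddMonoidHom.comp ψ.1, fun a v => (congrArg p (ψ.2 a v)).trans (map_smul p _ _)⟩
  map_zero' := Subtype.ext (AddMonoidHom.ext fun _ => map_zero p)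
  map_add' _ _ := Subtype.ext (AddMonoidHom.ext fun _ => map_add p _ _)

/-- Postcomposition with a map of bimodules, as a map of bimodules. -/
def homLMap (V : KBimodule k A B) {Z Z' : KBimodule k A C} (p : Z →ₗ[A ⊗[k] Cᵐᵒᵖ] Z') :
    homL V Z →ₗ[B ⊗[k] Cᵐᵒᵖ] homL V Z' :=
  ofAddHom (M := homL V Z) (M' := homL V Z') (equivariantLMap V p)
    (fun b (ψ : equivariantL V Z) => (congrArg (equivariantLMap V p) (homL_left_smul b ψ)).trans
      (homL_left_smul b (equivariantLMap V p ψ)).symm)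
    (fun c (ψ : equivariantL V Z) => (congrArg (equivariantLMap V p) (homL_right_smul c ψ)).trans
      (Eq.trans (Subtype.ext (AddMonoidHom.ext fun _ => map_smul p _ _))
        (homL_right_smul c (equivariantLMap V p ψ)).symm))

/-- If `V` is projective on the left and `W` is a projective bimodule, then `V ⊗_B W` is a
projective bimodule. -/
theorem projective_tensor_of_left (V : KBimodule k A B) [Module.Projective A V.left]
    (W : KBimodule k B C) [Module.Projective (B ⊗[k] Cᵐᵒᵖ) W] :
    Module.Projective (A ⊗[k] Cᵐᵒᵖ) (tensor V W) := by
  refine Module.Projective.of_lifting_property'' fun p hp => ?_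
  let Z : KBimodule k A C := ModuleCat.of _ (tensor V W →₀ A ⊗[k] Cᵐᵒᵖ)
  change Z →ₗ[A ⊗[k] Cᵐᵒᵖ] tensor V W at p
  -- The adjunction in the other variable: `w ↦ (v ↦ v ⊗ w)` maps `W` to `Hom_A(V, V ⊗ W)`.
  -- Projectivity of `V` over `A` makes postcomposition with `p` surjective, and projectivity of `W`
  -- then lifts `f`.
  let f : W →ₗ[B ⊗[k] Cᵐᵒᵖ] homL V (tensor V W) := ofAddHom (M' := homL V (tensor V W))
    (AddMonoidHom.codRestrict (tmHom V W).flip (equivariantL V (tensor V W))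
      fun w a v => (left_smul_tm a v w).symm)
    (fun b w => by
      refine Eq.trans ?_ (homL_left_smul b _).symm
      exact Subtype.ext (AddMonoidHom.ext fun v => (smul_tm v b w).symm))
    (fun c w => by
      refine Eq.trans ?_ (homL_right_smul c _).symm
      exact Subtype.ext (AddMonoidHom.ext fun v => (right_smul_tm c v w).symm))
  let q := homLMap V p
  have hq : Function.Surjective q := fun (φ : equivariantL V (tensor V W)) => by
    obtain ⟨h, hh⟩ := Module.projective_lifting_property (R := A) (P := V.left)
      (leftMap p) (show V.left →ₗ[A] (tensor V W).left from
        { toFun := φ.1, map_add' := φ.1.map_add, map_smul' := φ.2 }) hp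
    exact ⟨(⟨h.toAddMonoidHom, fun a v => h.map_smul a v⟩ : equivariantL V Z),
      Subtype.ext (AddMonoidHom.ext fun v => DFunLike.congr_fun hh v)⟩
  obtain ⟨G, hG⟩ := Module.projective_lifting_property q f hq
  let G' : W →+ equivariantL V Z := G.toAddMonoidHom
  have hG' : ∀ (v : V) (w : W), p ((G' w).1 v) = tm v w := fun v w =>
    DFunLike.congr_fun (congrArg Subtype.val
      (show (q (G w) : equivariantL V (tensor V W)) = f w from DFunLike.congr_fun hG w)) v
  have hl : ∀ (b : B) (w : W), G' ((b ⊗ₜ[k] (1 : Cᵐᵒᵖ)) • w) =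
      ⟨(G' w).1.comp (actEndR V (op b)), comp_mem_equivariantL (G' w).2 (op b)⟩ := fun b w =>
    (map_smul G _ w).trans (homL_left_smul b (G' w))
  have hr : ∀ (c : Cᵐᵒᵖ) (w : W), G' (((1 : B) ⊗ₜ[k] c) • w) =
      ⟨AddMonoidHom.comp (actEndR Z c) (G' w).1, mem_equivariantL_comp (G' w).2 c⟩ := fun c w =>
    (map_smul G _ w).trans (homL_right_smul c (G' w))
  let g : tensor V W →ₗ[A ⊗[k] Cᵐᵒᵖ] Z := tensorLift (Z := Z)
    ((equivariantL V Z).subtype.comp G').flip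
    (fun v b w => (DFunLike.congr_fun (congrArg Subtype.val (hl b w)) v).symm)
    (fun a v w => (G' w).2 a v)
    (fun c v w => DFunLike.congr_fun (congrArg Subtype.val (hr c w)) v)
  exact ⟨g, tensor_ext (f := p.comp g) (g := LinearMap.id) hG'⟩

end KBimodule

/-! ### Vanishing of `Tor` for one-sided modules, by dimension shifting. -/

theorem ModuleCat.exists_projective_cover {R : Type u} [Ring R] (M : ModuleCat.{u} R) :
    ∃ (K P : ModuleCat.{u} R) (i : K →ₗ[R] P) (g : P →ₗ[R] M), Module.Projective R P ∧
      Function.Injective i ∧ Function.Exact i g ∧ Function.Surjective g := by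
  let g : (M →₀ R) →ₗ[R] M := Finsupp.linearCombination R id
  exact ⟨ModuleCat.of R (LinearMap.ker g), ModuleCat.of R (M →₀ R), (LinearMap.ker g).subtype, g,
    inferInstanceAs (Module.Projective R (M →₀ R)), Subtype.val_injective,
    LinearMap.exact_subtype_ker_map g,
    Finsupp.linearCombination_surjective _ Function.surjective_id⟩

namespace BalancedTensor

variable {R : Type u} [Ring R]

/-- The vanishing of `Tor_i^R(V, N)` for `1 ≤ i ≤ n`, in terms of a resolution of `N`. -/
def TorVanishing (V : ModuleCat.{u} Rᵐᵒᵖ) : ℕ → ModuleCat.{u} R → Prop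
  | 0, _ => True
  | n + 1, N => ∃ (N' F : ModuleCat.{u} R) (j : N' →ₗ[R] F) (h : F →ₗ[R] N),
      Module.Projective R F ∧ Function.Injective j ∧ Function.Exact j h ∧ Function.Surjective h ∧
        Function.Injective (map R (LinearMap.id : V →ₗ[Rᵐᵒᵖ] V) j) ∧ TorVanishing V n N'

theorem map_map_comm {M M' N N' : Type u} [AddCommGroup M] [Module Rᵐᵒᵖ M] [AddCommGroup M']
    [Module Rᵐᵒᵖ M'] [AddCommGroup N] [Module R N] [AddCommGroup N'] [Module R N']
    (f : M →ₗ[Rᵐᵒᵖ] M') (g : N →ₗ[R] N') (x : BalancedTensor R M N) :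
    map R LinearMap.id g (map R f LinearMap.id x) =
      map R f LinearMap.id (map R LinearMap.id g x) := by
  rw [map_comp_apply, map_comp_apply]; rfl

variable {V V' P : ModuleCat.{u} Rᵐᵒᵖ} {i : V' →ₗ[Rᵐᵒᵖ] P} {g : P →ₗ[Rᵐᵒᵖ] V}

/-- Balancing of `Tor_1`: vanishing read off from a presentation of `N` gives injectivity along a
presentation of `V`. The grid is the tensor product of the two presentations; its middle column is
injective because `F` is flat. -/
theorem TorVanishing.map_injective [Module.Projective Rᵐᵒᵖ P] (hi : Function.Injective i)
    (hig : Function.Exact i g) (hg : Function.Surjective g) {n : ℕ} {N : ModuleCat.{u} R}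
    (h : TorVanishing V (n + 1) N) :
    Function.Injective (map R i (LinearMap.id : N →ₗ[R] N)) := by
  obtain ⟨N', F, j, h, hF, hj, hjh, hh, hinj, -⟩ := h
  refine grid_injective (t := map R LinearMap.id j) (r := map R LinearMap.id h)
    (u := map R LinearMap.id j) (y := map R LinearMap.id h) (w := map R LinearMap.id j)
    (i := map R i LinearMap.id) (p := map R g LinearMap.id) (q := map R i LinearMap.id)
    (v := map R g LinearMap.id) (map_surjective Function.surjective_id hh)
    (map_injective_id_of_projective hi) hinj (exact_map_right hjh hh) (exact_map_left hig hg)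
    (fun x => ?_) (fun x => ?_) (fun x => ?_) (fun x => ?_) (fun x => ?_)
  · exact (exact_map_left hig hg).apply_apply_eq_zero x
  · exact (exact_map_right hjh hh).apply_apply_eq_zero x
  · exact (map_map_comm _ _ _).symm
  · exact map_map_comm _ _ _
  · exact (map_map_comm _ _ _).symm

/-- This is `Tor_i(V', N) = Tor_{i+1}(V, N)`. The composite `V' ⊗ N' → V' ⊗ F → P ⊗ F` also factors
through `P ⊗ N'`. Both maps of that factorization are injective: the first by balancing for `N'`,
the second by flatness of `P`. -/
theorem TorVanishing.syzygy [Module.Projective Rᵐᵒᵖ P] (hi : Function.Injective i)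
    (hig : Function.Exact i g) (hg : Function.Surjective g) {n : ℕ} {N : ModuleCat.{u} R}
    (h : TorVanishing V (n + 1) N) : TorVanishing V' n N := by
  induction n generalizing N with
  | zero => trivial
  | succ n ih =>
    obtain ⟨N', F, j, h, hF, hj, hjh, hh, -, hN'⟩ := h
    refine ⟨N', F, j, h, hF, hj, hjh, hh, ?_, ih hN'⟩
    have h₁ : Function.Injective (map R (LinearMap.id : P →ₗ[Rᵐᵒᵖ] P) j) :=
      map_id_injective_of_projective hj
    have h₂ := h₁.comp (TorVanishing.map_injective hi hig hg hN')
    intro x y hxy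
    refine h₂ ?_
    change map R _ _ (map R _ _ _) = map R _ _ (map R _ _ _)
    rw [map_map_comm, map_map_comm, hxy]

/-- If `0 → V' → P → V → 0` is exact, then vanishing for `V'` and `V` implies it for `P`, as long
as `V'` is flat. -/
theorem TorVanishing.extension [Module.Projective Rᵐᵒᵖ V'] (hi : Function.Injective i)
    (hig : Function.Exact i g) (hg : Function.Surjective g) {n : ℕ} {N : ModuleCat.{u} R}
    (h : TorVanishing V n N) : TorVanishing P n N := by
  induction n generalizing N with
  | zero => trivial
  | succ n ih =>
    obtain ⟨N', F, j, h, hF, hj, hjh, hh, hinj, hN'⟩ := h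
    refine ⟨N', F, j, h, hF, hj, hjh, hh, ?_, ih hN'⟩
    refine (injective_iff_map_eq_zero _).2 fun x hx => ?_
    -- The image of `x` in `V ⊗ N'` dies in `V ⊗ F`, hence is zero, so `x` comes from `V' ⊗ N'`.
    -- There the two flatness statements, for `F` and for `V'`, finish the chase.
    obtain ⟨y, rfl⟩ := (exact_map_left (N := N') hig hg x).1 (hinj (by
      rw [map_map_comm, hx, map_zero, map_zero]))
    rw [map_map_comm] at hx
    have h₁ := map_injective_id_of_projective (N := F) hi (hx.trans (map_zero _).symm)
    rw [map_id_injective_of_projective hj (h₁.trans (map_zero _).symm), map_zero]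

/-- The vanishing of `Tor`, for modules with a projective resolution that stays exact. -/
theorem torVanishing_of_exact (V : ModuleCat.{u} Rᵐᵒᵖ) (F : ℕ → ModuleCat.{u} R)
    [∀ i, Module.Projective R (F i)] (d : ∀ i, F (i + 1) →ₗ[R] F i)
    (hd : ∀ i, Function.Exact (d (i + 1)) (d i))
    (hV : ∀ i, Function.Exact (map R (LinearMap.id : V →ₗ[Rᵐᵒᵖ] V) (d (i + 1)))
      (map R (LinearMap.id : V →ₗ[Rᵐᵒᵖ] V) (d i))) (n i : ℕ) (N : ModuleCat.{u} R)
    (g : F i →ₗ[R] N) (hg : Function.Surjective g) (hdg : Function.Exact (d i) g) :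
    TorVanishing V n N := by
  induction n generalizing i N with
  | zero => trivial
  | succ n ih =>
    have hs : Function.Surjective (d i).rangeRestrict := LinearMap.surjective_rangeRestrict _
    have he : Function.Exact (d (i + 1)) (d i).rangeRestrict := fun x =>
      (Subtype.ext_iff.trans Iff.rfl).trans (hd i x)
    refine ⟨ModuleCat.of R (LinearMap.range (d i)), F i, (LinearMap.range (d i)).subtype, g,
      inferInstance, Subtype.val_injective, fun x => ?_, hg, ?_,
      ih (i + 1) (ModuleCat.of R (LinearMap.range (d i))) (d i).rangeRestrict hs he⟩
    · rw [hdg x]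
      exact ⟨fun ⟨y, hy⟩ => ⟨⟨x, y, hy⟩, rfl⟩, fun ⟨y, hy⟩ => hy ▸ y.2⟩
    -- An element of `V ⊗ range (d i)` that dies in `V ⊗ F i` lifts to a cycle in `V ⊗ F (i+1)`. By
    -- exactness that cycle comes from `V ⊗ F (i+2)`, which maps to zero in `V ⊗ range (d i)`.
    · refine (injective_iff_map_eq_zero _).2 fun y hy => ?_
      obtain ⟨z, rfl⟩ := map_surjective (R := R) (f := (LinearMap.id : V →ₗ[Rᵐᵒᵖ] V))
        Function.surjective_id hs y
      rw [map_comp_apply] at hy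
      obtain ⟨w, rfl⟩ := (hV i z).1 hy
      rw [map_comp_apply]
      have : (d i).rangeRestrict.comp (d (i + 1)) = 0 :=
        LinearMap.ext fun x => (he _).2 ⟨x, rfl⟩
      rw [this]
      exact DFunLike.congr_fun (hom_ext (f := map R (LinearMap.id.comp LinearMap.id) 0)
        (g := 0) fun m n => tmul_zero R _) w

/-- The derived functors are the homology of `V ⊗ P` for a projective resolution `P` of `N`. Their
vanishing in positive degrees says exactly that `V ⊗ P` stays exact there. -/
theorem torVanishing_of_isZero_ncTor {V : ModuleCat.{u} Rᵐᵒᵖ} {N : ModuleCat.{u} R}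
    (h : ∀ i, 1 ≤ i → Limits.IsZero (ncTor R i V N)) (n : ℕ) : TorVanishing V n N := by
  let P : ProjectiveResolution N := projectiveResolution N
  have hproj : ∀ i, Module.Projective R (P.complex.X i) := fun i =>
    (IsProjective.iff_projective _).2 (P.projective i)
  refine torVanishing_of_exact V (fun i => P.complex.X i) (fun i => (P.complex.d (i + 1) i).hom)
    (fun i x => ?_) (fun i x => ?_) n 0 N (P.π.f 0).hom ?_ ?_
  · have h₁ := (P.complex.exactAt_iff' (i + 2) (i + 1) i (by simp) (by simp)).1
      (P.complex_exactAt_succ i)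
    exact (ShortComplex.ShortExact.moduleCat_exact_iff_function_exact _).1 h₁ x
  · have h₀ := (Limits.IsZero.of_iso (h (i + 1) (by omega))
      (P.isoLeftDerivedObj (balancedTensorFunctor R V) (i + 1)).symm)
    have h₁ := (HomologicalComplex.exactAt_iff' _ (i + 2) (i + 1) i (by simp) (by simp)).1
      ((HomologicalComplex.exactAt_iff_isZero_homology _ _).2 h₀)
    exact (ShortComplex.ab_exact_iff_function_exact _).1 h₁ x
  · exact (ModuleCat.epi_iff_surjective _).1 inferInstance
  · have := P.exact₀
    exact (ShortComplex.ShortExact.moduleCat_exact_iff_function_exact _).1 this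

end BalancedTensor

/-! ### `Tor`-independence of bimodules. -/

namespace KBimodule

variable {k : Type v} [Field k]
variable {A B C D : Type u} [Ring A] [Algebra k A] [Ring B] [Algebra k B] [Ring C] [Algebra k C]
  [Ring D] [Algebra k D]

/-- The vanishing of `Tor_i^B(V, N)` for `1 ≤ i ≤ n`, in terms of resolutions of `V`. -/
def TorVanishes (N : KBimodule k B C) : ℕ → KBimodule k A B → Prop
  | 0, _ => True
  | n + 1, V => ∀ (V' P : KBimodule k A B) (i : V' →ₗ[A ⊗[k] Bᵐᵒᵖ] P)
      (g : P →ₗ[A ⊗[k] Bᵐᵒᵖ] V), Module.Projective (A ⊗[k] Bᵐᵒᵖ) P → Function.Injective i →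
      Function.Exact i g → Function.Surjective g →
        Function.Injective (tensorMap i (LinearMap.id : N →ₗ[B ⊗[k] Cᵐᵒᵖ] N)) ∧
          TorVanishes N n V'

/-- The vanishing of `Tor_i^B(V, N)` for all `i ≥ 1`. -/
def TorIndependent (V : KBimodule k A B) (N : KBimodule k B C) : Prop :=
  ∀ n, TorVanishes N n V

/-- The map `V ⊗ g`. -/
abbrev whiskerL (V : KBimodule k A B) {N N' : KBimodule k B C} (g : N →ₗ[B ⊗[k] Cᵐᵒᵖ] N') :
    tensor V N →ₗ[A ⊗[k] Cᵐᵒᵖ] tensor V N' :=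
  tensorMap LinearMap.id g

/-- The map `f ⊗ N`. -/
abbrev whiskerR {V V' : KBimodule k A B} (f : V →ₗ[A ⊗[k] Bᵐᵒᵖ] V') (N : KBimodule k B C) :
    tensor V N →ₗ[A ⊗[k] Cᵐᵒᵖ] tensor V' N :=
  tensorMap f LinearMap.id

theorem whisker_comm {V V' : KBimodule k A B} {N N' : KBimodule k B C}
    (f : V →ₗ[A ⊗[k] Bᵐᵒᵖ] V') (g : N →ₗ[B ⊗[k] Cᵐᵒᵖ] N') (x : tensor V N) :
    whiskerL V' g (whiskerR f N x) = whiskerR f N' (whiskerL V g x) := by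
  rw [tensorMap_comp_apply, tensorMap_comp_apply]; rfl

theorem injective_map_of_whiskerL (V : KBimodule k A B) {N N' : KBimodule k B C}
    (g : N →ₗ[B ⊗[k] Cᵐᵒᵖ] N') (h : Function.Injective (whiskerL V g)) :
    Function.Injective
      (BalancedTensor.map B (LinearMap.id : V.right →ₗ[Bᵐᵒᵖ] V.right) (leftMap g)) := by
  intro x y hxy
  have h₁ := tensorMap_eq (LinearMap.id : V →ₗ[A ⊗[k] Bᵐᵒᵖ] V) g x
  have h₂ := tensorMap_eq (LinearMap.id : V →ₗ[A ⊗[k] Bᵐᵒᵖ] V) g y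
  exact h (h₁.trans (Eq.trans hxy h₂.symm))

/-- Projective bimodules are projective on the right, so every bimodule presentation of `V` shifts
`Tor` over `B` correctly. -/
theorem TorVanishes.of_torVanishing {n : ℕ} {V : KBimodule k A B} {N : KBimodule k B C}
    (h : BalancedTensor.TorVanishing V.right n N.left) : TorVanishes N n V := by
  induction n generalizing V with
  | zero => trivial
  | succ n ih =>
    intro V' P i g hP hi hig hg
    have := projective_right P
    refine ⟨fun x y hxy => ?_, ih (h.syzygy (i := rightMap i) (g := rightMap g) hi hig hg)⟩
    rw [tensorMap_eq, tensorMap_eq] at hxy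
    exact h.map_injective (i := rightMap i) (g := rightMap g) hi hig hg hxy

variable {K L N : KBimodule k B C} {i : K →ₗ[B ⊗[k] Cᵐᵒᵖ] L} {g : L →ₗ[B ⊗[k] Cᵐᵒᵖ] N}

/-- The kernel of `V ⊗ K → V ⊗ L` is the image of `Tor_1(V, N)`. The proof is the grid chase for a
projective presentation of `V`, which is flat on the right. -/
theorem TorVanishes.tensorMap_injective {V : KBimodule k A B} (h : TorVanishes N 1 V)
    (hi : Function.Injective i) (hig : Function.Exact i g) (hg : Function.Surjective g) :
    Function.Injective (tensorMap (LinearMap.id : V →ₗ[A ⊗[k] Bᵐᵒᵖ] V) i) := by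
  obtain ⟨V', P, i', g', hP, hi', hig', hg'⟩ := ModuleCat.exists_projective_cover V
  have := projective_right P
  refine BalancedTensor.grid_injective
    (t := (whiskerR i' K).toAddMonoidHom) (r := (whiskerR g' K).toAddMonoidHom)
    (u := (whiskerR i' L).toAddMonoidHom) (y := (whiskerR g' L).toAddMonoidHom)
    (w := (whiskerR i' N).toAddMonoidHom) (i := (whiskerL V' i).toAddMonoidHom)
    (p := (whiskerL V' g).toAddMonoidHom) (q := (whiskerL P i).toAddMonoidHom)
    (v := (whiskerL P g).toAddMonoidHom) (z := (whiskerL V i).toAddMonoidHom)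
    (tensorMap_surjective hg' Function.surjective_id)
    (tensorMap_injective_of_projective_right P hi)
    (h V' P i' g' hP hi' hig' hg').1
    (tensorMap_exact_left hig' hg' L) (tensorMap_exact_right hig hg V')
    (fun x => ?_) (fun x => ?_) (fun x => ?_) (fun x => ?_) (fun x => ?_)
  · exact (tensorMap_exact_right hig hg P).apply_apply_eq_zero x
  · exact (tensorMap_exact_left hig' hg' K).apply_apply_eq_zero x
  · exact whisker_comm i' i x
  · exact (whisker_comm i' g x).symm
  · exact whisker_comm g' i x

/-- In the long exact sequence `Tor_i(V, K)` lies between `Tor_{i+1}(V, N)` and `Tor_i(V, L)`; hence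
one more degree is asked of `N`. -/
theorem TorVanishes.kernel (hi : Function.Injective i) (hig : Function.Exact i g)
    (hg : Function.Surjective g) {n : ℕ} {V : KBimodule k A B} (hL : TorVanishes L n V)
    (hN : TorVanishes N (n + 1) V) : TorVanishes K n V := by
  induction n generalizing V with
  | zero => trivial
  | succ n ih =>
    intro V' P j q hP hj hjq hq
    obtain ⟨hL₁, hL₂⟩ := hL V' P j q hP hj hjq hq
    obtain ⟨-, hN₂⟩ := hN V' P j q hP hj hjq hq
    refine ⟨fun x y hxy => ?_, ih hL₂ hN₂⟩
    have h₁ : TorVanishes N 1 V' := by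
      intro W' W a b hW ha hab hb
      exact ⟨(hN₂ W' W a b hW ha hab hb).1, trivial⟩
    refine (hL₁.comp (h₁.tensorMap_injective hi hig hg)) ?_
    change whiskerR j L (whiskerL V' i x) = whiskerR j L (whiskerL V' i y)
    rw [← whisker_comm, ← whisker_comm, hxy]

/-- In the long exact sequence `Tor_i(V, L)` lies between `Tor_i(V, K)` and `Tor_i(V, N)`. -/
theorem TorVanishes.extension (hi : Function.Injective i) (hig : Function.Exact i g)
    (hg : Function.Surjective g) {n : ℕ} {V : KBimodule k A B} (hK : TorVanishes K n V)
    (hN : TorVanishes N n V) : TorVanishes L n V := by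
  induction n generalizing V with
  | zero => trivial
  | succ n ih =>
    intro V' P j q hP hj hjq hq
    obtain ⟨hK₁, hK₂⟩ := hK V' P j q hP hj hjq hq
    obtain ⟨hN₁, hN₂⟩ := hN V' P j q hP hj hjq hq
    refine ⟨(injective_iff_map_eq_zero _).2 fun x hx => ?_, ih hK₂ hN₂⟩
    have := projective_right P
    obtain ⟨y, rfl⟩ := (tensorMap_exact_right hig hg V' x).1 (hN₁ (by
      rw [← whisker_comm, hx, map_zero, map_zero]))
    rw [← whisker_comm] at hx
    have h₁ := tensorMap_injective_of_projective_right P hi (hx.trans (map_zero _).symm)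
    rw [hK₁ (h₁.trans (map_zero _).symm), map_zero]

theorem TorIndependent.of_projective_left (V : KBimodule k A B) (N : KBimodule k B C)
    [Module.Projective B N.left] : TorIndependent V N := by
  intro n
  induction n generalizing V with
  | zero => trivial
  | succ n ih =>
    exact fun V' P j q hP hj hjq hq => ⟨tensorMap_injective_of_projective_left N hj, ih V'⟩

theorem TorIndependent.tensorMap_injective {V : KBimodule k A B} (h : TorIndependent V N)
    (hi : Function.Injective i) (hig : Function.Exact i g) (hg : Function.Surjective g) :
    Function.Injective (tensorMap (LinearMap.id : V →ₗ[A ⊗[k] Bᵐᵒᵖ] V) i) :=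
  (h 1).tensorMap_injective hi hig hg

theorem TorIndependent.kernel (hi : Function.Injective i) (hig : Function.Exact i g)
    (hg : Function.Surjective g) {V : KBimodule k A B} (hL : TorIndependent V L)
    (hN : TorIndependent V N) : TorIndependent V K :=
  fun n => (hL n).kernel hi hig hg (hN (n + 1))

theorem TorIndependent.extension (hi : Function.Injective i) (hig : Function.Exact i g)
    (hg : Function.Surjective g) {V : KBimodule k A B} (hK : TorIndependent V K)
    (hN : TorIndependent V N) : TorIndependent V L :=
  fun n => (hK n).extension hi hig hg (hN n)

theorem TorIndependent.syzygy {V V' P : KBimodule k A B} {N : KBimodule k B C}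
    {j : V' →ₗ[A ⊗[k] Bᵐᵒᵖ] P} {q : P →ₗ[A ⊗[k] Bᵐᵒᵖ] V} [Module.Projective (A ⊗[k] Bᵐᵒᵖ) P]
    (hj : Function.Injective j) (hjq : Function.Exact j q) (hq : Function.Surjective q)
    (h : TorIndependent V N) : TorIndependent V' N :=
  fun n => (h (n + 1) V' P j q ‹_› hj hjq hq).2

theorem TorIndependent.tensorMap_injective_left {V V' P : KBimodule k A B} {N : KBimodule k B C}
    {j : V' →ₗ[A ⊗[k] Bᵐᵒᵖ] P} {q : P →ₗ[A ⊗[k] Bᵐᵒᵖ] V} [Module.Projective (A ⊗[k] Bᵐᵒᵖ) P]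
    (hj : Function.Injective j) (hjq : Function.Exact j q) (hq : Function.Surjective q)
    (h : TorIndependent V N) :
    Function.Injective (tensorMap j (LinearMap.id : N →ₗ[B ⊗[k] Cᵐᵒᵖ] N)) :=
  (h 1 V' P j q ‹_› hj hjq hq).1

theorem TorIndependent.of_equiv_left {V V₂ : KBimodule k A B} {N : KBimodule k B C}
    (e : V ≃ₗ[A ⊗[k] Bᵐᵒᵖ] V₂) (h : TorIndependent V N) : TorIndependent V₂ N := by
  rintro (_ | n)
  · trivial
  · intro V' P j q hP hj hjq hq
    refine h (n + 1) V' P j (e.symm.toLinearMap.comp q) hP hj (fun x => ?_)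
      (e.symm.surjective.comp hq)
    rw [← hjq x]
    exact e.symm.map_eq_zero_iff

theorem TorIndependent.of_subsingleton (V : KBimodule k A B) (N : KBimodule k B C)
    [Subsingleton N] : TorIndependent V N := by
  have : ∀ (W : KBimodule k A B) (x : tensor W N), x = 0 := fun W x => by
    induction x using tensor_induction with
    | zero => rfl
    | tmul w n => rw [Subsingleton.elim n 0, tm_zero]
    | add x y hx hy => rw [hx, hy, add_zero]
  intro n
  induction n generalizing V with
  | zero => trivial
  | succ n ih =>
    exact fun V' P j q hP hj hjq hq =>
      ⟨fun x y _ => (this V' x).trans (this V' y).symm, ih V'⟩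

/-- The kernel case applied to `0 → N₂ → N → 0 → 0`. -/
theorem TorIndependent.of_equiv_right {V : KBimodule k A B} {N N₂ : KBimodule k B C}
    (e : N ≃ₗ[B ⊗[k] Cᵐᵒᵖ] N₂) (h : TorIndependent V N) : TorIndependent V N₂ :=
  TorIndependent.kernel (K := N₂) (L := N) (N := ModuleCat.of (B ⊗[k] Cᵐᵒᵖ) PUnit.{u + 1})
    (i := e.symm.toLinearMap) (g := 0) e.symm.injective
    (fun x => ⟨fun _ => e.symm.surjective x, fun _ => rfl⟩) (fun _ => ⟨0, rfl⟩) h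
    (have : Subsingleton (ModuleCat.of (B ⊗[k] Cᵐᵒᵖ) PUnit.{u + 1}) :=
      inferInstanceAs (Subsingleton PUnit)
    TorIndependent.of_subsingleton V _)

/-- The injections that witness independence from `X` stay injective after tensoring with the flat
left module `F`; associativity moves the brackets. -/
theorem TorIndependent.tensor_projective {V : KBimodule k A B} {X : KBimodule k B C}
    (h : TorIndependent V X) (F : KBimodule k C D) [Module.Projective C F.left] :
    TorIndependent V (tensor X F) := by
  intro n
  induction n generalizing V with
  | zero => trivial
  | succ n ih =>
    intro V' P j q hP hj hjq hq
    refine ⟨fun x y hxy => ?_, ih (h.syzygy hj hjq hq)⟩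
    have h₁ := tensorMap_injective_of_projective_left F (h.tensorMap_injective_left hj hjq hq)
    refine (assoc V' X F).symm.injective (h₁ ((assoc P X F).injective ?_))
    rw [assoc_naturality, assoc_naturality, LinearEquiv.apply_symm_apply,
      LinearEquiv.apply_symm_apply, tensorMap_id, hxy]

/-- If `Tor(V, X)`, `Tor(X, Y)` and `Tor(V, X ⊗ Y)` vanish, then so does `Tor(V ⊗ X, Y)`. -/
theorem TorIndependent.tensor {V : KBimodule k A B} {X : KBimodule k B C}
    (hVX : TorIndependent V X) {Y : KBimodule k C D} (hXY : TorIndependent X Y)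
    (h : TorIndependent V (X.tensor Y)) : TorIndependent (V.tensor X) Y := by
  refine fun n => TorVanishes.of_torVanishing ?_
  induction n generalizing Y with
  | zero => trivial
  | succ n ih =>
    -- Independence of `X` and `Y` keeps `0 → X ⊗ Y' → X ⊗ F → X ⊗ Y → 0` exact. Independence of `V`
    -- from `X ⊗ Y` then makes `V ⊗ (X ⊗ j)`, which is `(V ⊗ X) ⊗ j`, injective. The same sequence
    -- passes all hypotheses on to `Y'`.
    obtain ⟨Y', F, j, q, hF, hj, hjq, hq⟩ := ModuleCat.exists_projective_cover Y
    have := projective_left F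
    have hX := hXY.tensorMap_injective hj hjq hq
    have hX' := tensorMap_exact_right hjq hq X
    have hX'' : Function.Surjective (tensorMap (LinearMap.id : X →ₗ[B ⊗[k] Cᵐᵒᵖ] X) q) :=
      tensorMap_surjective Function.surjective_id hq
    have hV := h.tensorMap_injective hX hX' hX''
    refine ⟨KBimodule.left Y', KBimodule.left F, leftMap j, leftMap q, this, hj, hjq, hq, ?_,
      ih (TorIndependent.kernel hj hjq hq (.of_projective_left X F) hXY)
      (TorIndependent.kernel hX hX' hX'' (hVX.tensor_projective F) h)⟩
    have key : Function.Injective (tensorMap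
        (LinearMap.id : V.tensor X →ₗ[A ⊗[k] Cᵐᵒᵖ] V.tensor X) j) := fun x y hxy => by
      refine (assoc V X Y').injective (hV ?_)
      rw [← assoc_naturality, ← assoc_naturality, tensorMap_id, hxy]
    exact injective_map_of_whiskerL _ j key

end KBimodule

/-! ### Projective dimension in short exact sequences. -/

section ProjectiveDimension

variable {R : Type u} [Ring R] {X Y Z : ModuleCat.{u} R} {f : X →ₗ[R] Y} {g : Y →ₗ[R] Z}

theorem ModuleCat.shortExact_of_exact (hf : Function.Injective f) (hfg : Function.Exact f g)
    (hg : Function.Surjective g) :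
    (ShortComplex.mk (ModuleCat.ofHom f) (ModuleCat.ofHom g)
      (ModuleCat.hom_ext hfg.linearMap_comp_eq_zero)).ShortExact where
  exact := (ShortComplex.ShortExact.moduleCat_exact_iff_function_exact _).2 hfg
  mono_f := (ModuleCat.mono_iff_injective _).2 hf
  epi_g := (ModuleCat.epi_iff_surjective _).2 hg

theorem hasProjectiveDimensionLT_one_iff :
    HasProjectiveDimensionLT X 1 ↔ Module.Projective R X := by
  rw [← projective_iff_hasProjectiveDimensionLT_one, IsProjective.iff_projective]

theorem hasProjectiveDimensionLT_middle (hf : Function.Injective f) (hfg : Function.Exact f g)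
    (hg : Function.Surjective g) {n : ℕ} (hX : HasProjectiveDimensionLT X n)
    (hZ : HasProjectiveDimensionLT Z n) : HasProjectiveDimensionLT Y n :=
  (ModuleCat.shortExact_of_exact hf hfg hg).hasProjectiveDimensionLT_X₂ n hX hZ

theorem hasProjectiveDimensionLT_right (hf : Function.Injective f) (hfg : Function.Exact f g)
    (hg : Function.Surjective g) {n : ℕ} (hX : HasProjectiveDimensionLT X n)
    (hY : HasProjectiveDimensionLT Y (n + 1)) : HasProjectiveDimensionLT Z (n + 1) :=
  (ModuleCat.shortExact_of_exact hf hfg hg).hasProjectiveDimensionLT_X₃ n hX hY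

theorem hasProjectiveDimensionLT_left (hf : Function.Injective f) (hfg : Function.Exact f g)
    (hg : Function.Surjective g) {n : ℕ} (hY : HasProjectiveDimensionLT Y n)
    (hZ : HasProjectiveDimensionLT Z (n + 1)) : HasProjectiveDimensionLT X n :=
  (ModuleCat.shortExact_of_exact hf hfg hg).hasProjectiveDimensionLT_X₁ n hY hZ

theorem CategoryTheory.HasProjectiveDimensionLT.mono {m n : ℕ} (h : HasProjectiveDimensionLT X m)
    (hmn : m ≤ n) : HasProjectiveDimensionLT X n :=
  hasProjectiveDimensionLT_of_ge X m n hmn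

theorem CategoryTheory.HasProjectiveDimensionLT.of_equiv {n : ℕ} (h : HasProjectiveDimensionLT X n)
    (e : X ≃ₗ[R] Y) : HasProjectiveDimensionLT Y n :=
  hasProjectiveDimensionLT_of_iso e.toModuleIso n

/-- Bounds are strict, so `n + 1` means dimension at most `n`. The conclusion never reaches the
bound `0`, which only zero modules satisfy. -/
theorem hasProjectiveDimensionLT_syzygy (hf : Function.Injective f) (hfg : Function.Exact f g)
    (hg : Function.Surjective g) [Module.Projective R Y] {n : ℕ}
    (hZ : HasProjectiveDimensionLT Z (n + 2)) : HasProjectiveDimensionLT X (n + 1) :=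
  hasProjectiveDimensionLT_left hf hfg hg
    ((hasProjectiveDimensionLT_one_iff.2 ‹_›).mono (by omega)) hZ

end ProjectiveDimension

/-! ### Syzygies up to projective extensions, and stable isomorphism. -/

section Syzygy

variable {R : Type u} [Ring R]

theorem IsSyzygy.of_equiv_left {l : ℕ} {X X' K : ModuleCat.{u} R} (e : X ≃ₗ[R] X')
    (h : IsSyzygy l X K) : IsSyzygy l X' K := by
  cases l with
  | zero => exact h.map fun i => i.trans e.toModuleIso
  | succ l =>
    obtain ⟨P, f, hP₁, hP₂, hf, hK⟩ := h
    refine ⟨P, e.toLinearMap.comp f, hP₁, hP₂, e.surjective.comp hf, ?_⟩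
    rwa [LinearEquiv.ker_comp]

theorem IsSyzygy.of_equiv_right {l : ℕ} {X K K' : ModuleCat.{u} R} (e : K ≃ₗ[R] K')
    (h : IsSyzygy l X K) : IsSyzygy l X K' := by
  induction l generalizing X with
  | zero => exact h.map fun i => e.toModuleIso.symm.trans i
  | succ l ih =>
    obtain ⟨P, f, hP₁, hP₂, hf, hK⟩ := h
    exact ⟨P, f, hP₁, hP₂, hf, ih hK⟩

theorem IsSyzygy.refl (X : ModuleCat.{u} R) : IsSyzygy 0 X X := ⟨Iso.refl X⟩

/-- The equivalence of the first term of a short exact sequence with the kernel. -/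
def Function.Exact.equivKer {X Y Z : Type*} [AddCommGroup X] [Module R X] [AddCommGroup Y]
    [Module R Y] [AddCommGroup Z] [Module R Z] {f : X →ₗ[R] Y} {g : Y →ₗ[R] Z}
    (h : Function.Exact f g) (hf : Function.Injective f) : X ≃ₗ[R] LinearMap.ker g :=
  (LinearEquiv.ofInjective f hf).trans (LinearEquiv.ofEq _ _ h.linearMap_ker_eq.symm)

theorem IsSyzygy.of_exact {l : ℕ} {X' P X K : ModuleCat.{u} R} {i : X' →ₗ[R] P}
    {g : P →ₗ[R] X} [Module.Finite R P] [Module.Projective R P] (hi : Function.Injective i)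
    (hig : Function.Exact i g) (hg : Function.Surjective g) (h : IsSyzygy l X' K) :
    IsSyzygy (l + 1) X K :=
  ⟨P, g, ‹_›, ‹_›, hg, IsSyzygy.of_equiv_left (X' := ModuleCat.of R (LinearMap.ker g))
    (hig.equivKer hi) h⟩

theorem IsSyzygy.trans {s t : ℕ} {X K L : ModuleCat.{u} R} (h : IsSyzygy s X K)
    (h' : IsSyzygy t K L) : IsSyzygy (s + t) X L := by
  induction s generalizing X with
  | zero => rw [zero_add]; exact h'.of_equiv_left h.some.toLinearEquiv
  | succ s ih =>
    obtain ⟨P, f, hP₁, hP₂, hf, hK⟩ := h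
    rw [Nat.succ_add]
    exact ⟨P, f, hP₁, hP₂, hf, ih hK⟩

theorem IsSyzygy.finite [IsNoetherianRing R] {l : ℕ} {X K : ModuleCat.{u} R}
    (h : IsSyzygy l X K) [hX : Module.Finite R X] : Module.Finite R K := by
  induction l generalizing X with
  | zero => exact Module.Finite.equiv h.some.symm.toLinearEquiv
  | succ l ih =>
    obtain ⟨P, f, hP₁, hP₂, hf, hK⟩ := h
    have : Module.Finite R (LinearMap.ker f) := inferInstance
    exact ih hK (hX := this)

theorem exists_isSyzygy [IsNoetherianRing R] (l : ℕ) (X : ModuleCat.{u} R)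
    [hX : Module.Finite R X] : ∃ K, IsSyzygy l X K := by
  induction l generalizing X with
  | zero => exact ⟨X, .refl X⟩
  | succ l ih =>
    obtain ⟨n, f, hf⟩ := Module.Finite.exists_fin' R X
    have : Module.Finite R (LinearMap.ker f) := inferInstance
    obtain ⟨K, hK⟩ := ih (ModuleCat.of R (LinearMap.ker f)) (hX := this)
    exact ⟨K, ModuleCat.of R (Fin n → R), f, inferInstanceAs (Module.Finite R (Fin n → R)),
      inferInstanceAs (Module.Projective R (Fin n → R)), hf, hK⟩

/-- Each syzygy lowers the projective dimension by one, from at most `l` down to at most `0`. -/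
theorem IsSyzygy.projective {l : ℕ} {X K : ModuleCat.{u} R} (h : IsSyzygy l X K)
    (hX : HasProjectiveDimensionLT X (l + 1)) : Module.Projective R K := by
  induction l generalizing X with
  | zero =>
    have := hasProjectiveDimensionLT_one_iff.1 hX
    exact Module.Projective.of_equiv h.some.symm.toLinearEquiv
  | succ l ih =>
    obtain ⟨P, f, hP₁, hP₂, hf, hK⟩ := h
    exact ih hK (hasProjectiveDimensionLT_syzygy (X := ModuleCat.of R (LinearMap.ker f))
      (f := (LinearMap.ker f).subtype) Subtype.val_injective (LinearMap.exact_subtype_ker_map f)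
      hf hX)

/-- `L'` is an extension of a projective module by `L`. -/
def IsProjectiveExtension (L L' : ModuleCat.{u} R) : Prop :=
  ∃ (P : ModuleCat.{u} R) (i : L →ₗ[R] L') (q : L' →ₗ[R] P), Module.Projective R P ∧
    Function.Injective i ∧ Function.Exact i q ∧ Function.Surjective q

/-- If `0 → Y → Z → K → 0` is exact and `K` has projective dimension at most `l`, then an `l`-th
syzygy of `Y` extends to one of `Z` by a projective module. -/
theorem IsSyzygy.exists_isProjectiveExtension [IsNoetherianRing R] {l : ℕ}
    {Y Z K L : ModuleCat.{u} R} {i : Y →ₗ[R] Z} {g : Z →ₗ[R] K} (hi : Function.Injective i)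
    (hig : Function.Exact i g) (hg : Function.Surjective g) [hfin : Module.Finite R K]
    (hK : HasProjectiveDimensionLT K (l + 1)) (h : IsSyzygy l Y L) :
    ∃ L', IsSyzygy l Z L' ∧ IsProjectiveExtension L L' := by
  induction l generalizing Y Z K with
  | zero =>
    let e : L ≃ₗ[R] Y := h.some.toLinearEquiv
    refine ⟨Z, .refl Z, K, i.comp e.toLinearMap, g, hasProjectiveDimensionLT_one_iff.1 hK,
      hi.comp e.injective, fun z => (hig z).trans ?_, hg⟩
    exact ⟨fun ⟨y, hy⟩ => ⟨e.symm y, by simpa using hy⟩, fun ⟨y, hy⟩ => ⟨e y, hy⟩⟩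
  | succ l ih =>
    obtain ⟨Q, f, hQ₁, hQ₂, hf, hL⟩ := h
    obtain ⟨n, e₀, he₀⟩ := Module.Finite.exists_fin' R K
    obtain ⟨e, he⟩ := Module.projective_lifting_property g e₀ hg
    have he' : ∀ x, g (e x) = e₀ x := DFunLike.congr_fun he
    have hgi : ∀ y, g (i y) = 0 := hig.apply_apply_eq_zero
    -- Horseshoe construction: a cover of `Y` and a lift of a free cover of `K` together cover `Z`.
    -- The kernels again form a short exact sequence, in which `K` is replaced by its syzygy of
    -- smaller projective dimension. The induction ends when `K` itself is projective.
    let h : (Q × (Fin n → R)) →ₗ[R] Z := (i.comp f).coprod e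
    have hh : Function.Surjective h := fun z => by
      obtain ⟨x, hx⟩ := he₀ (g z)
      obtain ⟨y, hy⟩ := (hig (z - e x)).1 (by rw [map_sub, he', hx, sub_self])
      obtain ⟨q, rfl⟩ := hf y
      exact ⟨(q, x), by simp [h, hy]⟩
    let i' : LinearMap.ker f →ₗ[R] LinearMap.ker h :=
      ((LinearMap.inl R Q (Fin n → R)).comp (LinearMap.ker f).subtype).codRestrict _
        fun q => by simp [h]
    let g' : LinearMap.ker h →ₗ[R] LinearMap.ker e₀ :=
      ((LinearMap.snd R Q (Fin n → R)).comp (LinearMap.ker h).subtype).codRestrict _ fun z => by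
        have hz : i (f z.1.1) + e z.1.2 = 0 := z.2
        have hz' := congrArg g hz
        rwa [map_add, hgi, he', zero_add, map_zero] at hz'
    have hi' : Function.Injective i' := fun x y hxy =>
      Subtype.ext (congrArg (fun z => z.1.1) hxy)
    have hg' : Function.Surjective g' := fun x => by
      obtain ⟨y, hy⟩ := (hig (e x.1)).1 (by rw [he']; exact x.2)
      obtain ⟨q, rfl⟩ := hf y
      refine ⟨⟨(-q, x.1), ?_⟩, rfl⟩
      simp [h, hy]
    have hig' : Function.Exact i' g' := fun z => by
      constructor
      · intro hz
        have h₂ : z.1.2 = 0 := congrArg Subtype.val hz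
        have h₁ : i (f z.1.1) + e z.1.2 = 0 := z.2
        have h₃ : f z.1.1 = 0 := hi (by rwa [h₂, map_zero, add_zero, ← map_zero i] at h₁)
        exact ⟨⟨z.1.1, h₃⟩, Subtype.ext (Prod.ext rfl h₂.symm)⟩
      · rintro ⟨q, rfl⟩
        rfl
    have hK₁ : HasProjectiveDimensionLT (ModuleCat.of R (LinearMap.ker e₀)) (l + 1) :=
      hasProjectiveDimensionLT_syzygy (Y := ModuleCat.of R (Fin n → R))
        (X := ModuleCat.of R (LinearMap.ker e₀)) (f := (LinearMap.ker e₀).subtype)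
        Subtype.val_injective (LinearMap.exact_subtype_ker_map e₀) he₀ hK
    have : Module.Finite R (LinearMap.ker e₀) := inferInstance
    obtain ⟨L', hL', hext⟩ := ih (Y := ModuleCat.of R (LinearMap.ker f))
      (Z := ModuleCat.of R (LinearMap.ker h)) (K := ModuleCat.of R (LinearMap.ker e₀))
      (i := i') (g := g') hi' hig' hg' (hfin := this) hK₁ hL
    exact ⟨L', ⟨ModuleCat.of R (Q × (Fin n → R)), h,
      inferInstanceAs (Module.Finite R (Q × (Fin n → R))),
      inferInstanceAs (Module.Projective R (Q × (Fin n → R))), hh, hL'⟩, hext⟩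

/-- If the kernel of a surjection `Y → Z` has projective dimension at most `l`, then an
`(l + 1)`-st syzygy of `Y` extends to one of `Z` by a projective module. -/
theorem IsSyzygy.exists_isProjectiveExtension_of_surjective [IsNoetherianRing R] {l : ℕ}
    {Y Z L : ModuleCat.{u} R} {p : Y →ₗ[R] Z} (hp : Function.Surjective p) [Module.Finite R Y]
    (hK : HasProjectiveDimensionLT (ModuleCat.of R (LinearMap.ker p)) (l + 1))
    (h : IsSyzygy (l + 1) Y L) :
    ∃ L', IsSyzygy (l + 1) Z L' ∧ IsProjectiveExtension L L' := by
  obtain ⟨Q, f, hQ₁, hQ₂, hf, hL⟩ := h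
  -- The cover `Q → Y` also covers `Z` through `p`, and the kernel of the composite is an extension
  -- of `ker p` by `ker f`. One syzygy is spent here, which is why the index is `l + 1`.
  let i : LinearMap.ker f →ₗ[R] LinearMap.ker (p.comp f) :=
    Submodule.inclusion (LinearMap.ker_le_ker_comp f p)
  let g : LinearMap.ker (p.comp f) →ₗ[R] LinearMap.ker p :=
    (f.comp (LinearMap.ker (p.comp f)).subtype).codRestrict _ fun x => x.2
  have hg : Function.Surjective g := fun y => by
    obtain ⟨x, hx⟩ := hf y.1
    exact ⟨⟨x, by rw [LinearMap.mem_ker, LinearMap.comp_apply, hx]; exact y.2⟩, Subtype.ext hx⟩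
  have hig : Function.Exact i g := fun x =>
    ⟨fun hx => ⟨⟨x.1, congrArg Subtype.val hx⟩, rfl⟩, by rintro ⟨y, rfl⟩; exact Subtype.ext y.2⟩
  have : Module.Finite R (LinearMap.ker p) := inferInstance
  obtain ⟨L', hL', hext⟩ := IsSyzygy.exists_isProjectiveExtension
    (Y := ModuleCat.of R (LinearMap.ker f)) (Z := ModuleCat.of R (LinearMap.ker (p.comp f)))
    (K := ModuleCat.of R (LinearMap.ker p)) (i := i) (g := g)
    (Submodule.inclusion_injective _) hig hg (hfin := this) hK hL
  exact ⟨L', ⟨Q, p.comp f, hQ₁, hQ₂, hp.comp hf, hL'⟩, hext⟩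

/-- The extension splits, and `P` is finitely generated as a quotient of `L'`. With `r` the
retraction from the splitting, `r ∘ i` is the identity and `i ∘ r - 1 = -(s ∘ q)` factors through
`P`. -/
theorem IsProjectiveExtension.stablyIsomorphic {L L' : ModuleCat.{u} R}
    (h : IsProjectiveExtension L L') [Module.Finite R L] [Module.Finite R L'] :
    StablyIsomorphic L L' := by
  obtain ⟨P, i, q, hP, hi, hiq, hq⟩ := h
  have hPfin : Module.Finite R P := Module.Finite.of_surjective q hq
  obtain ⟨s, hs⟩ := Module.projective_lifting_property q LinearMap.id hq
  have hs' : ∀ x, q (s x) = x := DFunLike.congr_fun hs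
  let e := LinearEquiv.ofInjective i hi
  let r : L' →ₗ[R] L := e.symm.toLinearMap.comp
    ((LinearMap.id - s.comp q).codRestrict (LinearMap.range i) fun x =>
      (hiq _).1 (by simp [hs']))
  have hr : ∀ x, i (r x) = x - s (q x) := fun x =>
    congrArg Subtype.val (e.apply_symm_apply _)
  have hr' : ∀ x, r (i x) = x := fun x => hi (by
    rw [hr, hiq.apply_apply_eq_zero, map_zero, sub_zero])
  refine ⟨‹_›, ‹_›, ⟨⟨(CategoryTheory.Quotient.functor (stableRel R)).map (FGModuleCat.ofHom i),
    (CategoryTheory.Quotient.functor (stableRel R)).map (FGModuleCat.ofHom r), ?_, ?_⟩⟩⟩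
  · refine (Functor.map_comp _ _ _).symm.trans (Eq.trans ?_ (CategoryTheory.Functor.map_id _ _))
    exact congrArg _ (FGModuleCat.hom_ext (LinearMap.ext hr'))
  · refine (Functor.map_comp _ _ _).symm.trans (Eq.trans ?_ (CategoryTheory.Functor.map_id _ _))
    refine CategoryTheory.Quotient.sound _
      ⟨FGModuleCat.of R P, FGModuleCat.ofHom (-q), FGModuleCat.ofHom s, hP, ?_⟩
    refine FGModuleCat.hom_ext (LinearMap.ext fun x => ?_)
    change i (r x) - x = s (-q x)
    rw [hr, map_neg]
    abel

theorem StablyIsomorphic.symm {X Y : ModuleCat.{u} R} (h : StablyIsomorphic X Y) :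
    StablyIsomorphic Y X := by
  obtain ⟨hX, hY, ⟨e⟩⟩ := h
  exact ⟨hY, hX, ⟨e.symm⟩⟩

end Syzygy

/-! ### Finiteness, projective dimension and syzygies of tensor products of bimodules. -/

namespace KBimodule

variable {k : Type v} [Field k]
variable {A B C D : Type u} [Ring A] [Algebra k A] [Ring B] [Algebra k B] [Ring C] [Algebra k C]
  [Ring D] [Algebra k D]

section Finiteness

instance isNoetherianRing_tensor_op [FiniteDimensional k A] [FiniteDimensional k B] :
    IsNoetherianRing (A ⊗[k] Bᵐᵒᵖ) :=
  have : Module.Finite k Bᵐᵒᵖ := Module.Finite.equiv (opLinearEquiv k)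
  IsNoetherianRing.of_finite k _

theorem finite_left [FiniteDimensional k B] (M : KBimodule k A B)
    [hM : Module.Finite (A ⊗[k] Bᵐᵒᵖ) M] : Module.Finite A M.left := by
  have : Module.Finite k Bᵐᵒᵖ := Module.Finite.equiv (opLinearEquiv k)
  let _ : Module (A ⊗[k] Bᵐᵒᵖ) M.left := inferInstanceAs (Module (A ⊗[k] Bᵐᵒᵖ) M)
  have : Module.Finite (A ⊗[k] Bᵐᵒᵖ) M.left := hM
  have : IsScalarTower A (A ⊗[k] Bᵐᵒᵖ) M.left := ⟨fun a x w => by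
    refine Eq.trans ?_ (mul_smul (a ⊗ₜ[k] (1 : Bᵐᵒᵖ)) x (show M from w))
    congr 1
    induction x with
    | zero => rw [smul_zero, mul_zero]
    | tmul x y => rw [TensorProduct.smul_tmul', smul_eq_mul, Algebra.TensorProduct.tmul_mul_tmul,
        one_mul]
    | add x y hx hy => rw [smul_add, mul_add, hx, hy]⟩
  exact Module.Finite.trans (A ⊗[k] Bᵐᵒᵖ) M.left

theorem finite_right [FiniteDimensional k A] (M : KBimodule k A B)
    [hM : Module.Finite (A ⊗[k] Bᵐᵒᵖ) M] : Module.Finite Bᵐᵒᵖ M.right := by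
  let _ : Module (A ⊗[k] Bᵐᵒᵖ) M.right := inferInstanceAs (Module (A ⊗[k] Bᵐᵒᵖ) M)
  have : Module.Finite (A ⊗[k] Bᵐᵒᵖ) M.right := hM
  let _ : Module Bᵐᵒᵖ (A ⊗[k] Bᵐᵒᵖ) := Module.compHom _
    (Algebra.TensorProduct.includeRight : Bᵐᵒᵖ →ₐ[k] A ⊗[k] Bᵐᵒᵖ).toRingHom
  have : IsScalarTower Bᵐᵒᵖ (A ⊗[k] Bᵐᵒᵖ) M.right := ⟨fun b x w =>
    mul_smul ((1 : A) ⊗ₜ[k] b) x (show M from w)⟩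
  let e : Bᵐᵒᵖ ⊗[k] A ≃ₗ[Bᵐᵒᵖ] A ⊗[k] Bᵐᵒᵖ :=
    { TensorProduct.comm k Bᵐᵒᵖ A with
      map_smul' := fun b x => by
        change TensorProduct.comm k Bᵐᵒᵖ A (b • x) =
          ((1 : A) ⊗ₜ[k] b) * TensorProduct.comm k Bᵐᵒᵖ A x
        induction x with
        | zero => rw [smul_zero, map_zero, mul_zero]
        | tmul x y => rw [TensorProduct.smul_tmul', smul_eq_mul, TensorProduct.comm_tmul,
            TensorProduct.comm_tmul, Algebra.TensorProduct.tmul_mul_tmul, one_mul]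
        | add x y hx hy => rw [smul_add, map_add, map_add, mul_add, hx, hy] }
  have : Module.Finite Bᵐᵒᵖ (A ⊗[k] Bᵐᵒᵖ) := Module.Finite.equiv e
  exact Module.Finite.trans (A ⊗[k] Bᵐᵒᵖ) M.right

/-- Tensors of left generators of `M` with right generators of `N` generate: first the coefficients
from `A` are moved out on the left, then those from `C` on the right. -/
theorem finite_tensor (M : KBimodule k A B) (N : KBimodule k B C) [hM : Module.Finite A M.left]
    [hN : Module.Finite Cᵐᵒᵖ N.right] : Module.Finite (A ⊗[k] Cᵐᵒᵖ) (tensor M N) := by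
  obtain ⟨s, hs⟩ := Module.finite_def.1 hM
  obtain ⟨t, ht⟩ := Module.finite_def.1 hN
  have hst : (Set.image2 (fun (m : M) (n : N) => tm m n) (s : Set M.left)
      (t : Set N.right)).Finite := s.finite_toSet.image2 _ t.finite_toSet
  refine Module.finite_def.2 (Submodule.fg_def.2 ⟨_, hst, ?_⟩)
  set S := Submodule.span (A ⊗[k] Cᵐᵒᵖ) (Set.image2 (fun (m : M) (n : N) => tm m n)
    (s : Set M.left) (t : Set N.right)) with hS
  have key : ∀ n ∈ t, ∀ m : M.left, tm (M := M) (N := N) m n ∈ S := fun n hn m => by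
    have hm : m ∈ Submodule.span A (s : Set M.left) := hs ▸ Submodule.mem_top
    induction hm using Submodule.span_induction with
    | mem m hm => exact Submodule.subset_span (Set.mem_image2_of_mem hm hn)
    | zero => exact (zero_tm (M := M) (N := N) n) ▸ S.zero_mem
    | add x y _ _ hx hy => exact (add_tm (M := M) (N := N) x y n) ▸ S.add_mem hx hy
    | smul a x _ hx =>
      exact (left_smul_tm (M := M) (N := N) a x n) ▸ S.smul_mem (a ⊗ₜ[k] (1 : Cᵐᵒᵖ)) hx
  have key' : ∀ (m : M) (n : N.right), tm (M := M) (N := N) m n ∈ S := fun m n => by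
    have hn : n ∈ Submodule.span Cᵐᵒᵖ (t : Set N.right) := ht ▸ Submodule.mem_top
    induction hn using Submodule.span_induction with
    | mem n hn => exact key n hn m
    | zero => exact (tm_zero (M := M) (N := N) m) ▸ S.zero_mem
    | add x y _ _ hx hy => exact (tm_add (M := M) (N := N) m x y) ▸ S.add_mem hx hy
    | smul c x _ hx =>
      exact (right_smul_tm (M := M) (N := N) c m x) ▸ S.smul_mem ((1 : A) ⊗ₜ[k] c) hx
  refine (Submodule.eq_top_iff').2 fun x => ?_
  induction x using tensor_induction with
  | zero => exact S.zero_mem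
  | add x y hx hy => exact S.add_mem hx hy
  | tmul m n => exact key' m n

end Finiteness

theorem TorIndependent.of_projective_right (V : KBimodule k A B) (N : KBimodule k B C)
    [Module.Projective Bᵐᵒᵖ V.right] : TorIndependent V N := by
  refine fun n => TorVanishes.of_torVanishing ?_
  generalize N.left = N'
  induction n generalizing N' with
  | zero => trivial
  | succ n ih =>
    obtain ⟨Y', F, j, q, hF, hj, hjq, hq⟩ := ModuleCat.exists_projective_cover N'
    exact ⟨Y', F, j, q, hF, hj, hjq, hq,
      BalancedTensor.map_id_injective_of_projective (M := V.right) hj, ih Y'⟩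

section ProjectiveDimension

/-- Restriction to one side is exact and preserves projectives. -/
theorem hasProjectiveDimensionLT_of_left {X : KBimodule k A B} {n : ℕ}
    (h : HasProjectiveDimensionLT X (n + 1)) : HasProjectiveDimensionLT X.left (n + 1) := by
  induction n generalizing X with
  | zero =>
    have := hasProjectiveDimensionLT_one_iff.1 h
    exact hasProjectiveDimensionLT_one_iff.2 (projective_left X)
  | succ n ih =>
    obtain ⟨Y, F, j, q, hF, hj, hjq, hq⟩ := ModuleCat.exists_projective_cover X
    exact hasProjectiveDimensionLT_right (f := leftMap j) (g := leftMap q) hj hjq hq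
      (ih (hasProjectiveDimensionLT_syzygy hj hjq hq h))
      ((hasProjectiveDimensionLT_one_iff.2 (projective_left F)).mono (by omega))

theorem hasProjectiveDimensionLT_of_right {X : KBimodule k A B} {n : ℕ}
    (h : HasProjectiveDimensionLT X (n + 1)) : HasProjectiveDimensionLT X.right (n + 1) := by
  induction n generalizing X with
  | zero =>
    have := hasProjectiveDimensionLT_one_iff.1 h
    exact hasProjectiveDimensionLT_one_iff.2 (projective_right X)
  | succ n ih =>
    obtain ⟨Y, F, j, q, hF, hj, hjq, hq⟩ := ModuleCat.exists_projective_cover X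
    exact hasProjectiveDimensionLT_right (f := rightMap j) (g := rightMap q) hj hjq hq
      (ih (hasProjectiveDimensionLT_syzygy hj hjq hq h))
      ((hasProjectiveDimensionLT_one_iff.2 (projective_right F)).mono (by omega))

/-- As `V` is left projective, `V ⊗ -` sends projective bimodules to projective bimodules, and
independence keeps presentations of `Y` exact. -/
theorem TorIndependent.hasProjectiveDimensionLT_of_projective_left {V : KBimodule k A B}
    {Y : KBimodule k B C} [Module.Projective A V.left] (h : TorIndependent V Y) {n : ℕ}
    (hY : HasProjectiveDimensionLT Y (n + 1)) :
    HasProjectiveDimensionLT (V.tensor Y) (n + 1) := by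
  induction n generalizing Y with
  | zero =>
    have := hasProjectiveDimensionLT_one_iff.1 hY
    exact hasProjectiveDimensionLT_one_iff.2 (projective_tensor_of_left V Y)
  | succ n ih =>
    obtain ⟨Y', F, j, q, hF, hj, hjq, hq⟩ := ModuleCat.exists_projective_cover Y
    have := projective_left F
    exact hasProjectiveDimensionLT_right (h.tensorMap_injective hj hjq hq)
      (tensorMap_exact_right hjq hq V) (tensorMap_surjective Function.surjective_id hq)
      (ih (.kernel hj hjq hq (.of_projective_left V F) h)
        (hasProjectiveDimensionLT_syzygy hj hjq hq hY))
      ((hasProjectiveDimensionLT_one_iff.2 (projective_tensor_of_left V F)).mono (by omega))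

theorem TorIndependent.hasProjectiveDimensionLT_of_projective_right {V : KBimodule k A B}
    {N : KBimodule k B C} [Module.Projective Cᵐᵒᵖ N.right] (h : TorIndependent V N) {n : ℕ}
    (hV : HasProjectiveDimensionLT V (n + 1)) :
    HasProjectiveDimensionLT (V.tensor N) (n + 1) := by
  induction n generalizing V with
  | zero =>
    have := hasProjectiveDimensionLT_one_iff.1 hV
    exact hasProjectiveDimensionLT_one_iff.2 (projective_tensor_of_right V N)
  | succ n ih =>
    obtain ⟨V', F, j, q, hF, hj, hjq, hq⟩ := ModuleCat.exists_projective_cover V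
    exact hasProjectiveDimensionLT_right (h.tensorMap_injective_left hj hjq hq)
      (tensorMap_exact_left hjq hq N) (tensorMap_surjective hq Function.surjective_id)
      (ih (h.syzygy hj hjq hq) (hasProjectiveDimensionLT_syzygy hj hjq hq hV))
      ((hasProjectiveDimensionLT_one_iff.2 (projective_tensor_of_right F N)).mono (by omega))

/-- Dimensions add, by induction along a resolution of `V`. Its terms `F` are projective on both
sides, so each `F ⊗ Y` has at most the dimension of `Y`. -/
theorem TorIndependent.exists_hasProjectiveDimensionLT {V : KBimodule k A B} {Y : KBimodule k B C}
    (h : TorIndependent V Y) {m n : ℕ} (hV : HasProjectiveDimensionLT V (m + 1))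
    (hY : HasProjectiveDimensionLT Y (n + 1)) :
    HasProjectiveDimensionLT (V.tensor Y) (m + n + 1) := by
  induction m generalizing V with
  | zero =>
    have := hasProjectiveDimensionLT_one_iff.1 hV
    have := projective_left V
    exact (h.hasProjectiveDimensionLT_of_projective_left hY).mono (by omega)
  | succ m ih =>
    obtain ⟨V', F, j, q, hF, hj, hjq, hq⟩ := ModuleCat.exists_projective_cover V
    have := projective_left F
    have := projective_right F
    have h₁ := ih (h.syzygy hj hjq hq) (hasProjectiveDimensionLT_syzygy hj hjq hq hV)
    have h₂ := (TorIndependent.of_projective_right F Y).hasProjectiveDimensionLT_of_projective_left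
      hY
    exact (hasProjectiveDimensionLT_right (h.tensorMap_injective_left hj hjq hq)
      (tensorMap_exact_left hjq hq Y) (tensorMap_surjective hq Function.surjective_id)
      h₁ (h₂.mono (by omega))).mono (by omega)

end ProjectiveDimension

section Syzygy

/-- Finitely generated projective bimodules restrict to finitely generated projective left modules;
finite generation uses that `B` is finite-dimensional. -/
theorem isSyzygy_left [FiniteDimensional k B] {l : ℕ} {X K : KBimodule k A B}
    (h : IsSyzygy l X K) : IsSyzygy l X.left K.left := by
  induction l generalizing X with
  | zero => exact h.map fun i => (ModuleCat.restrictScalars _).mapIso i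
  | succ l ih =>
    obtain ⟨P, f, hP₁, hP₂, hf, hK⟩ := h
    have := finite_left P
    have := projective_left P
    exact IsSyzygy.of_exact (X' := left (ModuleCat.of (A ⊗[k] Bᵐᵒᵖ) (LinearMap.ker f)))
      (P := left P) (i := leftMap (LinearMap.ker f).subtype) (g := leftMap f)
      Subtype.val_injective (LinearMap.exact_subtype_ker_map f) hf (ih hK)

theorem isSyzygy_right [FiniteDimensional k A] {l : ℕ} {X K : KBimodule k A B}
    (h : IsSyzygy l X K) : IsSyzygy l X.right K.right := by
  induction l generalizing X with
  | zero => exact h.map fun i => (ModuleCat.restrictScalars _).mapIso i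
  | succ l ih =>
    obtain ⟨P, f, hP₁, hP₂, hf, hK⟩ := h
    have := finite_right P
    have := projective_right P
    exact IsSyzygy.of_exact (X' := right (ModuleCat.of (A ⊗[k] Bᵐᵒᵖ) (LinearMap.ker f)))
      (P := right P) (i := rightMap (LinearMap.ker f).subtype) (g := rightMap f)
      Subtype.val_injective (LinearMap.exact_subtype_ker_map f) hf (ih hK)

/-- Each `V ⊗ P` is again a finitely generated projective bimodule, and independence keeps the
sequence exact, so `V ⊗ -` carries syzygies to syzygies. -/
theorem TorIndependent.isSyzygy_of_projective_left [FiniteDimensional k B] {V : KBimodule k A B}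
    [Module.Projective A V.left] [Module.Finite A V.left] {Y K : KBimodule k B C}
    (h : TorIndependent V Y) {l : ℕ} (hK : IsSyzygy l Y K) :
    IsSyzygy l (V.tensor Y) (V.tensor K) := by
  induction l generalizing Y with
  | zero => exact hK.map fun i => (tensorEquiv (.refl _ V) i.toLinearEquiv).toModuleIso
  | succ l ih =>
    obtain ⟨P, f, hP₁, hP₂, hf, hK⟩ := hK
    have := finite_right P
    have := projective_left P
    have := finite_tensor V P
    have := projective_tensor_of_left V P
    have hfe := LinearMap.exact_subtype_ker_map f
    exact IsSyzygy.of_exact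
      (X' := V.tensor (ModuleCat.of (B ⊗[k] Cᵐᵒᵖ) (LinearMap.ker f)))
      (i := whiskerL V (N := ModuleCat.of (B ⊗[k] Cᵐᵒᵖ) (LinearMap.ker f))
        (LinearMap.ker f).subtype) (g := whiskerL V f)
      (h.tensorMap_injective (K := ModuleCat.of (B ⊗[k] Cᵐᵒᵖ) (LinearMap.ker f))
        Subtype.val_injective hfe hf)
      (tensorMap_exact_right (N := ModuleCat.of (B ⊗[k] Cᵐᵒᵖ) (LinearMap.ker f)) hfe hf V)
      (tensorMap_surjective Function.surjective_id hf)
      (ih (.kernel (K := ModuleCat.of (B ⊗[k] Cᵐᵒᵖ) (LinearMap.ker f))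
        Subtype.val_injective hfe hf (.of_projective_left V P) h) hK)

theorem TorIndependent.isSyzygy_of_projective_right [FiniteDimensional k B]
    {V K : KBimodule k A B} {N : KBimodule k B C} [Module.Projective Cᵐᵒᵖ N.right]
    [Module.Finite Cᵐᵒᵖ N.right] (h : TorIndependent V N) {l : ℕ} (hK : IsSyzygy l V K) :
    IsSyzygy l (V.tensor N) (K.tensor N) := by
  induction l generalizing V with
  | zero => exact hK.map fun i => (tensorEquiv i.toLinearEquiv (.refl _ N)).toModuleIso
  | succ l ih =>
    obtain ⟨P, f, hP₁, hP₂, hf, hK⟩ := hK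
    have := finite_left P
    have := finite_tensor P N
    have := projective_tensor_of_right P N
    have hfe := LinearMap.exact_subtype_ker_map f
    exact IsSyzygy.of_exact
      (X' := KBimodule.tensor (ModuleCat.of (A ⊗[k] Bᵐᵒᵖ) (LinearMap.ker f)) N)
      (i := whiskerR (V := ModuleCat.of (A ⊗[k] Bᵐᵒᵖ) (LinearMap.ker f))
        (LinearMap.ker f).subtype N) (g := whiskerR f N)
      (h.tensorMap_injective_left (V' := ModuleCat.of (A ⊗[k] Bᵐᵒᵖ) (LinearMap.ker f))
        Subtype.val_injective hfe hf)
      (tensorMap_exact_left (M := ModuleCat.of (A ⊗[k] Bᵐᵒᵖ) (LinearMap.ker f)) hfe hf N)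
      (tensorMap_surjective hf Function.surjective_id)
      (ih (h.syzygy (V' := ModuleCat.of (A ⊗[k] Bᵐᵒᵖ) (LinearMap.ker f))
        Subtype.val_injective hfe hf) hK)

/-- A syzygy `K` of `V` as a bimodule gives a syzygy `K ⊗ N` of `V ⊗ N` as a left module. -/
theorem TorIndependent.isSyzygy_tensor_left [FiniteDimensional k B] [FiniteDimensional k C]
    {V K : KBimodule k A B} {N : KBimodule k B C} [Module.Finite Cᵐᵒᵖ N.right]
    (h : TorIndependent V N) {l : ℕ} (hK : IsSyzygy l V K) :
    IsSyzygy l (V.tensor N).left (K.tensor N).left := by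
  induction l generalizing V with
  | zero =>
    exact hK.map fun i => (ModuleCat.restrictScalars _).mapIso
      (tensorEquiv i.toLinearEquiv (.refl _ N)).toModuleIso
  | succ l ih =>
    obtain ⟨P, f, hP₁, hP₂, hf, hK⟩ := hK
    have := finite_left P
    have := finite_tensor P N
    have := finite_left (KBimodule.tensor P N)
    -- Nothing makes `N` projective on the right, so `P ⊗ N` is known to be projective only as a
    -- left module. This is why the conclusion is one-sided.
    have := projective_tensor_left P N
    have hfe := LinearMap.exact_subtype_ker_map f
    exact IsSyzygy.of_exact
      (X' := KBimodule.left
        (KBimodule.tensor (ModuleCat.of (A ⊗[k] Bᵐᵒᵖ) (LinearMap.ker f)) N))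
      (i := leftMap (whiskerR (V := ModuleCat.of (A ⊗[k] Bᵐᵒᵖ) (LinearMap.ker f))
        (LinearMap.ker f).subtype N)) (g := leftMap (whiskerR f N))
      (h.tensorMap_injective_left (V' := ModuleCat.of (A ⊗[k] Bᵐᵒᵖ) (LinearMap.ker f))
        Subtype.val_injective hfe hf)
      (tensorMap_exact_left (M := ModuleCat.of (A ⊗[k] Bᵐᵒᵖ) (LinearMap.ker f)) hfe hf N)
      (tensorMap_surjective hf Function.surjective_id)
      (ih (h.syzygy (V' := ModuleCat.of (A ⊗[k] Bᵐᵒᵖ) (LinearMap.ker f))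
        Subtype.val_injective hfe hf) hK)

end Syzygy

end KBimodule

theorem BalancedTensor.TorVanishing.of_equiv {R : Type u} [Ring R] {V : ModuleCat.{u} Rᵐᵒᵖ}
    {n : ℕ} {N N' : ModuleCat.{u} R} (h : TorVanishing V n N) (e : N ≃ₗ[R] N') :
    TorVanishing V n N' := by
  cases n with
  | zero => trivial
  | succ n =>
    obtain ⟨K, F, j, q, hF, hj, hjq, hq, h⟩ := h
    exact ⟨K, F, j, e.toLinearMap.comp q, hF, hj,
      fun x => (e.map_eq_zero_iff (x := q x)).trans (hjq x), e.surjective.comp hq, h⟩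

namespace KBimodule

variable {k : Type v} [Field k]
variable {A B C D : Type u} [Ring A] [Algebra k A] [Ring B] [Algebra k B] [Ring C] [Algebra k C]
  [Ring D] [Algebra k D]

/-- Converse to `TorVanishes.of_torVanishing`: a bimodule presentation of `N` is also a projective
presentation over `B`. Independence is thus a one-sided condition, which allows the right action on
`N` to be changed. -/
theorem TorIndependent.torVanishing {V : KBimodule k A B} {N : KBimodule k B C}
    (h : TorIndependent V N) (n : ℕ) : BalancedTensor.TorVanishing V.right n N.left := by
  induction n generalizing N with
  | zero => trivial
  | succ n ih =>
    obtain ⟨N', F, j, q, hF, hj, hjq, hq⟩ := ModuleCat.exists_projective_cover N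
    have := projective_left F
    exact ⟨KBimodule.left N', KBimodule.left F, leftMap j, leftMap q, this, hj, hjq, hq,
      injective_map_of_whiskerL V j (h.tensorMap_injective hj hjq hq),
      ih (.kernel hj hjq hq (.of_projective_left V F) h)⟩

/-- The `Tor`-independence of `V` and `N` depends only on the left module underlying `N`. -/
theorem TorIndependent.of_equiv_left_right {V : KBimodule k A B} {N : KBimodule k B C}
    {N' : KBimodule k B D} (h : TorIndependent V N) (e : N.left ≃ₗ[B] N'.left) :
    TorIndependent V N' :=
  fun n => .of_torVanishing ((h.torVanishing n).of_equiv e)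

/-! ### The algebra `A` as a bimodule over `A` and `B` in its various forms. -/

section Restriction

variable (φ : B →ₐ[k] A)

theorem resR_left_smul (V : KBimodule k C A) (c : C) (x : V) :
    (c ⊗ₜ[k] (1 : Bᵐᵒᵖ)) • (show (resR φ).obj V from x) =
      (show (resR φ).obj V from (c ⊗ₜ[k] (1 : Aᵐᵒᵖ)) • x) := by
  refine (resR_smul φ V c 1 x).trans ?_
  rw [unop_one, map_one, op_one]

theorem resL_right_smul (V : KBimodule k A C) (c : Cᵐᵒᵖ) (x : V) :
    ((1 : B) ⊗ₜ[k] c) • (show (resL φ).obj V from x) =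
      (show (resL φ).obj V from ((1 : A) ⊗ₜ[k] c) • x) := by
  refine (resL_smul φ V 1 c x).trans ?_
  rw [map_one]

/-- The identity of `V ⊗ N`, with the right action restricted. -/
def tensorResRHom (V : KBimodule k C D) (N : KBimodule k D A) :
    tensor V ((resR φ).obj N) →ₗ[C ⊗[k] Bᵐᵒᵖ] (resR φ).obj (tensor V N) :=
  tensorLift (M := V) (N := (resR φ).obj N) (Z := (resR φ).obj (tensor V N)) (tmHom V N)
    (fun v d n => (smul_tm (M := V) (N := N) v d n).trans
      (congrArg (tm (M := V) (N := N) v) (resR_left_smul φ N d n).symm))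
    (fun c v n => (left_smul_tm (M := V) (N := N) c v n).symm.trans
      (resR_left_smul φ (tensor V N) c (tm v n)).symm)
    (fun b v n => (right_smul_tm (M := V) (N := N) (op (φ b.unop)) v n).symm)

/-- Restriction of the right action commutes with tensor products. -/
def tensorResR (V : KBimodule k C D) (N : KBimodule k D A) :
    (resR φ).obj (tensor V N) ≃ₗ[C ⊗[k] Bᵐᵒᵖ] tensor V ((resR φ).obj N) :=
  LinearEquiv.symm <| LinearEquiv.ofBijective (tensorResRHom φ V N) (by
    let inv : tensor V N →+ tensor V ((resR φ).obj N) :=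
      liftAdd (M := V) (N := N) (tmHom V ((resR φ).obj N)) fun v d n =>
        (smul_tm (M := V) (N := (resR φ).obj N) v d n).trans
          (congrArg (tm (M := V) (N := (resR φ).obj N) v) (resR_left_smul φ N d n))
    have h₁ : AddMonoidHom.comp inv (tensorResRHom φ V N).toAddMonoidHom = AddMonoidHom.id _ :=
      tensor_addHom_ext (M := V) (N := (resR φ).obj N) fun _ _ => rfl
    have h₂ : AddMonoidHom.comp (tensorResRHom φ V N).toAddMonoidHom inv = AddMonoidHom.id _ :=
      tensor_addHom_ext (M := V) (N := N) fun _ _ => rfl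
    exact Function.bijective_iff_has_inverse.2
      ⟨inv, DFunLike.congr_fun h₁, DFunLike.congr_fun h₂⟩)

theorem tensorResR_symm_tm (V : KBimodule k C D) (N : KBimodule k D A) (v : V) (n : N) :
    (tensorResR φ V N).symm (tm (M := V) (N := (resR φ).obj N) v n) =
      (show tensor V N from tm v n) := rfl

theorem tensorResR_tm (V : KBimodule k C D) (N : KBimodule k D A) (v : V) (n : N) :
    tensorResR φ V N (show tensor V N from tm v n) =
      tm (M := V) (N := (resR φ).obj N) v n :=
  (LinearEquiv.symm_apply_eq _).1 (tensorResR_symm_tm φ V N v n)|>.symm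

end Restriction

section Regular

/-- `A` is free as a left module over itself. -/
def regularLeftEquiv : A ≃ₗ[A] (regular k A).left where
  toFun a := a
  invFun a := a
  map_add' _ _ := rfl
  map_smul' a x := (regular_left_smul (k := k) a x).symm
  left_inv _ := rfl
  right_inv _ := rfl

/-- `A` is free as a right module over itself. -/
def regularRightEquiv : Aᵐᵒᵖ ≃ₗ[Aᵐᵒᵖ] (regular k A).right where
  toFun a := a.unop
  invFun a := op a
  map_add' _ _ := rfl
  map_smul' a x := (regular_right_smul (k := k) a x.unop).symm
  left_inv _ := rfl
  right_inv _ := rfl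

variable (φ : B →ₐ[k] A)

/-- The left module underlying `regularR φ` is free. -/
def regularRLeftEquiv : A ≃ₗ[A] (regularR φ).left where
  toFun a := a
  invFun a := a
  map_add' _ _ := rfl
  map_smul' a x := ((resR_left_smul φ (regular k A) a x).trans
    (regular_left_smul (k := k) a x)).symm
  left_inv _ := rfl
  right_inv _ := rfl

/-- The right module underlying `regularL φ` is free. -/
def regularLRightEquiv : Aᵐᵒᵖ ≃ₗ[Aᵐᵒᵖ] (regularL φ).right where
  toFun a := a.unop
  invFun a := op a
  map_add' _ _ := rfl
  map_smul' a x := ((resL_right_smul φ (regular k A) a x.unop).trans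
    (regular_right_smul (k := k) a x.unop)).symm
  left_inv _ := rfl
  right_inv _ := rfl

instance : Module.Projective A (regular k A).left := .of_equiv regularLeftEquiv

instance : Module.Finite A (regular k A).left := .equiv regularLeftEquiv

instance : Module.Projective Aᵐᵒᵖ (regular k A).right := .of_equiv regularRightEquiv

instance : Module.Finite Aᵐᵒᵖ (regular k A).right := .equiv regularRightEquiv

instance : Module.Projective A (regularR φ).left := .of_equiv (regularRLeftEquiv φ)

instance : Module.Finite A (regularR φ).left := .equiv (regularRLeftEquiv φ)

instance : Module.Projective Aᵐᵒᵖ (regularL φ).right := .of_equiv (regularLRightEquiv φ)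

instance : Module.Finite Aᵐᵒᵖ (regularL φ).right := .equiv (regularLRightEquiv φ)

instance : Module.Finite (A ⊗[k] Aᵐᵒᵖ) (regular k A) :=
  have := finite_tensor (regular k A) (regular k A)
  .equiv (tensorRegular (regular k A))

end Regular

section Ambient

variable (φ : B →ₐ[k] A)

/-- `A` as a bimodule over `B`. -/
abbrev ambient : KBimodule k B B := (resR φ).obj (regularL φ)

theorem ambient_left_smul (b : B) (x : A) :
    (b ⊗ₜ[k] (1 : Bᵐᵒᵖ)) • (show ambient φ from x) = (show ambient φ from φ b * x) :=
  (resR_left_smul φ (regularL φ) b x).trans (regular_left_smul (k := k) (φ b) x)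

theorem ambient_right_smul (b : Bᵐᵒᵖ) (x : A) :
    ((1 : B) ⊗ₜ[k] b) • (show ambient φ from x) = (show ambient φ from x * φ b.unop) :=
  (resL_right_smul φ (regular k A) (op (φ b.unop)) x).trans
    (regular_right_smul (k := k) (op (φ b.unop)) x)

/-- The map `B → A`, as a map of bimodules over `B`. -/
def unitMap : regular k B →ₗ[B ⊗[k] Bᵐᵒᵖ] ambient φ :=
  ofAddHom (M := regular k B) (M' := ambient φ) (φ : B →+ A)
    (fun b (x : B) => (congrArg φ (regular_left_smul (k := k) b x)).trans
      ((map_mul φ b x).trans (ambient_left_smul φ b (φ x)).symm))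
    (fun b (x : B) => (congrArg φ (regular_right_smul (k := k) b x)).trans
      ((map_mul φ x b.unop).trans (ambient_right_smul φ b (φ x)).symm))

/-- The left modules underlying `ambient φ` and `regularL φ` agree. -/
def ambientLeftEquiv : (ambient φ).left ≃ₗ[B] (regularL φ).left where
  toFun x := x
  invFun x := x
  map_add' _ _ := rfl
  map_smul' b x := resR_left_smul φ (regularL φ) b x
  left_inv _ := rfl
  right_inv _ := rfl

/-- The right modules underlying `ambient φ` and `regularR φ` agree. -/
def ambientRightEquiv : (ambient φ).right ≃ₗ[Bᵐᵒᵖ] (regularR φ).right where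
  toFun x := x
  invFun x := x
  map_add' _ _ := rfl
  map_smul' b x := resL_right_smul φ (regular k A) (op (φ b.unop)) x
  left_inv _ := rfl
  right_inv _ := rfl

end Ambient

/-! ### Relative syzygies: kernels of multiplication. -/

section Section

variable (φ : B →ₐ[k] A)

theorem mulHom_tm_one (V : KBimodule k C A) (v : V) :
    mulHom φ V (tm (M := (resR φ).obj V) (N := regularL φ) v (1 : A)) = v :=
  (mulHom_tm φ V v 1).trans (one_tmul_one_smul v)

theorem mulHom_surjective (V : KBimodule k C A) : Function.Surjective (mulHom φ V) :=
  fun v => ⟨_, mulHom_tm_one φ V v⟩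

/-- The kernel of the multiplication `V ⊗_B A → V`. -/
abbrev mulKer (V : KBimodule k C A) : KBimodule k C A :=
  ModuleCat.of (C ⊗[k] Aᵐᵒᵖ) (LinearMap.ker (mulHom φ V))

/-- Moving `b` across the tensor sign normalizes every tensor to the form `w ⊗ 1`. -/
theorem exists_tm_one (W : KBimodule k C B) (y : tensor W (regular k B)) :
    ∃ w : W, tm (N := regular k B) w (1 : B) = y := by
  induction y using tensor_induction with
  | zero => exact ⟨0, zero_tm (M := W) (N := regular k B) _⟩
  | tmul w b =>
    refine ⟨((1 : C) ⊗ₜ[k] op (show B from b)) • w, ?_⟩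
    refine (smul_tm (M := W) (N := regular k B) w (show B from b) (1 : B)).trans ?_
    refine congrArg (tm (M := W) (N := regular k B) w) ?_
    exact (regular_left_smul (k := k) (show B from b) (1 : B)).trans (mul_one (M := B) b)
  | add x y hx hy =>
    obtain ⟨w, rfl⟩ := hx
    obtain ⟨w', rfl⟩ := hy
    exact ⟨w + w', add_tm (M := W) (N := regular k B) w w' _⟩

variable {X : KBimodule k B B} {q : ambient φ →ₗ[B ⊗[k] Bᵐᵒᵖ] X}

/-- The map from the kernel of `V ⊗_B A → V` to `V ⊗_B A/B`. -/
def mulKerHom (q : ambient φ →ₗ[B ⊗[k] Bᵐᵒᵖ] X) (V : KBimodule k C A) :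
    (resR φ).obj (mulKer φ V) →ₗ[C ⊗[k] Bᵐᵒᵖ] tensor ((resR φ).obj V) X :=
  (whiskerL ((resR φ).obj V) q).comp
    ((tensorResR φ ((resR φ).obj V) (regularL φ)).toLinearMap.comp
      (resRMap φ (V := mulKer φ V) (LinearMap.ker (mulHom φ V)).subtype))

/-- The map `v ↦ v ⊗ 1` splits the multiplication over `B` (not over `A`), and its image is that of
`V ⊗_B B`. Both the kernel of multiplication and `V ⊗_B X` are therefore complements to `V` in `V
⊗_B A`. For injectivity, a kernel element that dies in `V ⊗_B X` has the form `w ⊗ 1`, and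
multiplying gives `w = 0`. -/
theorem mulKerHom_bijective (hex : Function.Exact (unitMap φ) q) (hq : Function.Surjective q)
    (V : KBimodule k C A) : Function.Bijective (mulKerHom φ q V) := by
  let W := (resR φ).obj V
  constructor
  · refine (injective_iff_map_eq_zero _).2 fun x hx => ?_
    obtain ⟨y, hy⟩ := (tensorMap_exact_right hex hq W _).1 hx
    obtain ⟨w, rfl⟩ := exists_tm_one W y
    have h₁ : tm (M := W) (N := regularL φ) w (1 : A) = x.1 := by
      refine (tensorResR φ W (regularL φ)).injective (Eq.trans ?_ hy)
      refine (tensorResR_tm φ W (regularL φ) w (1 : A)).trans ?_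
      refine congrArg (tm (M := W) (N := ambient φ) w) ?_
      exact (map_one φ).symm
    have h₂ : w = 0 := (mulHom_tm_one φ V w).symm.trans ((congrArg (mulHom φ V) h₁).trans x.2)
    refine Subtype.ext (h₁.symm.trans ?_)
    rw [h₂]
    exact zero_tm (M := W) (N := regularL φ) _
  · intro y
    obtain ⟨z, rfl⟩ := tensorMap_surjective (f := (LinearMap.id : W →ₗ[C ⊗[k] Bᵐᵒᵖ] W))
      Function.surjective_id hq y
    obtain ⟨z, rfl⟩ : ∃ z' : tensor W (regularL φ), tensorResR φ W (regularL φ) z' = z :=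
      (tensorResR φ W (regularL φ)).surjective z
    let w : W := mulHom φ V z
    -- Subtracting `w ⊗ 1`, with `w` the product of `z`, moves the lift into the kernel. Its image
    -- in `V ⊗_B X` is unchanged because `q` kills `1`.
    let x : tensor W (regularL φ) := z - tm (M := W) (N := regularL φ) w (1 : A)
    have hx : mulHom φ V x = 0 :=
      (map_sub (mulHom φ V) _ _).trans (sub_eq_zero.2 (mulHom_tm_one φ V w).symm)
    refine ⟨⟨x, hx⟩, ?_⟩
    have hone : q (show ambient φ from (1 : A)) = 0 :=
      (hex _).2 ⟨(1 : B), map_one φ⟩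
    have h₀ : whiskerL W q (tensorResR φ W (regularL φ)
        (show tensor W (regularL φ) from tm (M := W) (N := regularL φ) w (1 : A))) = 0 := by
      refine (congrArg (whiskerL W q) (tensorResR_tm φ W (regularL φ) w (1 : A))).trans ?_
      refine (tensorMap_tm _ _ w _).trans ?_
      refine (congrArg (tm (M := W) (N := X) _) hone).trans ?_
      exact tm_zero (M := W) (N := X) w
    have h₁ : tensorResR φ W (regularL φ) x = tensorResR φ W (regularL φ) z -
        tensorResR φ W (regularL φ) (show tensor W (regularL φ) from
          tm (M := W) (N := regularL φ) w (1 : A)) :=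
      map_sub (tensorResR φ W (regularL φ)) z _
    refine (congrArg (whiskerL W q) h₁).trans ((map_sub (whiskerL W q) _ _).trans ?_)
    exact (congrArg₂ _ rfl h₀).trans (sub_zero _)

/-- The kernel of `V ⊗_B A → V` is isomorphic to `V ⊗_B A/B` as a right module over `B`. -/
def mulKerEquiv (hex : Function.Exact (unitMap φ) q) (hq : Function.Surjective q)
    (V : KBimodule k C A) :
    (resR φ).obj (mulKer φ V) ≃ₗ[C ⊗[k] Bᵐᵒᵖ] tensor ((resR φ).obj V) X :=
  LinearEquiv.ofBijective (mulKerHom φ q V) (mulKerHom_bijective φ hex hq V)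

/-- The iterated kernels of the multiplications `V ⊗_B A → V`, starting from `V = A`. -/
def relSyzygy : ℕ → KBimodule k A A
  | 0 => regular k A
  | j + 1 => mulKer φ (relSyzygy j)

end Section

theorem subsingleton_tensor_right (V : KBimodule k A B) (N : KBimodule k B C)
    [h : Subsingleton N] : Subsingleton (tensor V N) :=
  subsingleton_of_forall_eq 0 fun x => by
    induction x using tensor_induction with
    | zero => rfl
    | tmul w n => rw [Subsingleton.elim n 0, tm_zero]
    | add x y hx hy => rw [hx, hy, add_zero]

theorem subsingleton_tensorPow {X : KBimodule k B B} {p m : ℕ} (h : Subsingleton (tensorPow X p))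
    (hpm : p ≤ m) : Subsingleton (tensorPow X m) := by
  induction m, hpm using Nat.le_induction with
  | base => exact h
  | succ m _ ih => exact subsingleton_tensor_right X (tensorPow X m)

/-! ### `Tor`-independence and projective dimension of the relative syzygies. -/

section Extension

variable {φ : B →ₐ[k] A} {X : KBimodule k B B} {q : ambient φ →ₗ[B ⊗[k] Bᵐᵒᵖ] X}

section

variable (hφ : Function.Injective φ) (hex : Function.Exact (unitMap φ) q)
  (hq : Function.Surjective q)

include hφ hex hq

/-- As a left `B`-module, `A` is an extension of `X` by the free module `B`. -/
theorem torIndependent_regularL {V : KBimodule k C B} (h : TorIndependent V X) :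
    TorIndependent V (regularL φ) :=
  (TorIndependent.extension (L := ambient φ) hφ hex hq (.of_projective_left V (regular k B))
    h).of_equiv_left_right (ambientLeftEquiv φ)

/-- As a right `B`-module, `A` is an extension of `X` by the free module `B`. -/
theorem torIndependent_regularR {N : KBimodule k B C}
    (h : ∀ n, BalancedTensor.TorVanishing X.right n N.left) :
    TorIndependent (regularR φ) N := fun n => by
  let e := ambientRightEquiv φ
  refine .of_torVanishing (BalancedTensor.TorVanishing.extension (V' := (regular k B).right)
    (P := (regularR φ).right) (V := X.right) (i := e.toLinearMap.comp (rightMap (unitMap φ)))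
    (g := (rightMap q).comp e.symm.toLinearMap) hφ (fun x => hex x) hq (h n))

end

section RelSyzygy

variable (hex : Function.Exact (unitMap φ) q) (hq : Function.Surjective q)

include hex hq

/-- Since `K_{j+1} ≅ K_j ⊗_B X`, independence from `X^{⊗m}` follows from that of the pairs `(K_j,
X)`, `(X, X^{⊗m})` and `(K_j, X^{⊗(m+1)})`. The exponent grows, so the induction on `j` runs over
all `m ≥ 1` at once. The first tensor power is `X ⊗_B B`, whence `tensorRegular`. -/
theorem torIndependent_relSyzygy (hφ : Function.Injective φ)
    (htor : ∀ n m, 1 ≤ m → BalancedTensor.TorVanishing X.right n (tensorPow X m).left)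
    (j : ℕ) {m : ℕ} (hm : 1 ≤ m) :
    TorIndependent ((resR φ).obj (relSyzygy φ j)) (tensorPow X m) := by
  induction j generalizing m with
  | zero => exact torIndependent_regularR hφ hex hq fun n => htor n m hm
  | succ j ih =>
    refine TorIndependent.of_equiv_left (mulKerEquiv φ hex hq (relSyzygy φ j)).symm ?_
    exact TorIndependent.tensor ((ih le_rfl).of_equiv_right (tensorRegular X))
      (fun n => .of_torVanishing (htor n m hm)) (ih (m := m + 1) (by omega))

/-- The isomorphism `K_{j+1} ⊗ X^{⊗m} ≅ K_j ⊗ X^{⊗(m+1)}` trades the index for tensor factors until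
`A ⊗ X^{⊗(j+m)}` is reached. -/
theorem subsingleton_relSyzygy_tensor {p : ℕ} (h : Subsingleton (tensorPow X p)) (j m : ℕ)
    (hp : p ≤ j + m) : Subsingleton (tensor ((resR φ).obj (relSyzygy φ j)) (tensorPow X m)) := by
  induction j generalizing m with
  | zero =>
    have := subsingleton_tensorPow h (show p ≤ m by omega)
    exact subsingleton_tensor_right _ _
  | succ j ih =>
    have : Subsingleton (tensor ((resR φ).obj (relSyzygy φ j)) (X.tensor (tensorPow X m))) :=
      ih (m + 1) (by omega)
    let e := (tensorEquiv (mulKerEquiv φ hex hq (relSyzygy φ j)) (.refl _ (tensorPow X m))).trans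
      (assoc ((resR φ).obj (relSyzygy φ j)) X (tensorPow X m))
    exact e.toEquiv.subsingleton

theorem subsingleton_relSyzygy {p j : ℕ} (h : Subsingleton (tensorPow X p)) (hp : p ≤ j) :
    Subsingleton (relSyzygy φ j) := by
  have : Subsingleton (tensor ((resR φ).obj (relSyzygy φ j)) (regular k B)) :=
    subsingleton_relSyzygy_tensor hex hq h j 0 (by omega)
  exact (tensorRegular ((resR φ).obj (relSyzygy φ j))).symm.toEquiv.subsingleton

/-- The first term is `A ⊗_B X` with `A` left projective, of dimension at most `n`. Each further
factor `X` adds at most `n`. The index starts at `1`, since no bound is available for `A` itself. -/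
theorem exists_hasProjectiveDimensionLT_resR_relSyzygy (hφ : Function.Injective φ)
    (htor : ∀ n m, 1 ≤ m → BalancedTensor.TorVanishing X.right n (tensorPow X m).left)
    {n : ℕ} (hX : HasProjectiveDimensionLT X (n + 1)) (j : ℕ) :
    ∃ r, HasProjectiveDimensionLT ((resR φ).obj (relSyzygy φ (j + 1))) (r + 1) := by
  have hT := fun j => (torIndependent_relSyzygy hex hq hφ htor j le_rfl).of_equiv_right
    (tensorRegular X)
  induction j with
  | zero =>
    exact ⟨n, ((hT 0).hasProjectiveDimensionLT_of_projective_left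
      (V := regularR φ) hX).of_equiv (mulKerEquiv φ hex hq (relSyzygy φ 0)).symm⟩
  | succ j ih =>
    obtain ⟨r, hr⟩ := ih
    exact ⟨r + n, ((hT (j + 1)).exists_hasProjectiveDimensionLT hr hX).of_equiv
      (mulKerEquiv φ hex hq (relSyzygy φ (j + 1))).symm⟩

/-- The kernel of `A ⊗_B A → A` has finite projective dimension. -/
theorem exists_hasProjectiveDimensionLT_relSyzygy (hφ : Function.Injective φ)
    (htor : ∀ n m, 1 ≤ m → BalancedTensor.TorVanishing X.right n (tensorPow X m).left)
    {n p : ℕ} (hX : HasProjectiveDimensionLT X (n + 1)) (h : Subsingleton (tensorPow X p)) :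
    ∃ r, HasProjectiveDimensionLT (relSyzygy φ 1) (r + 1) := by
  -- Downward induction on `j`, with `d = p - j`: it starts at `K_{p+1} = 0` and descends along `0 →
  -- K_{j+2} → K_{j+1} ⊗_B A → K_{j+1} → 0`.
  suffices ∀ d j, j + d = p → ∃ r, HasProjectiveDimensionLT (relSyzygy φ (j + 1)) (r + 1) from
    this p 0 (by omega)
  intro d
  induction d with
  | zero =>
    intro j hj
    have := subsingleton_relSyzygy hex hq h (show p ≤ j + 1 by omega)
    have : Module.Projective (A ⊗[k] Aᵐᵒᵖ) (relSyzygy φ (j + 1)) := inferInstance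
    exact ⟨0, hasProjectiveDimensionLT_one_iff.2 this⟩
  | succ d ih =>
    intro j hj
    obtain ⟨r, hr⟩ := ih (j + 1) (by omega)
    obtain ⟨s, hs⟩ := exists_hasProjectiveDimensionLT_resR_relSyzygy hex hq hφ htor hX j
    -- Independence of `K_{j+1}` and `A` lets a resolution over `A ⊗ B^op` be induced to `A^e`,
    -- which bounds the middle term.
    have hT := torIndependent_regularL hφ hex hq
      ((torIndependent_relSyzygy hex hq hφ htor (j + 1) le_rfl).of_equiv_right (tensorRegular X))
    have hs' := hT.hasProjectiveDimensionLT_of_projective_right hs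
    exact ⟨r + s + 1, hasProjectiveDimensionLT_right
      (f := (LinearMap.ker (mulHom φ (relSyzygy φ (j + 1)))).subtype)
      (X := relSyzygy φ (j + 1 + 1)) Subtype.val_injective
      (LinearMap.exact_subtype_ker_map _) (mulHom_surjective φ (relSyzygy φ (j + 1)))
      (hr.mono (by omega)) (hs'.mono (by omega))⟩

end RelSyzygy

end Extension

end KBimodule

theorem IsProjectiveExtension.of_equiv_right {R : Type u} [Ring R] {L L' L'' : ModuleCat.{u} R}
    (h : IsProjectiveExtension L L') (e : L' ≃ₗ[R] L'') : IsProjectiveExtension L L'' := by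
  obtain ⟨P, i, q, hP, hi, hiq, hq⟩ := h
  refine ⟨P, e.toLinearMap.comp i, q.comp e.symm.toLinearMap, hP, e.injective.comp hi,
    fun x => (hiq (e.symm x)).trans ?_, hq.comp e.symm.surjective⟩
  exact exists_congr fun y => e.eq_symm_apply

namespace KBimodule

variable {k : Type v} [Field k]
variable {A B C D : Type u} [Ring A] [Algebra k A] [Ring B] [Algebra k B] [Ring C] [Algebra k C]
  [Ring D] [Algebra k D]

/-! ### The singular equivalence. -/

section Equivalence

variable {φ : B →ₐ[k] A}

/-- The bimodule resolution of `B` splits on one side, because `B` is projective over itself. -/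
theorem projective_left_of_isSyzygy_regular [FiniteDimensional k B] {l : ℕ} {U : KBimodule k B B}
    (h : IsSyzygy l (regular k B) U) : Module.Projective B U.left :=
  (isSyzygy_left h).projective ((hasProjectiveDimensionLT_one_iff.2
    (inferInstanceAs (Module.Projective B (regular k B).left))).mono (by omega))

theorem projective_right_of_isSyzygy_regular [FiniteDimensional k B] {l : ℕ} {U : KBimodule k B B}
    (h : IsSyzygy l (regular k B) U) : Module.Projective Bᵐᵒᵖ U.right :=
  (isSyzygy_right h).projective ((hasProjectiveDimensionLT_one_iff.2
    (inferInstanceAs (Module.Projective Bᵐᵒᵖ (regular k B).right))).mono (by omega))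

theorem isSyzygy_regularR_tensor [FiniteDimensional k B] {l : ℕ} {U : KBimodule k B B}
    (h : IsSyzygy l (regular k B) U) :
    IsSyzygy l (regularR φ) ((regularR φ).tensor U) :=
  ((TorIndependent.of_projective_left (regularR φ) (regular k B)).isSyzygy_of_projective_left
    h).of_equiv_left (tensorRegular (regularR φ))

theorem isSyzygy_tensor_regularL [FiniteDimensional k B] {l : ℕ} {U : KBimodule k B B}
    (h : IsSyzygy l (regular k B) U) :
    IsSyzygy l (regularL φ) (U.tensor (regularL φ)) :=
  ((TorIndependent.of_projective_right (regular k B) (regularL φ)).isSyzygy_of_projective_right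
    h).of_equiv_left (regularTensor (regularL φ))

instance finite_regularR : Module.Finite (A ⊗[k] Bᵐᵒᵖ) (regularR φ) :=
  have := finite_tensor (regularR φ) (regular k B)
  .equiv (tensorRegular (regularR φ))

instance finite_regularL : Module.Finite (B ⊗[k] Aᵐᵒᵖ) (regularL φ) :=
  have := finite_tensor (regular k B) (regularL φ)
  .equiv (regularTensor (regularL φ))

instance finite_ambient [FiniteDimensional k A] : Module.Finite (B ⊗[k] Bᵐᵒᵖ) (ambient φ) :=
  have := finite_left (regularL φ)
  have : Module.Finite B (ambient φ).left := .equiv (ambientLeftEquiv φ).symm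
  have := finite_tensor (ambient φ) (regular k B)
  .equiv (tensorRegular (ambient φ))

/-- The product `(U ⊗_B A) ⊗_A (A ⊗_B U')` is `U ⊗_B A ⊗_B U'`. -/
def tensorRegularTensor (φ : B →ₐ[k] A) (U U' : KBimodule k B B) :
    tensor (U.tensor (regularL φ)) ((regularR φ).tensor U') ≃ₗ[B ⊗[k] Bᵐᵒᵖ]
      tensor (U.tensor (ambient φ)) U' :=
  (assoc (U.tensor (regularL φ)) (regularR φ) U').symm.trans
    (tensorEquiv ((tensorRegularR φ (U.tensor (regularL φ))).trans (tensorResR φ U (regularL φ)))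
      (.refl _ U'))

variable {X : KBimodule k B B} {q : ambient φ →ₗ[B ⊗[k] Bᵐᵒᵖ] X}
 [FiniteDimensional k A] [FiniteDimensional k B]
  (hφ : Function.Injective φ) (hex : Function.Exact (unitMap φ) q) (hq : Function.Surjective q)

include hφ hex hq

/-- Tensoring `0 → B → A → X → 0` with `U` on both sides gives an extension of `U ⊗_B X ⊗_B U` by `U
⊗_B B ⊗_B U`. The former is projective, and the latter is an iterated syzygy of `B`. -/
theorem stablyIsomorphic_tensor_regularL_tensor {n : ℕ} (hX : HasProjectiveDimensionLT X (n + 1))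
    {U : KBimodule k B B} (hU : IsSyzygy (n + 1) (regular k B) U) :
    IsStablySyzygy (n + 1 + (n + 1)) (regular k B)
      (tensor (U.tensor (regularL φ)) ((regularR φ).tensor U)) := by
  have hUl := projective_left_of_isSyzygy_regular hU
  have hUr := projective_right_of_isSyzygy_regular hU
  have hUf : Module.Finite (B ⊗[k] Bᵐᵒᵖ) U := hU.finite
  have := finite_left U
  have := finite_right U
  have hXf : Module.Finite (B ⊗[k] Bᵐᵒᵖ) X := .of_surjective q hq
  have := finite_right X
  -- On the left, `U ⊗ X` is an `(n+1)`-st syzygy of `B ⊗ X ≅ X`, which has dimension at most `n`.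
  have hUX : Module.Projective B (U.tensor X).left :=
    ((TorIndependent.of_projective_right (regular k B) X).isSyzygy_tensor_left hU).projective
      ((hasProjectiveDimensionLT_of_left (hX.of_equiv (regularTensor X).symm)).mono (by omega))
  have := finite_tensor U X
  have := finite_left (U.tensor X)
  -- Now `(U ⊗ X) ⊗ U` is an `(n+1)`-st syzygy of the bimodule `U ⊗ X`, whose dimension is at most
  -- `n` because `U` is projective on both sides.
  have hP : Module.Projective (B ⊗[k] Bᵐᵒᵖ) (tensor (U.tensor X) U) :=
    ((TorIndependent.of_projective_left (U.tensor X) (regular k B)).isSyzygy_of_projective_left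
      hU).projective ((((TorIndependent.of_projective_right U
        X).hasProjectiveDimensionLT_of_projective_left hX).of_equiv
          (tensorRegular (U.tensor X)).symm).mono (by omega))
  have hL : IsSyzygy (n + 1 + (n + 1)) (regular k B) (tensor (U.tensor (regular k B)) U) :=
    hU.trans ((((TorIndependent.of_projective_left U (regular k B)).isSyzygy_of_projective_left
      hU).of_equiv_left (tensorRegular U)).of_equiv_right
        (tensorEquiv (tensorRegular U).symm (.refl _ U)))
  have hLf : Module.Finite (B ⊗[k] Bᵐᵒᵖ) (tensor (U.tensor (regular k B)) U) := hL.finite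
  have hexU := tensorMap_exact_right hex hq U
  have hqU : Function.Surjective (whiskerL U q) := tensorMap_surjective Function.surjective_id hq
  have hext : IsProjectiveExtension (tensor (U.tensor (regular k B)) U)
      (tensor (U.tensor (ambient φ)) U) :=
    ⟨tensor (U.tensor X) U, whiskerR (whiskerL U (unitMap φ)) U, whiskerR (whiskerL U q) U, hP,
      tensorMap_injective_of_projective_left U (tensorMap_injective_of_projective_right U hφ),
      tensorMap_exact_left hexU hqU U, tensorMap_surjective hqU Function.surjective_id⟩
  have hext' := hext.of_equiv_right (tensorRegularTensor φ U U).symm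
  have hf : Module.Finite (B ⊗[k] Bᵐᵒᵖ) (tensor (U.tensor (ambient φ)) U) :=
    have := finite_right (ambient φ)
    have := finite_tensor U (ambient φ)
    have := finite_left (U.tensor (ambient φ))
    finite_tensor _ U
  have hf' : Module.Finite (B ⊗[k] Bᵐᵒᵖ)
      (tensor (U.tensor (regularL φ)) ((regularR φ).tensor U)) :=
    .equiv (tensorRegularTensor φ U U).symm
  exact ⟨_, hL, hext'.stablyIsomorphic.symm⟩

/-- As a right `B`-module, `A` has dimension at most `n`, being an extension of `X` by `B`; and `A
⊗_B U` is an `(n+1)`-st syzygy of it. -/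
theorem projective_right_regularR_tensor {n : ℕ} (hX : HasProjectiveDimensionLT X (n + 1))
    {U : KBimodule k B B} (hU : IsSyzygy (n + 1) (regular k B) U) :
    Module.Projective Bᵐᵒᵖ ((regularR φ).tensor U).right := by
  have h : HasProjectiveDimensionLT (ambient φ).right (n + 1) :=
    hasProjectiveDimensionLT_middle (X := (regular k B).right) (Z := X.right)
      (f := rightMap (unitMap φ)) (g := rightMap q) hφ hex hq
      ((hasProjectiveDimensionLT_one_iff.2
        (inferInstanceAs (Module.Projective Bᵐᵒᵖ (regular k B).right))).mono (by omega))
      (hasProjectiveDimensionLT_of_right hX)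
  exact (isSyzygy_right (isSyzygy_regularR_tensor hU)).projective
    ((h.of_equiv (ambientRightEquiv φ)).mono (by omega))

theorem projective_left_tensor_regularL {n : ℕ} (hX : HasProjectiveDimensionLT X (n + 1))
    {U : KBimodule k B B} (hU : IsSyzygy (n + 1) (regular k B) U) :
    Module.Projective B (U.tensor (regularL φ)).left := by
  have h : HasProjectiveDimensionLT (ambient φ).left (n + 1) :=
    hasProjectiveDimensionLT_middle (X := (regular k B).left) (Z := X.left)
      (f := leftMap (unitMap φ)) (g := leftMap q) hφ hex hq
      ((hasProjectiveDimensionLT_one_iff.2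
        (inferInstanceAs (Module.Projective B (regular k B).left))).mono (by omega))
      (hasProjectiveDimensionLT_of_left hX)
  exact (isSyzygy_left (isSyzygy_tensor_regularL hU)).projective
    ((h.of_equiv (ambientLeftEquiv φ)).mono (by omega))

/-- With `M = A ⊗_B U`, the bimodule `M ⊗_B A` is a syzygy of `A ⊗_B A`, and `M ⊗_B U ⊗_B A` is a
syzygy of `M ⊗_B A`. Passing from `A ⊗_B A` to `A` costs only a projective extension, since the
kernel of multiplication has finite dimension. -/
theorem stablyIsomorphic_regularR_tensor_tensor {n : ℕ}
    (hX : HasProjectiveDimensionLT X (n + 1))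
    (htor : ∀ n m, 1 ≤ m → BalancedTensor.TorVanishing X.right n (tensorPow X m).left)
    (hmul : HasProjectiveDimensionLT (relSyzygy φ 1) (n + 1))
    {U : KBimodule k B B} (hU : IsSyzygy (n + 1) (regular k B) U) :
    IsStablySyzygy (n + 1 + (n + 1)) (regular k A)
      (tensor ((regularR φ).tensor U) (U.tensor (regularL φ))) := by
  have hM := isSyzygy_regularR_tensor (φ := φ) hU
  have hMf : Module.Finite (A ⊗[k] Bᵐᵒᵖ) ((regularR φ).tensor U) := hM.finite
  have := finite_left ((regularR φ).tensor U)
  have := projective_right_regularR_tensor hφ hex hq hX hU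
  have hMl : Module.Projective A ((regularR φ).tensor U).left :=
    (isSyzygy_left hM).projective ((hasProjectiveDimensionLT_one_iff.2
      (inferInstanceAs (Module.Projective A (regularR φ).left))).mono (by omega))
  have hT : TorIndependent (regularR φ) (regularL φ) :=
    torIndependent_regularL hφ hex hq
      (((torIndependent_relSyzygy hex hq hφ htor 0 le_rfl).of_equiv_right (tensorRegular X)))
  have h₁ := hT.isSyzygy_of_projective_right hM
  have h₂ := (TorIndependent.of_projective_right ((regularR φ).tensor U)
    (regularL φ)).isSyzygy_of_projective_left (isSyzygy_tensor_regularL hU)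
  have := finite_tensor (regularR φ) (regularL φ)
  have hL := h₁.trans h₂
  obtain ⟨L', hL', hext⟩ := IsSyzygy.exists_isProjectiveExtension_of_surjective (l := n + 1 + n)
    (mulHom_surjective φ (regular k A)) (hmul.mono (by omega)) hL
  have : Module.Finite (A ⊗[k] Aᵐᵒᵖ)
    (tensor ((regularR φ).tensor U) (U.tensor (regularL φ))) := hL.finite
  have : Module.Finite (A ⊗[k] Aᵐᵒᵖ) L' := hL'.finite
  exact ⟨L', hL', hext.stablyIsomorphic⟩

theorem singularlyEquivalent_of_extension {n p : ℕ} (hX : HasProjectiveDimensionLT X (n + 1))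
    (htor : ∀ n m, 1 ≤ m → BalancedTensor.TorVanishing X.right n (tensorPow X m).left)
    (hpow : Subsingleton (tensorPow X p)) :
    SingularlyEquivalentOfMoritaTypeWithLevel k A B := by
  obtain ⟨r, hr⟩ := exists_hasProjectiveDimensionLT_relSyzygy hex hq hφ htor hX hpow
  -- A common bound for the dimensions of `X` and of the kernel of multiplication fixes the order of
  -- the syzygy `U`.
  have hX' : HasProjectiveDimensionLT X (max n r + 1) := hX.mono (by omega)
  obtain ⟨U, hU⟩ : ∃ U : KBimodule k B B, IsSyzygy (max n r + 1) (regular k B) U :=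
    exists_isSyzygy (max n r + 1) (regular k B)
  have hM := isSyzygy_regularR_tensor (φ := φ) hU
  have hN := isSyzygy_tensor_regularL (φ := φ) hU
  have hMf : Module.Finite (A ⊗[k] Bᵐᵒᵖ) ((regularR φ).tensor U) := hM.finite
  have hNf : Module.Finite (B ⊗[k] Aᵐᵒᵖ) (U.tensor (regularL φ)) := hN.finite
  exact ⟨max n r + 1 + (max n r + 1), (regularR φ).tensor U, U.tensor (regularL φ),
    { finite_M_left := finite_left _
      projective_M_left := (isSyzygy_left hM).projective ((hasProjectiveDimensionLT_one_iff.2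
        (inferInstanceAs (Module.Projective A (regularR φ).left))).mono (by omega))
      finite_M_right := finite_right _
      projective_M_right := projective_right_regularR_tensor hφ hex hq hX' hU
      finite_N_left := finite_left _
      projective_N_left := projective_left_tensor_regularL hφ hex hq hX' hU
      finite_N_right := finite_right _
      projective_N_right := (isSyzygy_right hN).projective ((hasProjectiveDimensionLT_one_iff.2
        (inferInstanceAs (Module.Projective Aᵐᵒᵖ (regularL φ).right))).mono (by omega))
      tensor_MN := stablyIsomorphic_regularR_tensor_tensor hφ hex hq hX' htor
        (hr.mono (by omega)) hU
      tensor_NM := stablyIsomorphic_tensor_regularL_tensor hφ hex hq hX' hU }⟩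

end Equivalence

end KBimodule

/-! ### The sequence `0 → B → A → A/B → 0` of a subalgebra. -/

namespace Subalgebra

open KBimodule

variable {k : Type v} [Field k] {A : Type u} [Ring A] [Algebra k A] (B : Subalgebra k A)

/-- The quotient map `A → A/B`, as a map of bimodules over `B`. -/
def ambientQuotient : ambient B.val →ₗ[B ⊗[k] Bᵐᵒᵖ] quotientBimodule B :=
  ofAddHom (M := ambient B.val) (M' := quotientBimodule B)
    -- `ambientBimodule` restricts both actions at once and `ambient` one side at a time. The
    -- underlying group is `A` in both, and only the formulas for the actions have to be compared.
    (B.subBimodule.mkQ.toAddMonoidHom : B.ambientBimodule →+ B.ambientBimodule ⧸ B.subBimodule)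
    (fun b (x : A) => congrArg B.subBimodule.mkQ ((ambient_left_smul B.val b x).trans
      (Eq.symm ((ambientBimodule_smul B b 1 x).trans (congrArg (_ * ·) (mul_one x))))))
    (fun b (x : A) => congrArg B.subBimodule.mkQ ((ambient_right_smul B.val b x).trans
      (Eq.symm ((ambientBimodule_smul B 1 b.unop x).trans
        (one_mul (M := A) (x * (b.unop : A)) : ((1 : B) : A) * (x * (b.unop : A)) = _)))))

theorem ambientQuotient_apply (x : A) :
    ambientQuotient B (show ambient B.val from x) =
      B.subBimodule.mkQ (show B.ambientBimodule from x) := rfl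

theorem ambientQuotient_surjective : Function.Surjective (ambientQuotient B) := fun y => by
  obtain ⟨x, hx⟩ := B.subBimodule.mkQ_surjective y
  exact ⟨show ambient B.val from x, (ambientQuotient_apply B x).trans hx⟩

theorem exact_unitMap_ambientQuotient :
    Function.Exact (unitMap B.val) (ambientQuotient B) := fun x => by
  have h : B.subBimodule.mkQ (show B.ambientBimodule from x) = 0 ↔
      (show B.ambientBimodule from x) ∈ B.subBimodule := Submodule.Quotient.mk_eq_zero _
  exact h.trans ⟨fun h => ⟨(⟨x, h⟩ : B), rfl⟩,
    fun ⟨b, hb⟩ => hb ▸ Subtype.property (p := (· ∈ B)) b⟩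

end Subalgebra

end

theorem theorem3p4 {k : Type v} [Field k] {A : Type u} [Ring A] [Algebra k A]
    [FiniteDimensional k A] (B : Subalgebra k A)
    (hpd : projectiveDimension (Subalgebra.quotientBimodule B) < ⊤)
    (hpow : ∃ p : ℕ, Limits.IsZero ((Subalgebra.quotientBimodule B).tensorPow p))
    (htor : ∀ i j : ℕ, 1 ≤ i → 1 ≤ j →
      Limits.IsZero (ncTor B i (Subalgebra.quotientBimodule B).right
        ((Subalgebra.quotientBimodule B).tensorPow j).left)) :
    SingularlyEquivalentOfMoritaTypeWithLevel k A B := by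
  obtain ⟨p, hp⟩ := hpow
  -- The bound obtained is dimension at most `n`, which unfolds to the strict bound `n + 1`.
  obtain ⟨n, hn'⟩ := (projectiveDimension_ne_top_iff _).1 hpd.ne
  exact KBimodule.singularlyEquivalent_of_extension Subtype.val_injective
    B.exact_unitMap_ambientQuotient B.ambientQuotient_surjective hn'
    (fun n m hm => BalancedTensor.torVanishing_of_isZero_ncTor (fun i hi => htor i m hi hm) n)
    (ModuleCat.subsingleton_of_isZero hp)
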